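/- Let $(M_p)_{p\ge 0}$ be a sequence of positive reals with $M_0=1$ and $m_p:=M_p/M_{p-1}\to\infty$, satisfying - $(M.1)$: $M_p^2\le M_{p-1}M_{p+1}$ for $p\ge 1$; - $(M.2)$: $M_{p+q}\le A H^{p+q}M_pM_q$ for all $p,q\ge 0$ and some $A,H\ge 1$; - $(M.2)^*$: there is an integer $Q\ge 1$ such that $2m_p\le m_{pQ}$ for all sufficiently large $p$; - $(QA)$: $\sum_{p\ge 1}1/m_p=\infty$; - $(NE)$: $p!\le C h^pM_p$ for all $p\ge 0$ and some $C,h>0$. Let $M(t)=\sup_{p\ge 0}\log(t^p/M_p)$ for $t>0$ and $M(0)=0$. For $h>0$, $K\subset\mathbb R^d$ compact and $f$ smooth near $K$ put $\|f\|_{K,h}=\sup_{\alpha}\sup_{x\in K}|f^{(\alpha)}(x)|/(h^{|\alpha|}M_{|\alpha|})$. For $\Omega\subseteq\mathbb R^d$ open let $\mathcal E^{\{M_p\}}(\Omega)$ be the space of $f\in C^\infty(\Omega;\mathbb C)$ such that for every compact $K\subset\Omega$ there is $h>0$ with $\|f\|_{K,h}<\infty$. A sequence $(f_n)_{n\ge1}$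 in $\mathcal E^{\{M_p\}}(\Omega)$ is called moderate if for every compact $K\subset\Omega$ and every $\lambda>0$ there is $h>0$ with $\sup_n\|f_n\|_{K,h}e^{-M(\lambda n)}<\infty$, and negligible if for every compact $K\subset\Omega$ there are $\lambda>0$ and $h>0$ with $\sup_n\|f_n\|_{K,h}e^{M(\lambda n)}<\infty$. Let $\mathcal G^{\{M_p\}}(\Omega)$ be the quotient of the algebra of moderate sequences (with pointwise operations) by the ideal of negligible ones, with the restriction maps $[(f_n)_n]|_{\Omega'}=[(f_n|_{\Omega'})_n]$ for $\Omega'\subseteq\Omega$. Then $\mathcal G^{\{M_p\}}$ is a soft sheaf of algebras on $\mathbb R^d$. That is, it is a sheaf, and for every closed set $Z\subseteq\mathbb R^d$, every open $U\supseteq Z$ and every $f\in\mathcal G^{\{M_p\}}(U)$ there are $g\in\mathcal G^{\{M_p\}}(\mathbb R^d)$ and an open $V$ with $Z\subseteq V\subseteq U$ such that $g|_V=f|_V$. In particular, if $\Omega,\Omega'\subseteq\mathbb R^d$ are open, $\overline{\Omega'}$ is compact and $\overline{\Omega'}\subset\Omega$, then for every $f\in\mathcal G^{\{M_p\}}(\Omega)$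 there is $g\in\mathcal G^{\{M_p\}}(\mathbb R^d)$ with $g|_{\Omega'}=f|_{\Omega'}$. -/

import Mathlib

open Set Filter Topology TopologicalSpace CategoryTheory Opposite
open scoped ContDiff

/-- A weight sequence: a sequence of positive reals `(M_p)_{p ≥ 0}` with `M_0 = 1` and
`m_p = M_p / M_{p-1} → ∞`. -/
structure WeightSequence where
  M : ℕ → ℝ
  pos : ∀ p, 0 < M p
  zero : M 0 = 1
  tendsto_ratio : Tendsto (fun p : ℕ => M (p + 1) / M p) atTop atTop

namespace WeightSequence

/-- The quotients `m_p = M_p / M_{p-1}`, used for `p ≥ 1` only. -/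
noncomputable def ratio (W : WeightSequence) (p : ℕ) : ℝ := W.M p / W.M (p - 1)

/-- `(M.1)`: logarithmic convexity. -/
def M1 (W : WeightSequence) : Prop :=
  ∀ p : ℕ, 1 ≤ p → W.M p ^ 2 ≤ W.M (p - 1) * W.M (p + 1)

/-- `(M.2)`: stability under ultradifferential operators. -/
def M2 (W : WeightSequence) : Prop :=
  ∃ A H : ℝ, 1 ≤ A ∧ 1 ≤ H ∧ ∀ p q : ℕ, W.M (p + q) ≤ A * H ^ (p + q) * W.M p * W.M q

/-- `(M.2)*`: there is a positive integer `Q` with `2 m_p ≤ m_{pQ}` for all large `p`. -/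
def M2Star (W : WeightSequence) : Prop :=
  ∃ Q : ℕ, 1 ≤ Q ∧ ∀ᶠ p : ℕ in atTop, 2 * W.ratio p ≤ W.ratio (p * Q)

/-- `(QA)`: `∑_{p ≥ 1} 1 / m_p = ∞` (a series of positive terms). -/
def QA (W : WeightSequence) : Prop :=
  ¬ Summable (fun p : ℕ => 1 / W.ratio (p + 1))

/-- `(NE)`: `p! ≤ C h ^ p M_p`. -/
def NE (W : WeightSequence) : Prop :=
  ∃ C h : ℝ, 0 < C ∧ 0 < h ∧ ∀ p : ℕ, (p.factorial : ℝ) ≤ C * h ^ p * W.M p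

/-- The associated function `M(t) = sup_p log (t ^ p / M_p)` for `t > 0`, and `M(0) = 0`. The
supremum is finite because `m_p → ∞`. -/
noncomputable def assoc (W : WeightSequence) (t : ℝ) : ℝ :=
  if t = 0 then 0 else ⨆ p : ℕ, Real.log (t ^ p / W.M p)

variable {d : ℕ}

/-- The iterated partial derivative `∂_{σ 0} ⋯ ∂_{σ (k-1)} f (x)`. For smooth `f` these, for
`σ : Fin k → Fin d`, are the derivatives `f^{(α)}(x)` with `|α| = k`. -/
noncomputable def partialDeriv (f : EuclideanSpace ℝ (Fin d) → ℂ) {k : ℕ} (σ : Fin k → Fin d)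
    (x : EuclideanSpace ℝ (Fin d)) : ℂ :=
  iteratedFDeriv ℝ k f x (fun i => EuclideanSpace.single (σ i) (1 : ℝ))

/-- `‖f‖_{K,h} ≤ C`, where `‖f‖_{K,h} = sup_α sup_{x ∈ K} |f^{(α)}(x)| / (h^{|α|} M_{|α|})`. -/
def NormLE (W : WeightSequence) (K : Set (EuclideanSpace ℝ (Fin d))) (h C : ℝ)
    (f : EuclideanSpace ℝ (Fin d) → ℂ) : Prop :=
  ∀ (k : ℕ) (σ : Fin k → Fin d), ∀ x ∈ K, ‖partialDeriv f σ x‖ ≤ C * (h ^ k * W.M k)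

/-- `f` is (on `Ω`) an ultradifferentiable function of class `{M_p}`. The values of `f` outside
the open set `Ω` play no role. -/
def IsUltradifferentiable (W : WeightSequence) (Ω : Opens (EuclideanSpace ℝ (Fin d)))
    (f : EuclideanSpace ℝ (Fin d) → ℂ) : Prop :=
  ContDiffOn ℝ ∞ f Ω ∧
    ∀ K : Set (EuclideanSpace ℝ (Fin d)), IsCompact K → K ⊆ Ω →
      ∃ h : ℝ, 0 < h ∧ ∃ C : ℝ, W.NormLE K h C f

/-- `{M_p}`-moderate sequences on `Ω`. -/
def IsModerate (W : WeightSequence) (Ω : Opens (EuclideanSpace ℝ (Fin d)))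
    (f : ℕ+ → EuclideanSpace ℝ (Fin d) → ℂ) : Prop :=
  (∀ n, W.IsUltradifferentiable Ω (f n)) ∧
    ∀ K : Set (EuclideanSpace ℝ (Fin d)), IsCompact K → K ⊆ Ω → ∀ lam : ℝ, 0 < lam →
      ∃ h : ℝ, 0 < h ∧ ∃ C : ℝ, ∀ n : ℕ+,
        W.NormLE K h (C * Real.exp (W.assoc (lam * (n : ℝ)))) (f n)

/-- `{M_p}`-negligible sequences on `Ω`. -/
def IsNegligible (W : WeightSequence) (Ω : Opens (EuclideanSpace ℝ (Fin d)))
    (f : ℕ+ → EuclideanSpace ℝ (Fin d) → ℂ) : Prop :=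
  (∀ n, W.IsUltradifferentiable Ω (f n)) ∧
    ∀ K : Set (EuclideanSpace ℝ (Fin d)), IsCompact K → K ⊆ Ω →
      ∃ lam : ℝ, 0 < lam ∧ ∃ h : ℝ, 0 < h ∧ ∃ C : ℝ, ∀ n : ℕ+,
        W.NormLE K h (C * Real.exp (-W.assoc (lam * (n : ℝ)))) (f n)

/-! Elementary facts showing that moderate sequences form an algebra and negligible ones an
ideal in it. -/

theorem NormLE.mono {W : WeightSequence} {K : Set (EuclideanSpace ℝ (Fin d))} {h h' C C' : ℝ}
    {f : EuclideanSpace ℝ (Fin d) → ℂ} (hf : W.NormLE K h C f) (h0 : 0 ≤ h) (hh : h ≤ h')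
    (hC : C ≤ C') (hC' : 0 ≤ C') : W.NormLE K h' C' f := by
  intro k σ x hx
  refine (hf k σ x hx).trans ?_
  have := (W.pos k).le
  gcongr

theorem NormLE.add {W : WeightSequence} {Ω : Opens (EuclideanSpace ℝ (Fin d))}
    {K : Set (EuclideanSpace ℝ (Fin d))} (hK : K ⊆ Ω) {h C C' : ℝ}
    {f g : EuclideanSpace ℝ (Fin d) → ℂ} (cf : ContDiffOn ℝ ∞ f Ω) (cg : ContDiffOn ℝ ∞ g Ω)
    (hf : W.NormLE K h C f) (hg : W.NormLE K h C' g) : W.NormLE K h (C + C') (f + g) := by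
  intro k σ x hx
  have hx' : (Ω : Set (EuclideanSpace ℝ (Fin d))) ∈ 𝓝 x := Ω.isOpen.mem_nhds (hK hx)
  have h1 : ContDiffAt ℝ k f x := (cf.contDiffAt hx').of_le (by exact_mod_cast le_top)
  have h2 : ContDiffAt ℝ k g x := (cg.contDiffAt hx').of_le (by exact_mod_cast le_top)
  unfold partialDeriv
  rw [iteratedFDeriv_add_apply h1 h2, ContinuousMultilinearMap.add_apply, add_mul]
  exact (norm_add_le _ _).trans (add_le_add (hf k σ x hx) (hg k σ x hx))

theorem norm_iteratedFDeriv_le_of_partialDeriv {f : EuclideanSpace ℝ (Fin d) → ℂ} {k : ℕ}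
    {x : EuclideanSpace ℝ (Fin d)} {B : ℝ} (hB : 0 ≤ B)
    (hf : ∀ σ : Fin k → Fin d, ‖partialDeriv f σ x‖ ≤ B) :
    ‖iteratedFDeriv ℝ k f x‖ ≤ (d : ℝ) ^ k * B := by
  refine ContinuousMultilinearMap.opNorm_le_bound (by positivity) fun v => ?_
  have hv : v = fun i => ∑ j : Fin d, v i j • EuclideanSpace.single j (1 : ℝ) := by
    funext i
    have := (EuclideanSpace.basisFun (Fin d) ℝ).sum_repr (v i)
    simpa using this.symm
  have hs : iteratedFDeriv ℝ k f x v
      = ∑ σ : Fin k → Fin d, (∏ i, v i (σ i)) • partialDeriv f σ x := by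
    conv_lhs => rw [hv]
    rw [ContinuousMultilinearMap.map_sum]
    refine Finset.sum_congr rfl fun σ _ => ?_
    rw [ContinuousMultilinearMap.map_smul_univ]
    rfl
  rw [hs]
  refine (norm_sum_le _ _).trans ?_
  have : ∀ σ ∈ (Finset.univ : Finset (Fin k → Fin d)),
      ‖(∏ i, v i (σ i)) • partialDeriv f σ x‖ ≤ (∏ i, ‖v i‖) * B := by
    intro σ _
    rw [norm_smul, norm_prod]
    refine mul_le_mul ?_ (hf σ) (norm_nonneg _) (Finset.prod_nonneg fun _ _ => norm_nonneg _)
    exact Finset.prod_le_prod (fun _ _ => norm_nonneg _) fun i _ => PiLp.norm_apply_le (v i) (σ i)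
  refine (Finset.sum_le_sum this).trans (le_of_eq ?_)
  simp
  ring

theorem norm_partialDeriv_le (f : EuclideanSpace ℝ (Fin d) → ℂ) {k : ℕ} (σ : Fin k → Fin d)
    (x : EuclideanSpace ℝ (Fin d)) : ‖partialDeriv f σ x‖ ≤ ‖iteratedFDeriv ℝ k f x‖ := by
  refine (ContinuousMultilinearMap.le_opNorm _ _).trans ?_
  simp

theorem M1.ratio_mono {W : WeightSequence} (h : W.M1) :
    Monotone fun p : ℕ => W.M (p + 1) / W.M p := by
  refine monotone_nat_of_le_succ fun p => ?_
  have := h (p + 1) (by omega)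
  rw [div_le_div_iff₀ (W.pos _) (W.pos _)]
  simpa [sq, mul_comm] using this

theorem M1.mul_le {W : WeightSequence} (h : W.M1) (p q : ℕ) :
    W.M p * W.M q ≤ W.M (p + q) := by
  induction q with
  | zero => simp [W.zero]
  | succ q ih =>
    have h1 := h.ratio_mono (show q ≤ p + q by omega)
    simp only at h1
    rw [div_le_div_iff₀ (W.pos _) (W.pos _)] at h1
    have hq := W.pos q
    have h2 : W.M p * W.M q * W.M (q + 1) ≤ W.M (p + (q + 1)) * W.M q := by
      rw [show p + (q + 1) = p + q + 1 by ring]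
      nlinarith [W.pos (q + 1), mul_le_mul_of_nonneg_right ih (W.pos (q + 1)).le]
    nlinarith

theorem NormLE.mul {W : WeightSequence} (hM1 : W.M1) {Ω : Opens (EuclideanSpace ℝ (Fin d))}
    {K : Set (EuclideanSpace ℝ (Fin d))} (hK : K ⊆ Ω) {h h' C C' : ℝ} (h0 : 0 ≤ h)
    (h0' : 0 ≤ h') (hC : 0 ≤ C) (hC' : 0 ≤ C')
    {f g : EuclideanSpace ℝ (Fin d) → ℂ} (cf : ContDiffOn ℝ ∞ f Ω) (cg : ContDiffOn ℝ ∞ g Ω)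
    (hf : W.NormLE K h C f) (hg : W.NormLE K h' C' g) :
    W.NormLE K (d * (h + h')) (C * C') (f * g) := by
  intro k σ x hx
  have hxΩ := hK hx
  refine (norm_partialDeriv_le _ _ _).trans ?_
  have key := norm_iteratedFDerivWithin_mul_le (𝕜 := ℝ) cf cg Ω.isOpen.uniqueDiffOn hxΩ (n := k)
    (by exact_mod_cast le_top)
  simp only [iteratedFDerivWithin_of_isOpen _ Ω.isOpen hxΩ] at key
  refine key.trans ?_
  have e : C * C' * ((d * (h + h')) ^ k * W.M k)
      = ∑ i ∈ Finset.range (k + 1), (k.choose i : ℝ) *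
        (h ^ i * h' ^ (k - i) * (C * C' * (d : ℝ) ^ k * W.M k)) := by
    rw [mul_pow, add_pow, Finset.mul_sum, Finset.sum_mul, Finset.mul_sum]
    exact Finset.sum_congr rfl fun i _ => by ring
  rw [e]
  refine Finset.sum_le_sum fun i hi => ?_
  have hik : i + (k - i) = k := by have := Finset.mem_range.1 hi; omega
  have b1 := norm_iteratedFDeriv_le_of_partialDeriv
    (B := C * (h ^ i * W.M i)) (by have := W.pos i; positivity) fun σ => hf i σ x hx
  have b2 := norm_iteratedFDeriv_le_of_partialDeriv
    (B := C' * (h' ^ (k - i) * W.M (k - i))) (by have := W.pos (k - i); positivity)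
    fun σ => hg (k - i) σ x hx
  have b3 := hM1.mul_le i (k - i)
  rw [hik] at b3
  rw [mul_assoc]
  refine mul_le_mul_of_nonneg_left ?_ (Nat.cast_nonneg _)
  refine (mul_le_mul b1 b2 (norm_nonneg _)
    (by have := W.pos i; positivity)).trans ?_
  calc _ = h ^ i * h' ^ (k - i) * (C * C' * (d : ℝ) ^ (i + (k - i)) * (W.M i * W.M (k - i))) := by
        rw [pow_add]; ring
    _ ≤ _ := by
        rw [hik]
        gcongr

theorem bddAbove_assoc (W : WeightSequence) {t : ℝ} (ht : 0 < t) :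
    BddAbove (range fun p : ℕ => Real.log (t ^ p / W.M p)) := by
  obtain ⟨N, hN⟩ := eventually_atTop.1 (W.tendsto_ratio.eventually_ge_atTop t)
  have hanti : ∀ p, N ≤ p → Real.log (t ^ p / W.M p) ≤ Real.log (t ^ N / W.M N) := by
    intro p hp
    induction p, hp using Nat.le_induction with
    | base => exact le_rfl
    | succ p hp ih =>
      refine le_trans (Real.log_le_log (div_pos (by positivity) (W.pos _)) ?_) ih
      have h1 := hN p hp
      rw [le_div_iff₀ (W.pos p)] at h1
      rw [div_le_div_iff₀ (W.pos _) (W.pos _), pow_succ]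
      have : 0 < t ^ p := by positivity
      nlinarith
  obtain ⟨B, hB⟩ := ((Finset.range (N + 1)).image
    fun p : ℕ => Real.log (t ^ p / W.M p)).bddAbove
  refine ⟨B, ?_⟩
  rintro _ ⟨p, rfl⟩
  have hNB : Real.log (t ^ N / W.M N) ≤ B := hB (by simp; exact ⟨N, by omega, rfl⟩)
  rcases le_total N p with h | h
  · exact (hanti p h).trans hNB
  · exact hB (by simp; exact ⟨p, by omega, rfl⟩)

theorem le_assoc (W : WeightSequence) {t : ℝ} (ht : 0 < t) (p : ℕ) :
    Real.log (t ^ p / W.M p) ≤ W.assoc t := by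
  rw [assoc, if_neg ht.ne']
  exact le_ciSup (W.bddAbove_assoc ht) p

theorem assoc_nonneg (W : WeightSequence) {t : ℝ} (ht : 0 < t) : 0 ≤ W.assoc t := by
  simpa [W.zero] using W.le_assoc ht 0

theorem M2.exists_assoc {W : WeightSequence} (hM2 : W.M2) :
    ∃ H L : ℝ, 0 < H ∧ ∀ t : ℝ, 0 < t → W.assoc (t / H) + W.assoc (t / H) ≤ W.assoc t + L := by
  obtain ⟨A, H, hA, hH, hAH⟩ := hM2
  have hA0 : 0 < A := by linarith
  have hH0 : 0 < H := by linarith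
  refine ⟨H, Real.log A, hH0, fun t ht => ?_⟩
  have ht' : 0 < t / H := by positivity
  have step : ∀ p q : ℕ, Real.log ((t / H) ^ p / W.M p) + Real.log ((t / H) ^ q / W.M q)
      ≤ W.assoc t + Real.log A := by
    intro p q
    refine le_trans ?_ (add_le_add_left (W.le_assoc ht (p + q)) _)
    have hp := W.pos p
    have hq := W.pos q
    have hpq := W.pos (p + q)
    rw [← Real.log_mul (by positivity) (by positivity),
      ← Real.log_mul (by positivity) (by positivity)]
    refine Real.log_le_log (by positivity) ?_
    have h1 := hAH p q
    rw [div_pow, div_pow, div_div, div_div, div_mul_div_comm, div_mul_eq_mul_div,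
      div_le_div_iff₀ (by positivity) (by positivity), ← pow_add]
    have : 0 < t ^ (p + q) := by positivity
    calc t ^ (p + q) * W.M (p + q) ≤ t ^ (p + q) * (A * H ^ (p + q) * W.M p * W.M q) := by gcongr
      _ = _ := by rw [pow_add H]; ring
  have h1 : ∀ p : ℕ, Real.log ((t / H) ^ p / W.M p) ≤ W.assoc t + Real.log A - W.assoc (t / H) := by
    intro p
    have : W.assoc (t / H) ≤ W.assoc t + Real.log A - Real.log ((t / H) ^ p / W.M p) := by
      conv_lhs => rw [assoc, if_neg ht'.ne']
      exact ciSup_le fun q => by linarith [step p q]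
    linarith
  have : W.assoc (t / H) ≤ W.assoc t + Real.log A - W.assoc (t / H) := by
    conv_lhs => rw [assoc, if_neg ht'.ne']
    exact ciSup_le h1
  linarith

theorem NormLE.const (W : WeightSequence) (K : Set (EuclideanSpace ℝ (Fin d))) (c : ℂ) :
    W.NormLE K 1 ‖c‖ (fun _ => c) := by
  intro k σ x _
  have := W.pos k
  rcases Nat.eq_zero_or_pos k with rfl | hk
  · simp [partialDeriv, W.zero]
  · rw [partialDeriv, iteratedFDeriv_const_of_ne hk.ne']
    simp only [Pi.zero_apply, ContinuousMultilinearMap.zero_apply, norm_zero]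
    positivity

theorem IsUltradifferentiable.const (W : WeightSequence)
    (Ω : Opens (EuclideanSpace ℝ (Fin d))) (c : ℂ) :
    W.IsUltradifferentiable Ω (fun _ => c) :=
  ⟨contDiffOn_const, fun K _ _ => ⟨1, one_pos, ‖c‖, NormLE.const W K c⟩⟩

theorem IsUltradifferentiable.add {W : WeightSequence} {Ω : Opens (EuclideanSpace ℝ (Fin d))}
    {f g : EuclideanSpace ℝ (Fin d) → ℂ} (hf : W.IsUltradifferentiable Ω f)
    (hg : W.IsUltradifferentiable Ω g) : W.IsUltradifferentiable Ω (f + g) := by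
  refine ⟨hf.1.add hg.1, fun K hK hKΩ => ?_⟩
  obtain ⟨h, h0, C, b⟩ := hf.2 K hK hKΩ
  obtain ⟨h', h0', C', b'⟩ := hg.2 K hK hKΩ
  exact ⟨max h h', lt_max_of_lt_left h0, |C| + |C'|,
    NormLE.add hKΩ hf.1 hg.1
      (b.mono h0.le (le_max_left _ _) (le_abs_self _) (abs_nonneg _))
      (b'.mono h0'.le (le_max_right _ _) (le_abs_self _) (abs_nonneg _))⟩

theorem IsUltradifferentiable.mul {W : WeightSequence} (hM1 : W.M1)
    {Ω : Opens (EuclideanSpace ℝ (Fin d))}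
    {f g : EuclideanSpace ℝ (Fin d) → ℂ} (hf : W.IsUltradifferentiable Ω f)
    (hg : W.IsUltradifferentiable Ω g) : W.IsUltradifferentiable Ω (f * g) := by
  refine ⟨hf.1.mul hg.1, fun K hK hKΩ => ?_⟩
  obtain ⟨h, h0, C, b⟩ := hf.2 K hK hKΩ
  obtain ⟨h', h0', C', b'⟩ := hg.2 K hK hKΩ
  refine ⟨d * (h + h') + 1, by positivity, |C| * |C'|, ?_⟩
  exact (NormLE.mul hM1 hKΩ h0.le h0'.le (abs_nonneg _) (abs_nonneg _) hf.1 hg.1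
    (b.mono h0.le le_rfl (le_abs_self _) (abs_nonneg _))
    (b'.mono h0'.le le_rfl (le_abs_self _) (abs_nonneg _))).mono (by positivity)
      (by linarith) le_rfl (by positivity)

theorem IsModerate.const (W : WeightSequence)
    (Ω : Opens (EuclideanSpace ℝ (Fin d))) (c : ℂ) : W.IsModerate Ω (fun _ _ => c) := by
  refine ⟨fun _ => .const W Ω c, fun K _ _ lam hlam => ⟨1, one_pos, ‖c‖, fun n => ?_⟩⟩
  have hn : (0 : ℝ) < lam * (n : ℝ) := by have := n.pos; positivity
  refine (NormLE.const W K c).mono zero_le_one le_rfl ?_ (by positivity)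
  exact le_mul_of_one_le_right (norm_nonneg _) (Real.one_le_exp (W.assoc_nonneg hn))

theorem IsModerate.add {W : WeightSequence} {Ω : Opens (EuclideanSpace ℝ (Fin d))}
    {f g : ℕ+ → EuclideanSpace ℝ (Fin d) → ℂ} (hf : W.IsModerate Ω f)
    (hg : W.IsModerate Ω g) : W.IsModerate Ω (f + g) := by
  refine ⟨fun n => (hf.1 n).add (hg.1 n), fun K hK hKΩ lam hlam => ?_⟩
  obtain ⟨h, h0, C, b⟩ := hf.2 K hK hKΩ lam hlam
  obtain ⟨h', h0', C', b'⟩ := hg.2 K hK hKΩ lam hlam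
  refine ⟨max h h', lt_max_of_lt_left h0, |C| + |C'|, fun n => ?_⟩
  rw [add_mul]
  exact NormLE.add hKΩ (hf.1 n).1 (hg.1 n).1
      ((b n).mono h0.le (le_max_left _ _) (by gcongr; exact le_abs_self _) (by positivity))
      ((b' n).mono h0'.le (le_max_right _ _) (by gcongr; exact le_abs_self _) (by positivity))

theorem IsModerate.mul {W : WeightSequence} (hM1 : W.M1) (hM2 : W.M2)
    {Ω : Opens (EuclideanSpace ℝ (Fin d))}
    {f g : ℕ+ → EuclideanSpace ℝ (Fin d) → ℂ} (hf : W.IsModerate Ω f)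
    (hg : W.IsModerate Ω g) : W.IsModerate Ω (f * g) := by
  refine ⟨fun n => (hf.1 n).mul hM1 (hg.1 n), fun K hK hKΩ lam hlam => ?_⟩
  obtain ⟨H, L, hH, hL⟩ := hM2.exists_assoc
  obtain ⟨h, h0, C, b⟩ := hf.2 K hK hKΩ (lam / H) (by positivity)
  obtain ⟨h', h0', C', b'⟩ := hg.2 K hK hKΩ (lam / H) (by positivity)
  refine ⟨d * (h + h') + 1, by positivity, |C| * |C'| * Real.exp L, fun n => ?_⟩
  have hn : (0 : ℝ) < lam * (n : ℝ) := by have := n.pos; positivity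
  have e := Real.exp_le_exp.2 (hL _ hn)
  rw [← div_mul_eq_mul_div, Real.exp_add, Real.exp_add] at e
  refine (NormLE.mul hM1 hKΩ h0.le h0'.le (by positivity) (by positivity) (hf.1 n).1 (hg.1 n).1
    ((b n).mono h0.le le_rfl (mul_le_mul_of_nonneg_right (le_abs_self _) (Real.exp_pos _).le)
      (by positivity))
    ((b' n).mono h0'.le le_rfl (mul_le_mul_of_nonneg_right (le_abs_self _) (Real.exp_pos _).le)
      (by positivity))).mono (by positivity) (by linarith) ?_ (by positivity)
  calc _ = |C| * |C'| * (Real.exp (W.assoc (lam / H * n)) * Real.exp (W.assoc (lam / H * n))) := by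
        ring
    _ ≤ |C| * |C'| * (Real.exp (W.assoc (lam * n)) * Real.exp L) := by gcongr
    _ = _ := by ring

theorem IsNegligible.zero (W : WeightSequence) (Ω : Opens (EuclideanSpace ℝ (Fin d))) :
    W.IsNegligible Ω (0 : ℕ+ → EuclideanSpace ℝ (Fin d) → ℂ) := by
  refine ⟨fun _ => .const W Ω 0, fun K _ _ => ⟨1, one_pos, 1, one_pos, 0, fun n => ?_⟩⟩
  have := NormLE.const W K (0 : ℂ)
  rw [norm_zero] at this
  rw [zero_mul]
  exact this

theorem assoc_mono (W : WeightSequence) {s t : ℝ} (hs : 0 < s) (hst : s ≤ t) :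
    W.assoc s ≤ W.assoc t := by
  conv_lhs => rw [assoc, if_neg hs.ne']
  refine ciSup_le fun p => le_trans ?_ (W.le_assoc (hs.trans_le hst) p)
  have := W.pos p
  exact Real.log_le_log (by positivity) (by gcongr)

theorem IsNegligible.add {W : WeightSequence} {Ω : Opens (EuclideanSpace ℝ (Fin d))}
    {f g : ℕ+ → EuclideanSpace ℝ (Fin d) → ℂ} (hf : W.IsNegligible Ω f)
    (hg : W.IsNegligible Ω g) : W.IsNegligible Ω (f + g) := by
  refine ⟨fun n => (hf.1 n).add (hg.1 n), fun K hK hKΩ => ?_⟩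
  obtain ⟨l, l0, h, h0, C, b⟩ := hf.2 K hK hKΩ
  obtain ⟨l', l0', h', h0', C', b'⟩ := hg.2 K hK hKΩ
  refine ⟨min l l', lt_min l0 l0', max h h', lt_max_of_lt_left h0, |C| + |C'|, fun n => ?_⟩
  have hn : (0 : ℝ) < (n : ℝ) := by exact_mod_cast n.pos
  have hm : 0 < min l l' * (n : ℝ) := mul_pos (lt_min l0 l0') hn
  have e : Real.exp (-W.assoc (l * n)) ≤ Real.exp (-W.assoc (min l l' * n)) :=
    Real.exp_le_exp.2 (neg_le_neg (W.assoc_mono hm (by gcongr; exact min_le_left _ _)))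
  have e' : Real.exp (-W.assoc (l' * n)) ≤ Real.exp (-W.assoc (min l l' * n)) :=
    Real.exp_le_exp.2 (neg_le_neg (W.assoc_mono hm (by gcongr; exact min_le_right _ _)))
  rw [add_mul]
  exact NormLE.add hKΩ (hf.1 n).1 (hg.1 n).1
      ((b n).mono h0.le (le_max_left _ _)
        (mul_le_mul (le_abs_self _) e (Real.exp_pos _).le (abs_nonneg _)) (by positivity))
      ((b' n).mono h0'.le (le_max_right _ _)
        (mul_le_mul (le_abs_self _) e' (Real.exp_pos _).le (abs_nonneg _)) (by positivity))

theorem IsNegligible.mul_left {W : WeightSequence} (hM1 : W.M1) (hM2 : W.M2)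
    {Ω : Opens (EuclideanSpace ℝ (Fin d))}
    {f g : ℕ+ → EuclideanSpace ℝ (Fin d) → ℂ} (hf : W.IsModerate Ω f)
    (hg : W.IsNegligible Ω g) : W.IsNegligible Ω (f * g) := by
  refine ⟨fun n => (hf.1 n).mul hM1 (hg.1 n), fun K hK hKΩ => ?_⟩
  obtain ⟨H, L, hH, hL⟩ := hM2.exists_assoc
  obtain ⟨l, l0, h', h0', C', b'⟩ := hg.2 K hK hKΩ
  obtain ⟨h, h0, C, b⟩ := hf.2 K hK hKΩ (l / H) (by positivity)
  refine ⟨l / H, by positivity, d * (h + h') + 1, by positivity, |C| * |C'| * Real.exp L,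
    fun n => ?_⟩
  have hn : (0 : ℝ) < l * (n : ℝ) := by have := n.pos; positivity
  have e := hL _ hn
  rw [← div_mul_eq_mul_div] at e
  have e2 : Real.exp (W.assoc (l / H * n)) * Real.exp (-W.assoc (l * n))
      ≤ Real.exp L * Real.exp (-W.assoc (l / H * n)) := by
    rw [← Real.exp_add, ← Real.exp_add]
    exact Real.exp_le_exp.2 (by linarith)
  refine (NormLE.mul hM1 hKΩ h0.le h0'.le (by positivity) (by positivity) (hf.1 n).1 (hg.1 n).1
    ((b n).mono h0.le le_rfl (mul_le_mul_of_nonneg_right (le_abs_self _) (Real.exp_pos _).le)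
      (by positivity))
    ((b' n).mono h0'.le le_rfl (mul_le_mul_of_nonneg_right (le_abs_self _) (Real.exp_pos _).le)
      (by positivity))).mono (by positivity) (by linarith) ?_ (by positivity)
  calc _ = |C| * |C'| * (Real.exp (W.assoc (l / H * n)) * Real.exp (-W.assoc (l * n))) := by
        ring
    _ ≤ |C| * |C'| * (Real.exp L * Real.exp (-W.assoc (l / H * n))) := by gcongr
    _ = _ := by ring

theorem IsUltradifferentiable.restrict {W : WeightSequence}
    {Ω Ω' : Opens (EuclideanSpace ℝ (Fin d))} (h : Ω' ≤ Ω)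
    {f : EuclideanSpace ℝ (Fin d) → ℂ} (hf : W.IsUltradifferentiable Ω f) :
    W.IsUltradifferentiable Ω' f :=
  ⟨hf.1.mono h, fun K hK hKΩ => hf.2 K hK (hKΩ.trans h)⟩

theorem IsModerate.restrict {W : WeightSequence}
    {Ω Ω' : Opens (EuclideanSpace ℝ (Fin d))} (h : Ω' ≤ Ω)
    {f : ℕ+ → EuclideanSpace ℝ (Fin d) → ℂ} (hf : W.IsModerate Ω f) : W.IsModerate Ω' f :=
  ⟨fun n => (hf.1 n).restrict h, fun K hK hKΩ => hf.2 K hK (hKΩ.trans h)⟩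

theorem IsNegligible.restrict {W : WeightSequence}
    {Ω Ω' : Opens (EuclideanSpace ℝ (Fin d))} (h : Ω' ≤ Ω)
    {f : ℕ+ → EuclideanSpace ℝ (Fin d) → ℂ} (hf : W.IsNegligible Ω f) : W.IsNegligible Ω' f :=
  ⟨fun n => (hf.1 n).restrict h, fun K hK hKΩ => hf.2 K hK (hKΩ.trans h)⟩

/-- The algebra of moderate sequences on `Ω` (pointwise operations). -/
def moderate (W : WeightSequence) (hM1 : W.M1) (hM2 : W.M2)
    (Ω : Opens (EuclideanSpace ℝ (Fin d))) :
    Subalgebra ℂ (ℕ+ → EuclideanSpace ℝ (Fin d) → ℂ) where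
  carrier := {f | W.IsModerate Ω f}
  mul_mem' hf hg := IsModerate.mul hM1 hM2 hf hg
  add_mem' hf hg := IsModerate.add hf hg
  algebraMap_mem' c := IsModerate.const W Ω c

/-- The ideal of negligible sequences on `Ω`. -/
def negligible (W : WeightSequence) (hM1 : W.M1) (hM2 : W.M2)
    (Ω : Opens (EuclideanSpace ℝ (Fin d))) : Ideal (W.moderate hM1 hM2 Ω) where
  carrier := {f | W.IsNegligible Ω f.1}
  add_mem' hf hg := IsNegligible.add hf hg
  zero_mem' := IsNegligible.zero W Ω
  smul_mem' f _ hg := IsNegligible.mul_left hM1 hM2 f.2 hg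

/-- The algebra `𝒢^{M_p}(Ω)` of generalized functions of class `{M_p}` on `Ω`. Representatives are
sequences of functions on the whole space of which only the restrictions to `Ω` matter: two of
them that agree on `Ω` differ by a negligible sequence. -/
abbrev GenFun (W : WeightSequence) (hM1 : W.M1) (hM2 : W.M2)
    (Ω : Opens (EuclideanSpace ℝ (Fin d))) : Type :=
  W.moderate hM1 hM2 Ω ⧸ W.negligible hM1 hM2 Ω

/-- The restriction `[(f_n)_n] ↦ [(f_n|Ω')_n]`. -/
noncomputable def restrictHom (W : WeightSequence) (hM1 : W.M1) (hM2 : W.M2)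
    {Ω Ω' : Opens (EuclideanSpace ℝ (Fin d))} (h : Ω' ≤ Ω) :
    W.GenFun hM1 hM2 Ω →ₐ[ℂ] W.GenFun hM1 hM2 Ω' :=
  Ideal.quotientMapₐ (W.negligible hM1 hM2 Ω')
    (Subalgebra.inclusion (S := W.moderate hM1 hM2 Ω) (T := W.moderate hM1 hM2 Ω')
      fun _ hf => IsModerate.restrict h hf)
    fun _ hf => IsNegligible.restrict h hf

/-- The presheaf of algebras `Ω ↦ 𝒢^{M_p}(Ω)` on `ℝ^d`. -/
noncomputable def genFunPresheaf (W : WeightSequence) (hM1 : W.M1) (hM2 : W.M2) (d : ℕ) :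
    TopCat.Presheaf (AlgCat.{0} ℂ) (TopCat.of (EuclideanSpace ℝ (Fin d))) where
  obj Ω := AlgCat.of ℂ (W.GenFun hM1 hM2 (d := d) Ω.unop)
  map i := AlgCat.ofHom (W.restrictHom hM1 hM2 i.unop.le)
  map_id Ω := by
    ext x
    obtain ⟨x, rfl⟩ := Ideal.Quotient.mk_surjective x
    rfl
  map_comp i j := by
    ext x
    obtain ⟨x, rfl⟩ := Ideal.Quotient.mk_surjective x
    rfl

end WeightSequence

/-- Softness of a (pre)sheaf of algebras `F` on a topological space `X`: every section of `F` over
a closed set `Z`, i.e. every germ along `Z` of a section over an open neighbourhood `U` of `Z`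
(two sections being identified if they agree on a neighbourhood of `Z`), extends to a global
section. -/
def IsSoftPresheaf {X : TopCat.{0}} (F : TopCat.Presheaf (AlgCat.{0} ℂ) X) : Prop :=
  ∀ Z : Set X, IsClosed Z → ∀ (U : Opens X), Z ⊆ U → ∀ s : F.obj (op U),
    ∃ (g : F.obj (op ⊤)) (V : Opens X) (hVU : V ≤ U), Z ⊆ V ∧
      F.map (homOfLE le_top : V ⟶ ⊤).op g = F.map (homOfLE hVU).op s

/-! ### The associated function and the consequences of (NE) -/

namespace WeightSequence

variable {W : WeightSequence} {d : ℕ}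

/-! Under (QA) the class has no cutoff functions (for `d ≥ 1`), so sections cannot be glued with a
partition of unity taken from the class. Cutoffs do exist as sequences. Convolving the indicator of
a set `S` with Gaussians of width `(Rn)^(-1/2)` gives analytic functions `χ_n` whose `j`-th
derivatives are bounded by a constant times `(Kn)^(j/2) √(j!)`. The square of this is `(Kn)^j j!`;
up to geometric factors one factor is at most `M_j e^{M(λn)}` for any `λ`, the other at most `M_j`
by (NE), so the sequence is moderate (`isModerate_cutoffSeq`). At distance `ε` from `S` it is of
size `e^{-cRε²n}`, hence negligible, because (NE) gives `M(t) ≤ Lt + const`. Moreover `1 - χ_n` is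
exactly the cutoff of the complement.

These cutoffs alone do not glue, since a representative is controlled only on its own open set. Near
a point, however, it can be replaced by a global sequence: expand `f_n` in tensor products of
Chebyshev polynomials on a small box and keep the degrees `|k| ≤ Rn`. By (M.1) and (NE) the
coefficients are `O(e^{M(n)} e^{-M(|k|/κ)})`; by (M.2) the discarded tail is negligible; the
truncations are polynomials of growth at most `e^{Cn(1+|x|²)}`
(`IsModerate.exists_hasEntireGrowth_sub`). Away from `S`, a cutoff with large `R` beats such growth,
so two local representatives can be combined (`Agrees.exists_combine`), and a compactness argument
yields one near every compact set.

Along an exhaustion `K_m` the approximants `G_m` can be chosen with `G_{m+1} - G_m` of size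
`e^{-mn}` well inside `K_m`; the diagonal sequence, which at index `n` uses `G_n`, then glues
everything (`exists_glue`). Uniqueness of gluing is the locality of negligibility. For softness,
`χf` on `U` is glued with `0` off the closure of a neighbourhood of `Z` on which `χ = 1` modulo
negligible sequences (`IsModerate.exists_extension`). -/

theorem pow_le_mul_exp_assoc (W : WeightSequence) {t : ℝ} (ht : 0 < t) (p : ℕ) :
    t ^ p ≤ W.M p * Real.exp (W.assoc t) := by
  have hp := W.pos p
  have h := Real.exp_le_exp.2 (W.le_assoc ht p)
  rwa [Real.exp_log (by positivity), div_le_iff₀ hp, mul_comm] at h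

theorem exp_assoc_le_of_pow_le (W : WeightSequence) {t B : ℝ} (ht : 0 < t) (hB : 0 < B)
    (h : ∀ p, t ^ p ≤ B * W.M p) : Real.exp (W.assoc t) ≤ B := by
  rw [← Real.le_log_iff_exp_le hB, assoc, if_neg ht.ne']
  refine ciSup_le fun p => Real.log_le_log (div_pos (by positivity) (W.pos p)) ?_
  rw [div_le_iff₀ (W.pos p)]
  exact h p

theorem NE.factorial_le (h : W.NE) :
    ∃ C L : ℝ, 1 ≤ C ∧ 1 ≤ L ∧ ∀ p : ℕ, (p.factorial : ℝ) ≤ C * L ^ p * W.M p := by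
  obtain ⟨C, L, hC, hL, hb⟩ := h
  refine ⟨max C 1, max L 1, le_max_right _ _, le_max_right _ _, fun p => (hb p).trans ?_⟩
  have := (W.pos p).le
  gcongr
  · exact le_max_left _ _
  · exact le_max_left _ _

/-- By (NE), `t^p / M_p ≤ C (Lt)^p / p! ≤ C e^{Lt}` for every `p`. -/
theorem NE.exp_assoc_le (h : W.NE) :
    ∃ C L : ℝ, 1 ≤ C ∧ 1 ≤ L ∧ ∀ t : ℝ, 0 < t → Real.exp (W.assoc t) ≤ C * Real.exp (L * t) := by
  obtain ⟨C, L, hC, hL, hb⟩ := h.factorial_le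
  refine ⟨C, L, hC, hL, fun t ht => ?_⟩
  refine W.exp_assoc_le_of_pow_le ht (by positivity) fun p => ?_
  have h1 := Real.pow_div_factorial_le_exp (L * t) (by positivity) p
  rw [div_le_iff₀ (by positivity), mul_pow] at h1
  have hLp : 0 < L ^ p := by positivity
  have h2 : L ^ p * t ^ p ≤ L ^ p * (C * Real.exp (L * t) * W.M p) := by
    calc L ^ p * t ^ p ≤ Real.exp (L * t) * p.factorial := h1
      _ ≤ Real.exp (L * t) * (C * L ^ p * W.M p) := by gcongr; exact hb p
      _ = _ := by ring
  exact le_of_mul_le_mul_left h2 hLp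

/-- Exponential decay in the index is therefore enough for negligibility; all later estimates are of
this analytic type. The value `lam = c / L` makes `M(lam n) ≤ cn + log C`. -/
theorem NE.exp_neg_le (h : W.NE) {c : ℝ} (hc : 0 < c) :
    ∃ lam C : ℝ, 0 < lam ∧ 0 < C ∧ ∀ n : ℕ+,
      Real.exp (-(c * (n : ℝ))) ≤ C * Real.exp (-W.assoc (lam * n)) := by
  obtain ⟨C, L, hC, hL, hb⟩ := h.exp_assoc_le
  have hL0 : 0 < L := by linarith
  refine ⟨c / L, C, by positivity, by linarith, fun n => ?_⟩
  have hn : (0 : ℝ) < n := by exact_mod_cast n.pos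
  have := hb (c / L * n) (by positivity)
  rw [show L * (c / L * n) = c * n by field_simp] at this
  rw [Real.exp_neg, Real.exp_neg, ← div_eq_mul_inv, inv_eq_one_div,
    div_le_div_iff₀ (by positivity) (by positivity)]
  linarith

/-- Almost analytic growth of the quotients: `q M_q ≤ c M_{q+1}`. -/
theorem NE.nat_mul_le (h : W.NE) (hM1 : W.M1) :
    ∃ c : ℝ, 1 ≤ c ∧ ∀ q : ℕ, (q : ℝ) * W.M q ≤ c * W.M (q + 1) := by
  obtain ⟨C, L, hC, hL, hb⟩ := h.factorial_le
  refine ⟨C * L * Real.exp 1, ?_, fun q => ?_⟩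
  · have : (1 : ℝ) ≤ Real.exp 1 := Real.one_le_exp zero_le_one
    nlinarith [mul_le_mul hC hL zero_le_one (by linarith),
      mul_le_mul (mul_le_mul hC hL zero_le_one (by linarith)) this zero_le_one (by positivity)]
  rcases Nat.eq_zero_or_pos q with rfl | hq
  · have := W.pos 1
    simp; positivity
  set r := W.M (q + 1) / W.M q with hr
  have hr0 : 0 < r := div_pos (W.pos _) (W.pos _)
  -- The quotients increase, so those up to index `q` are at most `r = m_{q+1}` and `M_q ≤ r^q`.
  -- Together with `q^q ≤ e^q q!` and (NE), a `q`-th root gives `q ≤ C L e r`.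
  have hpow : ∀ p ≤ q, W.M p ≤ r ^ p := by
    intro p hp
    induction p with
    | zero => simp [W.zero]
    | succ p ih =>
      have h1 := hM1.ratio_mono (show p ≤ q by omega)
      simp only at h1
      rw [← hr, div_le_iff₀ (W.pos p)] at h1
      rw [pow_succ, mul_comm]
      exact h1.trans (mul_le_mul_of_nonneg_left (ih (by omega)) hr0.le)
  have hq0 : (0 : ℝ) < q := by exact_mod_cast hq
  have h1 : (q : ℝ) ^ q ≤ (C * L * Real.exp 1 * r) ^ q := by
    have h2 := Real.pow_div_factorial_le_exp (q : ℝ) hq0.le q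
    rw [div_le_iff₀ (by positivity)] at h2
    calc (q : ℝ) ^ q ≤ Real.exp q * q.factorial := h2
      _ ≤ Real.exp q * (C * L ^ q * r ^ q) := by
          gcongr
          refine (hb q).trans ?_
          gcongr
          exact hpow q le_rfl
      _ ≤ Real.exp q * (C ^ q * L ^ q * r ^ q) := by
          gcongr
          exact le_self_pow₀ hC hq.ne'
      _ = _ := by
          rw [mul_pow, mul_pow, mul_pow, ← Real.exp_nat_mul, mul_one]; ring
  have h2 := le_of_pow_le_pow_left₀ hq.ne' (by positivity) h1
  rw [hr, ← mul_div_assoc, le_div_iff₀ (W.pos q)] at h2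
  exact h2

theorem summable_prod_apply {f : ℤ → ℝ} (hf : Summable f) (h0 : ∀ k, 0 ≤ f k) (d : ℕ) :
    Summable fun k : Fin d → ℤ => ∏ i, f (k i) := by
  induction d with
  | zero => exact Summable.of_finite
  | succ d ih =>
    have h1 := hf.mul_of_nonneg ih h0 fun k => Finset.prod_nonneg fun i _ => h0 _
    rw [← (Fin.consEquiv fun _ : Fin (d + 1) => ℤ).summable_iff]
    refine h1.congr fun x => ?_
    simp [Fin.prod_univ_succ, Fin.consEquiv]

/-- `e^{-M(t)}` decays faster than any power: the bound `M_{2d} t^{-2d}` already allows comparison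
with the summable product `∏ 1 / (1 + k_i²)`. -/
theorem summable_exp_neg_assoc (W : WeightSequence) (d : ℕ) {c : ℝ} (hc : 0 < c) :
    Summable fun k : Fin d → ℤ => Real.exp (-W.assoc (c * ‖k‖)) := by
  have h1 : Summable fun k : ℤ => 1 / (1 + (k : ℝ) ^ 2) := by
    have h2 : Summable fun k : ℤ => 1 / (k : ℝ) ^ 2 :=
      Real.summable_one_div_int_pow.2 (by norm_num)
    have h3 : Summable fun k : ℤ => 1 / (k : ℝ) ^ 2 + if k = 0 then (1 : ℝ) else 0 :=
      h2.add (summable_of_hasFiniteSupport ((Set.finite_singleton (0 : ℤ)).subset (by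
        intro k hk; by_contra h; simp at h; simp [h] at hk)))
    refine Summable.of_nonneg_of_le (fun k => by positivity) (fun k => ?_) h3
    rcases eq_or_ne k 0 with rfl | hk
    · simp
    · have : (0 : ℝ) < (k : ℝ) ^ 2 := by positivity
      simp only [hk, if_false, add_zero]
      exact one_div_le_one_div_of_le this (by linarith)
  have h2 := summable_prod_apply h1 (fun k => by positivity) d
  -- The entry `1` serves `k = 0`, where `assoc 0 = 0`; the other one serves `‖k‖ ≥ 1`.
  set B := max 1 (2 ^ d * W.M (2 * d) / c ^ (2 * d)) with hB
  refine Summable.of_nonneg_of_le (fun k => by positivity) (fun k => ?_) (h2.mul_left B)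
  have hprod : (0 : ℝ) < ∏ i, (1 + (k i : ℝ) ^ 2) :=
    Finset.prod_pos fun i _ => by positivity
  simp only [Finset.prod_div_distrib, Finset.prod_const_one]
  rw [mul_one_div, le_div_iff₀ hprod]
  rcases eq_or_ne k 0 with rfl | hk
  · simp [assoc, hB]
  have hk0 : 0 < ‖k‖ := norm_pos_iff.2 hk
  have hk1 : 1 ≤ ‖k‖ := by
    obtain ⟨i, hi⟩ := Function.ne_iff.1 hk
    refine le_trans ?_ (norm_le_pi_norm k i)
    rw [Int.norm_eq_abs]
    exact_mod_cast Int.one_le_abs hi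
  have h3 : ∏ i, (1 + (k i : ℝ) ^ 2) ≤ 2 ^ d * ‖k‖ ^ (2 * d) := by
    calc ∏ i, (1 + (k i : ℝ) ^ 2) ≤ ∏ _i : Fin d, (2 * ‖k‖ ^ 2) := by
          refine Finset.prod_le_prod (fun i _ => by positivity) fun i _ => ?_
          have : (k i : ℝ) ^ 2 ≤ ‖k‖ ^ 2 := by
            rw [← sq_abs (k i : ℝ), ← Int.norm_eq_abs]
            exact pow_le_pow_left₀ (norm_nonneg _) (norm_le_pi_norm k i) 2
          nlinarith
      _ = _ := by simp [mul_pow, pow_mul]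
  have h4 := W.pow_le_mul_exp_assoc (show 0 < c * ‖k‖ by positivity) (2 * d)
  rw [Real.exp_neg, inv_mul_le_iff₀ (Real.exp_pos _)]
  refine h3.trans (le_trans ?_ (mul_le_mul_of_nonneg_left (le_max_right _ _) (Real.exp_pos _).le))
  rw [mul_pow] at h4
  rw [← mul_div_assoc, le_div_iff₀ (by positivity)]
  have : (0 : ℝ) < 2 ^ d := by positivity
  nlinarith

end WeightSequence

/-- Leibniz' rule for bounds of the form `A a ^ j w_j` with a supermultiplicative weight `w`. -/
theorem norm_iteratedFDeriv_mul_le_of_bound {E : Type*} [NormedAddCommGroup E] [NormedSpace ℝ E]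
    {u v : E → ℂ} (hu : ContDiff ℝ ∞ u) (hv : ContDiff ℝ ∞ v) {w : ℕ → ℝ} (hw0 : ∀ j, 0 ≤ w j)
    (hw : ∀ i j, w i * w j ≤ w (i + j)) {A B a b : ℝ} (hA : 0 ≤ A) (hB : 0 ≤ B) (ha : 0 ≤ a)
    (hb : 0 ≤ b) {x : E} (h1 : ∀ j, ‖iteratedFDeriv ℝ j u x‖ ≤ A * (a ^ j * w j))
    (h2 : ∀ j, ‖iteratedFDeriv ℝ j v x‖ ≤ B * (b ^ j * w j)) (j : ℕ) :
    ‖iteratedFDeriv ℝ j (u * v) x‖ ≤ A * B * ((a + b) ^ j * w j) := by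
  refine (norm_iteratedFDeriv_mul_le hu hv x (n := j) (by exact_mod_cast le_top)).trans ?_
  have e : A * B * ((a + b) ^ j * w j)
      = ∑ i ∈ Finset.range (j + 1), (j.choose i : ℝ) * (a ^ i * b ^ (j - i) * (A * B * w j)) := by
    rw [add_pow, Finset.sum_mul, Finset.mul_sum]
    exact Finset.sum_congr rfl fun i _ => by ring
  rw [e]
  refine Finset.sum_le_sum fun i hi => ?_
  have hij : i + (j - i) = j := by have := Finset.mem_range.1 hi; omega
  rw [mul_assoc]
  refine mul_le_mul_of_nonneg_left ?_ (Nat.cast_nonneg _)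
  have hwi := hw0 i
  refine (mul_le_mul (h1 i) (h2 (j - i)) (norm_nonneg _) (by positivity)).trans ?_
  have := hw i (j - i)
  rw [hij] at this
  calc _ = a ^ i * b ^ (j - i) * (A * B * (w i * w (j - i))) := by ring
    _ ≤ _ := by gcongr

theorem factorial_mul_factorial_le (i j : ℕ) :
    (i.factorial : ℝ) * j.factorial ≤ (i + j).factorial := by
  exact_mod_cast Nat.le_of_dvd (Nat.factorial_pos _) (Nat.factorial_mul_factorial_dvd_factorial_add i j)

theorem sqrt_factorial_mul_le (i j : ℕ) :
    √(i.factorial : ℝ) * √(j.factorial : ℝ) ≤ √((i + j).factorial : ℝ) := by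
  rw [← Real.sqrt_mul (by positivity)]
  exact Real.sqrt_le_sqrt (factorial_mul_factorial_le i j)

namespace WeightSequence

variable {W : WeightSequence} {d : ℕ}

/-! ### Locality of moderateness and negligibility -/

theorem NormLE.union {K K' : Set (EuclideanSpace ℝ (Fin d))} {h C : ℝ}
    {f : EuclideanSpace ℝ (Fin d) → ℂ} (hK : W.NormLE K h C f) (hK' : W.NormLE K' h C f) :
    W.NormLE (K ∪ K') h C f := by
  rintro k σ x (hx | hx)
  · exact hK k σ x hx
  · exact hK' k σ x hx

theorem NormLE.mono_set {K K' : Set (EuclideanSpace ℝ (Fin d))} {h C : ℝ}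
    {f : EuclideanSpace ℝ (Fin d) → ℂ} (hf : W.NormLE K' h C f) (hK : K ⊆ K') :
    W.NormLE K h C f := fun k σ x hx => hf k σ x (hK hx)

theorem NormLE.neg {K : Set (EuclideanSpace ℝ (Fin d))} {h C : ℝ}
    {f : EuclideanSpace ℝ (Fin d) → ℂ} (hf : W.NormLE K h C f) : W.NormLE K h C (-f) := by
  intro k σ x hx
  have : partialDeriv (-f) σ x = -partialDeriv f σ x := by
    simp [partialDeriv, iteratedFDeriv_neg_apply]
  rw [this, norm_neg]
  exact hf k σ x hx

theorem IsNegligible.neg {Ω : Opens (EuclideanSpace ℝ (Fin d))}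
    {f : ℕ+ → EuclideanSpace ℝ (Fin d) → ℂ} (hf : W.IsNegligible Ω f) : W.IsNegligible Ω (-f) := by
  refine ⟨fun n => ⟨(hf.1 n).1.neg, fun K hK hKΩ => ?_⟩, fun K hK hKΩ => ?_⟩
  · obtain ⟨h, h0, C, hC⟩ := (hf.1 n).2 K hK hKΩ
    exact ⟨h, h0, C, hC.neg⟩
  · obtain ⟨l, l0, h, h0, C, hC⟩ := hf.2 K hK hKΩ
    exact ⟨l, l0, h, h0, C, fun n => (hC n).neg⟩

theorem IsNegligible.sub {Ω : Opens (EuclideanSpace ℝ (Fin d))}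
    {f g : ℕ+ → EuclideanSpace ℝ (Fin d) → ℂ} (hf : W.IsNegligible Ω f)
    (hg : W.IsNegligible Ω g) : W.IsNegligible Ω (f - g) := by
  rw [sub_eq_add_neg]; exact hf.add hg.neg

theorem IsModerate.neg {Ω : Opens (EuclideanSpace ℝ (Fin d))}
    {f : ℕ+ → EuclideanSpace ℝ (Fin d) → ℂ} (hf : W.IsModerate Ω f) : W.IsModerate Ω (-f) := by
  refine ⟨fun n => ⟨(hf.1 n).1.neg, fun K hK hKΩ => ?_⟩, fun K hK hKΩ l l0 => ?_⟩
  · obtain ⟨h, h0, C, hC⟩ := (hf.1 n).2 K hK hKΩ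
    exact ⟨h, h0, C, hC.neg⟩
  · obtain ⟨h, h0, C, hC⟩ := hf.2 K hK hKΩ l l0
    exact ⟨h, h0, C, fun n => (hC n).neg⟩

theorem IsNegligible.isModerate {Ω : Opens (EuclideanSpace ℝ (Fin d))}
    {f : ℕ+ → EuclideanSpace ℝ (Fin d) → ℂ} (hf : W.IsNegligible Ω f) : W.IsModerate Ω f := by
  refine ⟨hf.1, fun K hK hKΩ lam hlam => ?_⟩
  obtain ⟨l, l0, h, h0, C, hC⟩ := hf.2 K hK hKΩ
  refine ⟨h, h0, |C|, fun n => (hC n).mono h0.le le_rfl ?_ (by positivity)⟩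
  have hn : (0 : ℝ) < n := by exact_mod_cast n.pos
  have h1 := W.assoc_nonneg (show 0 < l * n by positivity)
  have h2 := W.assoc_nonneg (show 0 < lam * n by positivity)
  exact mul_le_mul (le_abs_self _) (Real.exp_le_exp.2 (by linarith)) (Real.exp_pos _).le
    (abs_nonneg _)

/-- `Q` stands for an estimate whose constants may depend on the compact set. Finite unions only
require passing to the worst of finitely many constants. -/
theorem compact_of_locally {X : Type*} [TopologicalSpace X] [LocallyCompactSpace X]
    {Q : Set X → Prop} (h0 : Q ∅)
    (hmono : ∀ s t, s ⊆ t → Q t → Q s) (hunion : ∀ s t, Q s → Q t → Q (s ∪ t)) {K : Set X}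
    (hK : IsCompact K)
    (hloc : ∀ x ∈ K, ∃ U : Opens X, x ∈ U ∧ ∀ K' : Set X, IsCompact K' → K' ⊆ U → Q K') : Q K := by
  refine hK.induction_on h0 hmono hunion fun x hx => ?_
  obtain ⟨U, hxU, hU⟩ := hloc x hx
  obtain ⟨K', hK', hxK', hK'U⟩ := exists_compact_subset U.isOpen hxU
  exact ⟨K', mem_nhdsWithin_of_mem_nhds (mem_interior_iff_mem_nhds.1 hxK'), hU K' hK' hK'U⟩

theorem IsUltradifferentiable.of_locally {Ω : Opens (EuclideanSpace ℝ (Fin d))}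
    {f : EuclideanSpace ℝ (Fin d) → ℂ}
    (h : ∀ x ∈ Ω, ∃ Ω' : Opens (EuclideanSpace ℝ (Fin d)), x ∈ Ω' ∧
      W.IsUltradifferentiable Ω' f) : W.IsUltradifferentiable Ω f := by
  refine ⟨fun x hx => ?_, fun K hK hKΩ => ?_⟩
  · obtain ⟨Ω', hx', hf⟩ := h x hx
    exact (hf.1.contDiffAt (Ω'.isOpen.mem_nhds hx')).contDiffWithinAt
  · refine compact_of_locally (Q := fun K => ∃ h : ℝ, 0 < h ∧ ∃ C : ℝ, W.NormLE K h C f)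
      ⟨1, one_pos, 0, fun _ _ _ hx => hx.elim⟩ ?_ ?_ hK fun x hx => ?_
    · rintro s t hst ⟨h, h0, C, hC⟩
      exact ⟨h, h0, C, hC.mono_set hst⟩
    · rintro s t ⟨h, h0, C, hC⟩ ⟨h', h0', C', hC'⟩
      refine ⟨max h h', lt_max_of_lt_left h0, max |C| |C'|, .union ?_ ?_⟩
      · exact hC.mono h0.le (le_max_left _ _) ((le_abs_self _).trans (le_max_left _ _))
          (by positivity)
      · exact hC'.mono h0'.le (le_max_right _ _) ((le_abs_self _).trans (le_max_right _ _))
          (by positivity)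
    · obtain ⟨Ω', hx', hf⟩ := h x (hKΩ hx)
      exact ⟨Ω', hx', hf.2⟩

theorem IsModerate.of_locally {Ω : Opens (EuclideanSpace ℝ (Fin d))}
    {f : ℕ+ → EuclideanSpace ℝ (Fin d) → ℂ}
    (h : ∀ x ∈ Ω, ∃ Ω' : Opens (EuclideanSpace ℝ (Fin d)), x ∈ Ω' ∧ W.IsModerate Ω' f) :
    W.IsModerate Ω f := by
  refine ⟨fun n => .of_locally fun x hx => ?_, fun K hK hKΩ lam hlam => ?_⟩
  · obtain ⟨Ω', hx', hf⟩ := h x hx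
    exact ⟨Ω', hx', hf.1 n⟩
  · refine compact_of_locally (Q := fun K => ∃ h : ℝ, 0 < h ∧ ∃ C : ℝ, ∀ n : ℕ+,
        W.NormLE K h (C * Real.exp (W.assoc (lam * (n : ℝ)))) (f n))
      ⟨1, one_pos, 0, fun _ _ _ _ hx => hx.elim⟩ ?_ ?_ hK fun x hx => ?_
    · rintro s t hst ⟨h, h0, C, hC⟩
      exact ⟨h, h0, C, fun n => (hC n).mono_set hst⟩
    · rintro s t ⟨h, h0, C, hC⟩ ⟨h', h0', C', hC'⟩
      refine ⟨max h h', lt_max_of_lt_left h0, max |C| |C'|, fun n => .union ?_ ?_⟩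
      · exact (hC n).mono h0.le (le_max_left _ _)
          (by gcongr; exact (le_abs_self _).trans (le_max_left _ _)) (by positivity)
      · exact (hC' n).mono h0'.le (le_max_right _ _)
          (by gcongr; exact (le_abs_self _).trans (le_max_right _ _)) (by positivity)
    · obtain ⟨Ω', hx', hf⟩ := h x (hKΩ hx)
      exact ⟨Ω', hx', fun K' hK' hK'Ω => hf.2 K' hK' hK'Ω lam hlam⟩

theorem IsNegligible.of_locally {Ω : Opens (EuclideanSpace ℝ (Fin d))}
    {f : ℕ+ → EuclideanSpace ℝ (Fin d) → ℂ}
    (h : ∀ x ∈ Ω, ∃ Ω' : Opens (EuclideanSpace ℝ (Fin d)), x ∈ Ω' ∧ W.IsNegligible Ω' f) :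
    W.IsNegligible Ω f := by
  refine ⟨fun n => .of_locally fun x hx => ?_, fun K hK hKΩ => ?_⟩
  · obtain ⟨Ω', hx', hf⟩ := h x hx
    exact ⟨Ω', hx', hf.1 n⟩
  · refine compact_of_locally (Q := fun K => ∃ lam : ℝ, 0 < lam ∧ ∃ h : ℝ, 0 < h ∧ ∃ C : ℝ,
        ∀ n : ℕ+, W.NormLE K h (C * Real.exp (-W.assoc (lam * (n : ℝ)))) (f n))
      ⟨1, one_pos, 1, one_pos, 0, fun _ _ _ _ hx => hx.elim⟩ ?_ ?_ hK fun x hx => ?_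
    · rintro s t hst ⟨l, l0, h, h0, C, hC⟩
      exact ⟨l, l0, h, h0, C, fun n => (hC n).mono_set hst⟩
    · rintro s t ⟨l, l0, h, h0, C, hC⟩ ⟨l', l0', h', h0', C', hC'⟩
      refine ⟨min l l', lt_min l0 l0', max h h', lt_max_of_lt_left h0, max |C| |C'|,
        fun n => ?_⟩
      have hn : (0 : ℝ) < n := by exact_mod_cast n.pos
      have hm : 0 < min l l' * (n : ℝ) := mul_pos (lt_min l0 l0') hn
      have e : Real.exp (-W.assoc (l * n)) ≤ Real.exp (-W.assoc (min l l' * n)) :=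
        Real.exp_le_exp.2 (neg_le_neg (W.assoc_mono hm (by gcongr; exact min_le_left _ _)))
      have e' : Real.exp (-W.assoc (l' * n)) ≤ Real.exp (-W.assoc (min l l' * n)) :=
        Real.exp_le_exp.2 (neg_le_neg (W.assoc_mono hm (by gcongr; exact min_le_right _ _)))
      refine .union ?_ ?_
      · exact (hC n).mono h0.le (le_max_left _ _)
          (mul_le_mul ((le_abs_self _).trans (le_max_left _ _)) e (Real.exp_pos _).le
            (by positivity)) (by positivity)
      · exact (hC' n).mono h0'.le (le_max_right _ _)
          (mul_le_mul ((le_abs_self _).trans (le_max_right _ _)) e' (Real.exp_pos _).le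
            (by positivity)) (by positivity)
    · obtain ⟨Ω', hx', hf⟩ := h x (hKΩ hx)
      exact ⟨Ω', hx', hf.2⟩

theorem normLE_of_norm_iteratedFDeriv_le {K : Set (EuclideanSpace ℝ (Fin d))} {h C : ℝ}
    {f : EuclideanSpace ℝ (Fin d) → ℂ}
    (hf : ∀ x ∈ K, ∀ k, ‖iteratedFDeriv ℝ k f x‖ ≤ C * (h ^ k * W.M k)) : W.NormLE K h C f :=
  fun k σ x hx => (norm_partialDeriv_le f σ x).trans (hf x hx k)

/-- Analytic bounds imply ultradifferentiable ones. -/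
theorem NE.exists_normLE (hNE : W.NE) : ∃ C L : ℝ, 1 ≤ C ∧ 1 ≤ L ∧
    ∀ (K : Set (EuclideanSpace ℝ (Fin d))) (a A : ℝ) (f : EuclideanSpace ℝ (Fin d) → ℂ),
      0 ≤ a → 0 ≤ A →
      (∀ x ∈ K, ∀ k, ‖iteratedFDeriv ℝ k f x‖ ≤ A * (a ^ k * k.factorial)) →
        W.NormLE K (a * L) (C * A) f := by
  obtain ⟨C, L, hC, hL, hb⟩ := hNE.factorial_le
  refine ⟨C, L, hC, hL, fun K a A f ha hA hf =>
    normLE_of_norm_iteratedFDeriv_le fun x hx k => (hf x hx k).trans ?_⟩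
  calc A * (a ^ k * k.factorial) ≤ A * (a ^ k * (C * L ^ k * W.M k)) := by gcongr; exact hb k
    _ = _ := by rw [mul_pow]; ring

end WeightSequence

/-! ### Sequences of entire functions of controlled growth -/

/-- Sequences of smooth functions whose derivatives are bounded like those of entire functions,
with exponential growth in the index and Gaussian growth in the variable. -/
def HasEntireGrowth {d : ℕ} (u : ℕ+ → EuclideanSpace ℝ (Fin d) → ℂ) : Prop :=
  (∀ n, ContDiff ℝ ∞ (u n)) ∧ ∀ s : ℝ, 0 < s → ∃ C : ℝ, 0 < C ∧ ∀ (n : ℕ+) (j : ℕ)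
    (x : EuclideanSpace ℝ (Fin d)),
    ‖iteratedFDeriv ℝ j (u n) x‖ ≤ C * Real.exp (C * (n * (1 + ‖x‖ ^ 2))) * (s ^ j * j.factorial)

namespace HasEntireGrowth

variable {d : ℕ} {u v : ℕ+ → EuclideanSpace ℝ (Fin d) → ℂ}

theorem add (hu : HasEntireGrowth u) (hv : HasEntireGrowth v) : HasEntireGrowth (u + v) := by
  refine ⟨fun n => (hu.1 n).add (hv.1 n), fun s hs => ?_⟩
  obtain ⟨C, C0, hC⟩ := hu.2 s hs
  obtain ⟨C', C0', hC'⟩ := hv.2 s hs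
  refine ⟨C + C', by positivity, fun n j x => ?_⟩
  rw [Pi.add_apply, iteratedFDeriv_add_apply ((hu.1 n).contDiffAt.of_le (by exact_mod_cast le_top))
    ((hv.1 n).contDiffAt.of_le (by exact_mod_cast le_top)), add_mul, add_mul]
  refine (norm_add_le _ _).trans (add_le_add ((hC n j x).trans ?_) ((hC' n j x).trans ?_))
  · gcongr; linarith
  · gcongr; linarith

theorem neg (hu : HasEntireGrowth u) : HasEntireGrowth (-u) := by
  refine ⟨fun n => (hu.1 n).neg, fun s hs => ?_⟩
  obtain ⟨C, C0, hC⟩ := hu.2 s hs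
  refine ⟨C, C0, fun n j x => ?_⟩
  rw [Pi.neg_apply, iteratedFDeriv_neg_apply, norm_neg]
  exact hC n j x

theorem sub (hu : HasEntireGrowth u) (hv : HasEntireGrowth v) : HasEntireGrowth (u - v) := by
  rw [sub_eq_add_neg]; exact hu.add hv.neg

theorem mul (hu : HasEntireGrowth u) (hv : HasEntireGrowth v) : HasEntireGrowth (u * v) := by
  refine ⟨fun n => (hu.1 n).mul (hv.1 n), fun s hs => ?_⟩
  -- Leibniz' rule adds the radii, so each factor is used with radius `s / 2`.
  obtain ⟨C, C0, hC⟩ := hu.2 (s / 2) (by positivity)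
  obtain ⟨C', C0', hC'⟩ := hv.2 (s / 2) (by positivity)
  refine ⟨C * C' + C + C', by positivity, fun n j x => ?_⟩
  refine (norm_iteratedFDeriv_mul_le_of_bound (hu.1 n) (hv.1 n) (fun j => by positivity)
    factorial_mul_factorial_le (by positivity) (by positivity) (by positivity) (by positivity)
    (fun j => hC n j x) (fun j => hC' n j x) j).trans ?_
  rw [add_halves]
  refine mul_le_mul_of_nonneg_right ?_ (by positivity)
  rw [mul_mul_mul_comm, ← Real.exp_add]
  have : (0 : ℝ) < C * C' := by positivity
  refine mul_le_mul (by linarith) (Real.exp_le_exp.2 ?_) (Real.exp_pos _).le (by positivity)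
  rw [← add_mul]
  gcongr
  linarith

theorem isUltradifferentiable {W : WeightSequence} (hNE : W.NE) (hu : HasEntireGrowth u)
    (Ω : Opens (EuclideanSpace ℝ (Fin d))) (n : ℕ+) : W.IsUltradifferentiable Ω (u n) := by
  refine ⟨(hu.1 n).contDiffOn, fun K hK _ => ?_⟩
  obtain ⟨C, L, hC, hL, hb⟩ := hNE.exists_normLE (d := d)
  obtain ⟨B, B0, hB⟩ := hu.2 1 one_pos
  obtain ⟨R, hR⟩ := hK.isBounded.exists_norm_le
  refine ⟨1 * L, by linarith, C * (B * Real.exp (B * (n * (1 + R ^ 2)))),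
    hb K 1 _ (u n) zero_le_one (by positivity) fun x hx k => (hB n k x).trans ?_⟩
  gcongr
  exact hR x hx

end HasEntireGrowth

/-! ### Bounds for products of functions of one variable -/

/-- Iterated Leibniz rule: every factor contributes `a` to the radius, whence `s.card * a`. The
condition `1 ≤ w 0` is what the empty product needs. -/
theorem norm_iteratedFDeriv_prod_le_of_bound {E ι : Type*} [NormedAddCommGroup E]
    [NormedSpace ℝ E] (s : Finset ι) {u : ι → E → ℂ} (hu : ∀ i, ContDiff ℝ ∞ (u i)) {w : ℕ → ℝ}
    (hw0 : 1 ≤ w 0) (hw1 : ∀ j, 0 ≤ w j) (hw : ∀ i j, w i * w j ≤ w (i + j)) {A : ι → ℝ} {a : ℝ}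
    (hA : ∀ i, 0 ≤ A i) (ha : 0 ≤ a) {x : E}
    (h : ∀ i j, ‖iteratedFDeriv ℝ j (u i) x‖ ≤ A i * (a ^ j * w j)) (j : ℕ) :
    ‖iteratedFDeriv ℝ j (∏ i ∈ s, u i) x‖ ≤ (∏ i ∈ s, A i) * ((s.card * a) ^ j * w j) := by
  classical
  induction s using Finset.induction_on generalizing j with
  | empty =>
    rcases Nat.eq_zero_or_pos j with rfl | hj
    · simpa using hw0
    · rw [Finset.prod_empty]
      change ‖iteratedFDeriv ℝ j (fun _ => (1 : ℂ)) x‖ ≤ _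
      rw [iteratedFDeriv_const_of_ne hj.ne']
      simp [hj.ne']
  | insert i s hi ih =>
    rw [Finset.prod_insert hi, Finset.prod_insert hi, Finset.card_insert_of_notMem hi]
    have h1 : ContDiff ℝ ∞ (∏ i ∈ s, u i) := by
      have e : ∏ i ∈ s, u i = fun y => ∏ i ∈ s, u i y := by funext y; simp
      rw [e]
      exact contDiff_prod fun i _ => hu i
    refine (norm_iteratedFDeriv_mul_le_of_bound (hu i) h1 hw1 hw (hA i)
      (Finset.prod_nonneg fun i _ => hA i) ha (by positivity) (h i) ih j).trans (le_of_eq ?_)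
    push_cast
    ring

theorem norm_iteratedFDeriv_ofReal_comp_clm_le {E : Type*} [NormedAddCommGroup E]
    [NormedSpace ℝ E] {φ : ℝ → ℝ} (hφ : ContDiff ℝ ∞ φ) (L : E →L[ℝ] ℝ) (x₀ x : E) (j : ℕ) :
    ‖iteratedFDeriv ℝ j (fun y => (φ (L (y - x₀)) : ℂ)) x‖
      ≤ ‖iteratedDeriv j φ (L (x - x₀))‖ * ‖L‖ ^ j := by
  rw [iteratedFDeriv_comp_sub (f := fun y => (φ (L y) : ℂ)) j x₀ x]
  have h1 := Complex.ofRealLI.norm_iteratedFDeriv_comp_left (f := fun y => φ (L y)) (x := x - x₀)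
    (n := ∞) (i := j) (hφ.comp L.contDiff).contDiffAt (by exact_mod_cast le_top)
  change ‖iteratedFDeriv ℝ j (Complex.ofRealLI ∘ fun y => φ (L y)) (x - x₀)‖ ≤ _
  rw [h1]
  have h2 := L.iteratedFDeriv_comp_right hφ (x - x₀) (i := j) (by exact_mod_cast le_top)
  change ‖iteratedFDeriv ℝ j (φ ∘ L) (x - x₀)‖ ≤ _
  rw [h2, ← norm_iteratedFDeriv_eq_norm_iteratedDeriv]
  refine (ContinuousMultilinearMap.norm_compContinuousLinearMap_le _ _).trans ?_
  simp

/-! ### Derivatives of Gaussians -/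

/-- The Appell property turns the recursion `H_{n+1} = X H_n - H_n'` into a three-term recurrence
without derivatives. -/
theorem derivative_hermite_succ (n : ℕ) :
    Polynomial.derivative (Polynomial.hermite (n + 1)) =
      ((n + 1 : ℕ) : Polynomial ℤ) * Polynomial.hermite n := by
  induction n with
  | zero => simp [Polynomial.hermite_succ]
  | succ n ih =>
    rw [Polynomial.hermite_succ (n + 1), Polynomial.derivative_sub, Polynomial.derivative_mul, ih,
      Polynomial.derivative_X, one_mul, Polynomial.derivative_mul, Polynomial.derivative_natCast,
      zero_mul, zero_add, Polynomial.hermite_succ n]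
    push_cast
    ring

/-- With `s = √(n+1)`, the recurrence `H_{n+2} = x H_{n+1} - (n+1) H_n` propagates the bound because
`n + 1 = s² ≤ s(|x| + s)`. -/
theorem abs_aeval_hermite_le (n : ℕ) (x : ℝ) :
    |Polynomial.aeval x (Polynomial.hermite n)| ≤ (|x| + √n) ^ n := by
  induction n using Nat.strong_induction_on with
  | _ n ih =>
    match n with
    | 0 => simp
    | 1 =>
      simp
    | n + 2 =>
      rw [Polynomial.hermite_succ, derivative_hermite_succ]
      simp only [map_sub, map_mul, Polynomial.aeval_X, map_natCast]
      have h1 := ih (n + 1) (by omega)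
      have h2 := ih n (by omega)
      set s := √((n + 1 : ℕ) : ℝ) with hs
      set t := √((n + 2 : ℕ) : ℝ) with ht
      have hs0 : 0 ≤ s := Real.sqrt_nonneg _
      have hss : s * s = ((n + 1 : ℕ) : ℝ) := Real.mul_self_sqrt (by positivity)
      have hst : s ≤ t := Real.sqrt_le_sqrt (by push_cast; linarith)
      have hrs : √(n : ℝ) ≤ s := Real.sqrt_le_sqrt (by push_cast; linarith)
      have h3 : |Polynomial.aeval x (Polynomial.hermite n)| ≤ (|x| + s) ^ n :=
        h2.trans (pow_le_pow_left₀ (by positivity) (by linarith) _)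
      calc _ ≤ |x| * |Polynomial.aeval x (Polynomial.hermite (n + 1))|
            + ((n + 1 : ℕ) : ℝ) * |Polynomial.aeval x (Polynomial.hermite n)| := by
            refine (abs_sub _ _).trans ?_
            rw [abs_mul, abs_mul, Nat.abs_cast]
        _ ≤ |x| * (|x| + s) ^ (n + 1) + (s * (|x| + s)) * (|x| + s) ^ n := by
            refine add_le_add (mul_le_mul_of_nonneg_left h1 (abs_nonneg _))
              (mul_le_mul ?_ h3 (abs_nonneg _) (by positivity))
            rw [← hss]
            nlinarith [abs_nonneg x]
        _ = (|x| + s) ^ (n + 2) := by ring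
        _ ≤ (|x| + t) ^ (n + 2) := by gcongr

/-- After squaring, `(x + √j)² ≤ 8y` with `y = (x² + j)/4`, and `y^j ≤ j! e^y`; the leftover base
`8e^{1/4}` is at most `16`. The exponent `x²/8` is small enough to leave part of the Gaussian
`e^{-x²/2}`. -/
theorem add_sqrt_pow_le (j : ℕ) {x : ℝ} (hx : 0 ≤ x) :
    (x + √j) ^ j ≤ 4 ^ j * √(j.factorial : ℝ) * Real.exp (x ^ 2 / 8) := by
  refine (pow_le_pow_iff_left₀ (by positivity) (by positivity) two_ne_zero).1 ?_
  have h1 : (x + √j) ^ 2 ≤ 8 * ((x ^ 2 + j) / 4) := by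
    nlinarith [sq_nonneg (x - √j), Real.sq_sqrt (Nat.cast_nonneg (α := ℝ) j)]
  have h2 := Real.pow_div_factorial_le_exp ((x ^ 2 + j) / 4) (by positivity) j
  rw [div_le_iff₀ (by positivity)] at h2
  calc ((x + √j) ^ j) ^ 2 = ((x + √j) ^ 2) ^ j := by rw [← pow_mul, ← pow_mul, mul_comm]
    _ ≤ (8 * ((x ^ 2 + j) / 4)) ^ j := by gcongr
    _ = 8 ^ j * ((x ^ 2 + j) / 4) ^ j := mul_pow _ _ _
    _ ≤ 8 ^ j * (Real.exp ((x ^ 2 + j) / 4) * j.factorial) := by gcongr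
    _ = (8 * Real.exp (1 / 4)) ^ j * j.factorial * Real.exp (x ^ 2 / 4) := by
        rw [mul_pow, ← Real.exp_nat_mul, add_div, Real.exp_add]
        ring_nf
    _ ≤ 16 ^ j * j.factorial * Real.exp (x ^ 2 / 4) := by
        have : Real.exp (1 / 4) ≤ 2 := by
          rw [← Real.le_log_iff_exp_le two_pos]
          have := Real.log_two_gt_d9
          linarith
        gcongr
        linarith
    _ = _ := by
        have e1 : ((4 : ℝ) ^ j) ^ 2 = 16 ^ j := by
          rw [← pow_mul, mul_comm, pow_mul]; norm_num
        have e2 : Real.exp (x ^ 2 / 8) ^ 2 = Real.exp (x ^ 2 / 4) := by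
          rw [← Real.exp_nat_mul]; congr 1; push_cast; ring
        rw [mul_pow, mul_pow, e1, Real.sq_sqrt (by positivity), e2]

/-- Rodrigues' formula and the Hermite bound. The growth `√(j!)`, instead of the `j!` of a general
analytic function, is what later makes the cutoffs moderate. -/
theorem norm_iteratedDeriv_gaussian_le (j : ℕ) (x : ℝ) :
    ‖iteratedDeriv j (fun y : ℝ => Real.exp (-(y ^ 2 / 2))) x‖
      ≤ 4 ^ j * √(j.factorial : ℝ) * Real.exp (-(x ^ 2 / 4)) := by
  rw [iteratedDeriv_eq_iterate, Polynomial.deriv_gaussian_eq_hermite_mul_gaussian, norm_mul,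
    norm_mul, norm_pow, norm_neg, norm_one, one_pow, one_mul, Real.norm_eq_abs, Real.norm_eq_abs,
    abs_of_pos (Real.exp_pos _)]
  have h := (abs_aeval_hermite_le j x).trans (add_sqrt_pow_le j (abs_nonneg x))
  rw [sq_abs] at h
  calc _ ≤ 4 ^ j * √(j.factorial : ℝ) * Real.exp (x ^ 2 / 8) * Real.exp (-(x ^ 2 / 2)) := by gcongr
    _ ≤ _ := by
      rw [mul_assoc, ← Real.exp_add]
      gcongr
      nlinarith [sq_nonneg x]

/-- The Gaussian `exp (-r |x|²)`. -/
noncomputable def gaussianFun {d : ℕ} (r : ℝ) (x : EuclideanSpace ℝ (Fin d)) : ℂ :=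
  (Real.exp (-r * ‖x‖ ^ 2) : ℝ)

theorem contDiff_gaussianFun {d : ℕ} (r : ℝ) :
    ContDiff ℝ ∞ (gaussianFun r : EuclideanSpace ℝ (Fin d) → ℂ) := by
  unfold gaussianFun
  exact Complex.ofRealCLM.contDiff.comp
    (Real.contDiff_exp.comp (contDiff_const.mul (contDiff_norm_sq ℝ)))

theorem sqrt_smul_proj_sub_zero_sq {d : ℕ} {r : ℝ} (hr : 0 ≤ r) (i : Fin d)
    (x : EuclideanSpace ℝ (Fin d)) :
    ((√(2 * r) • (EuclideanSpace.proj i : EuclideanSpace ℝ (Fin d) →L[ℝ] ℝ)) (x - 0)) ^ 2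
      = 2 * r * x i ^ 2 := by
  rw [sub_zero]
  change (√(2 * r) * x i) ^ 2 = _
  rw [mul_pow, Real.sq_sqrt (by positivity)]

theorem gaussianFun_eq_prod {d : ℕ} {r : ℝ} (hr : 0 ≤ r) :
    (gaussianFun r : EuclideanSpace ℝ (Fin d) → ℂ) = ∏ i : Fin d,
      fun y => ((fun t : ℝ => Real.exp (-(t ^ 2 / 2)))
        ((√(2 * r) • (EuclideanSpace.proj i : EuclideanSpace ℝ (Fin d) →L[ℝ] ℝ)) (y - 0)) : ℂ) := by
  ext x
  rw [Finset.prod_apply, gaussianFun, ← Complex.ofReal_prod, ← Real.exp_sum]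
  congr 2
  rw [EuclideanSpace.norm_sq_eq, Finset.mul_sum]
  refine Finset.sum_congr rfl fun i _ => ?_
  rw [sqrt_smul_proj_sub_zero_sq hr, Real.norm_eq_abs, sq_abs]
  ring

theorem norm_iteratedFDeriv_gaussianFun_le {d : ℕ} {r : ℝ} (hr : 0 ≤ r) (j : ℕ)
    (x : EuclideanSpace ℝ (Fin d)) :
    ‖iteratedFDeriv ℝ j (gaussianFun r) x‖
      ≤ (d * (4 * √(2 * r))) ^ j * √(j.factorial : ℝ) * Real.exp (-(r / 2) * ‖x‖ ^ 2) := by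
  have hφ : ContDiff ℝ ∞ fun t : ℝ => Real.exp (-(t ^ 2 / 2)) := by fun_prop
  have hL : ∀ i : Fin d, ‖√(2 * r) • (EuclideanSpace.proj i : EuclideanSpace ℝ (Fin d) →L[ℝ] ℝ)‖
      ≤ √(2 * r) := by
    intro i
    refine ContinuousLinearMap.opNorm_le_bound _ (Real.sqrt_nonneg _) fun v => ?_
    change ‖√(2 * r) * v i‖ ≤ _
    rw [norm_mul, Real.norm_of_nonneg (Real.sqrt_nonneg _)]
    exact mul_le_mul_of_nonneg_left (PiLp.norm_apply_le v i) (Real.sqrt_nonneg _)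
  rw [gaussianFun_eq_prod hr]
  refine (norm_iteratedFDeriv_prod_le_of_bound Finset.univ (a := 4 * √(2 * r))
    (w := fun j => √(j.factorial : ℝ)) (A := fun i => Real.exp (-(r / 2) * x i ^ 2))
    (fun i => Complex.ofRealCLM.contDiff.comp (hφ.comp ((ContinuousLinearMap.contDiff _).comp
      (contDiff_id.sub contDiff_const)))) (by simp)
    (fun j => Real.sqrt_nonneg _) sqrt_factorial_mul_le (fun i => (Real.exp_pos _).le)
    (by positivity) (fun i j => ?_) j).trans (le_of_eq ?_)
  · refine (norm_iteratedFDeriv_ofReal_comp_clm_le hφ _ 0 x j).trans ?_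
    refine (mul_le_mul (norm_iteratedDeriv_gaussian_le j _)
      (pow_le_pow_left₀ (norm_nonneg _) (hL i) j) (by positivity) (by positivity)).trans
      (le_of_eq ?_)
    have : -(((√(2 * r) • (EuclideanSpace.proj i : EuclideanSpace ℝ (Fin d) →L[ℝ] ℝ)) (x - 0)) ^ 2
        / 4) = -(r / 2) * x i ^ 2 := by
      rw [sqrt_smul_proj_sub_zero_sq hr]
      ring
    rw [this, mul_pow]
    ring
  · rw [← Real.exp_sum, ← Finset.mul_sum, EuclideanSpace.norm_sq_eq]
    simp
    ring

/-! ### Mollified indicator functions -/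

section Cutoff

open MeasureTheory

variable {d : ℕ}

theorem integrable_exp_neg_mul_norm_sub_sq {a : ℝ} (ha : 0 < a) (x : EuclideanSpace ℝ (Fin d)) :
    Integrable fun y : EuclideanSpace ℝ (Fin d) => Real.exp (-a * ‖x - y‖ ^ 2) := by
  have h := (GaussianFourier.integrable_cexp_neg_mul_sq_norm_add (b := (a : ℂ))
    (by simpa using ha) 0 (0 : EuclideanSpace ℝ (Fin d))).norm
  have h2 : Integrable fun y : EuclideanSpace ℝ (Fin d) => Real.exp (-a * ‖y‖ ^ 2) := by
    refine h.congr (Eventually.of_forall fun y => ?_)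
    simp only [inner_zero_left, Complex.ofReal_zero, mul_zero, add_zero, Complex.norm_exp]
    congr 1
    rw [← Complex.ofReal_neg, ← Complex.ofReal_pow, ← Complex.ofReal_mul, Complex.ofReal_re]
  exact h2.comp_sub_left x

theorem exists_hasFDerivAt_integral_sub {E F : Type*} [NormedAddCommGroup E] [NormedSpace ℝ E]
    [MeasurableSpace E] [OpensMeasurableSpace E] [SecondCountableTopology E] {μ : Measure E}
    [NormedAddCommGroup F] [NormedSpace ℝ F] [CompleteSpace F]
    (hμ : ∀ (a : ℝ) (x : E), 0 < a → Integrable (fun y => Real.exp (-a * ‖x - y‖ ^ 2)) μ)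
    {g : E → F} (hg : ContDiff ℝ 1 g) {a : ℝ} (ha : 0 < a) {C C' : ℝ}
    (hb : ∀ z, ‖g z‖ ≤ C * Real.exp (-a * ‖z‖ ^ 2))
    (hb' : ∀ z, ‖fderiv ℝ g z‖ ≤ C' * Real.exp (-a * ‖z‖ ^ 2)) (x : E) :
    ∃ L : E →L[ℝ] F, HasFDerivAt (fun x => ∫ y, g (x - y) ∂μ) L x ∧
      ∀ v, L v = ∫ y, fderiv ℝ g (x - y) v ∂μ := by
  have hmeas : ∀ x, AEStronglyMeasurable (fun y => g (x - y)) μ := fun x =>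
    (hg.continuous.comp (continuous_const.sub continuous_id)).aestronglyMeasurable
  have hmeas' : ∀ x, AEStronglyMeasurable (fun y => fderiv ℝ g (x - y)) μ := fun x =>
    ((hg.continuous_fderiv one_ne_zero).comp
      (continuous_const.sub continuous_id)).aestronglyMeasurable
  have hint : Integrable (fun y => g (x - y)) μ :=
    ((hμ a x ha).const_mul C).mono' (hmeas x) (Eventually.of_forall fun y => hb _)
  have hint' : Integrable (fun y => fderiv ℝ g (x - y)) μ :=
    ((hμ a x ha).const_mul C').mono' (hmeas' x) (Eventually.of_forall fun y => hb' _)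
  refine ⟨∫ y, fderiv ℝ g (x - y) ∂μ, ?_, fun v => ContinuousLinearMap.integral_apply hint' v⟩
  -- For `x'` in the unit ball around `x` one has `‖x - y‖² ≤ 2‖x' - y‖² + 2`. Halving the rate `a`,
  -- at the cost of a factor `e^a`, thus gives a majorant independent of `x'`.
  refine hasFDerivAt_integral_of_dominated_of_fderiv_le (s := Metric.ball x 1)
    (F' := fun x y => fderiv ℝ g (x - y))
    (bound := fun y => |C'| * Real.exp a * Real.exp (-(a / 2) * ‖x - y‖ ^ 2))
    (Metric.ball_mem_nhds x one_pos)
    (Eventually.of_forall hmeas) hint (hmeas' x) ?_ ((hμ _ x (half_pos ha)).const_mul _) ?_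
  · refine Eventually.of_forall fun y x' hx' => (hb' _).trans ?_
    rw [mul_assoc, ← Real.exp_add]
    refine mul_le_mul (le_abs_self _) (Real.exp_le_exp.2 ?_) (Real.exp_pos _).le (abs_nonneg _)
    have h2 : ‖x - y‖ ≤ ‖x' - y‖ + 1 := by
      have h3 : ‖x - x'‖ < 1 := by rw [← dist_eq_norm, dist_comm]; exact hx'
      have h4 : ‖x - y‖ ≤ ‖x - x'‖ + ‖x' - y‖ := norm_sub_le_norm_sub_add_norm_sub ..
      linarith
    have h5 : ‖x - y‖ ^ 2 ≤ 2 * ‖x' - y‖ ^ 2 + 2 := by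
      nlinarith [norm_nonneg (x - y), sq_nonneg (‖x' - y‖ - 1)]
    nlinarith
  · refine Eventually.of_forall fun y x' _ => ?_
    have h1 : DifferentiableAt ℝ g (x' - y) := hg.differentiable one_ne_zero _
    simpa [Function.comp_def] using h1.hasFDerivAt.comp x' ((hasFDerivAt_id x').sub_const y)

/-- Differentiation under the integral sign in a convolution with a rapidly decaying kernel. -/
theorem iteratedFDeriv_integral_sub {E : Type*} [NormedAddCommGroup E] [NormedSpace ℝ E]
    [MeasurableSpace E] [OpensMeasurableSpace E] [SecondCountableTopology E] {μ : Measure E}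
    (hμ : ∀ (a : ℝ) (x : E), 0 < a → Integrable (fun y => Real.exp (-a * ‖x - y‖ ^ 2)) μ)
    {k : E → ℂ} (hk : ContDiff ℝ ∞ k) {a : ℝ} (ha : 0 < a) {C : ℕ → ℝ}
    (hb : ∀ j z, ‖iteratedFDeriv ℝ j k z‖ ≤ C j * Real.exp (-a * ‖z‖ ^ 2)) :
    ContDiff ℝ ∞ (fun x => ∫ y, k (x - y) ∂μ) ∧
    ∀ j, iteratedFDeriv ℝ j (fun x => ∫ y, k (x - y) ∂μ)
      = fun x => ∫ y, iteratedFDeriv ℝ j k (x - y) ∂μ := by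
  have hcont : ∀ j, Continuous (iteratedFDeriv ℝ j k) := fun j =>
    hk.continuous_iteratedFDeriv (by exact_mod_cast le_top)
  have hint : ∀ j x, Integrable (fun y => iteratedFDeriv ℝ j k (x - y)) μ :=
    fun j x => ((hμ a x ha).const_mul (C j)).mono'
      ((hcont j).comp (continuous_const.sub continuous_id)).aestronglyMeasurable
      (Eventually.of_forall fun y => hb j _)
  have hder : ∀ j x, ∃ L, HasFDerivAt (fun x => ∫ y, iteratedFDeriv ℝ j k (x - y) ∂μ) L x ∧
      ∀ v, L v = ∫ y, fderiv ℝ (iteratedFDeriv ℝ j k) (x - y) v ∂μ := fun j x =>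
    exists_hasFDerivAt_integral_sub hμ (hk.iteratedFDeriv_right (by exact_mod_cast le_top)) ha
      (hb j) (fun z => norm_fderiv_iteratedFDeriv.trans_le (hb (j + 1) z)) x
  have heq : ∀ j, iteratedFDeriv ℝ j (fun x => ∫ y, k (x - y) ∂μ)
      = fun x => ∫ y, iteratedFDeriv ℝ j k (x - y) ∂μ := by
    intro j
    induction j with
    | zero =>
      ext1 x
      simp_rw [iteratedFDeriv_zero_eq_comp]
      exact ((continuousMultilinearCurryFin0 ℝ E
        ℂ).symm.toContinuousLinearEquiv.integral_comp_comm _).symm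
    | succ j ih =>
      ext1 x
      obtain ⟨L, hL, hLv⟩ := hder j x
      ext m
      have hint' : Integrable (fun y => fderiv ℝ (iteratedFDeriv ℝ j k) (x - y) (m 0)) μ := by
        refine ((hμ a x ha).const_mul (C (j + 1) * ‖m 0‖)).mono' ?_ ?_
        · exact ((((hk.iteratedFDeriv_right (m := 1) (i := j)
            (by exact_mod_cast le_top)).continuous_fderiv one_ne_zero).clm_apply
            continuous_const).comp (continuous_const.sub continuous_id)).aestronglyMeasurable
        · refine Eventually.of_forall fun y => (ContinuousLinearMap.le_opNorm _ _).trans ?_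
          rw [mul_right_comm]
          exact mul_le_mul_of_nonneg_right
            (norm_fderiv_iteratedFDeriv.trans_le (hb (j + 1) _)) (norm_nonneg _)
      rw [ContinuousMultilinearMap.integral_apply (hint (j + 1) x), iteratedFDeriv_succ_apply_left,
        ih, hL.fderiv, hLv, ContinuousMultilinearMap.integral_apply hint']
      rfl
  refine ⟨?_, heq⟩
  refine contDiff_of_differentiable_iteratedFDeriv fun j _ => ?_
  rw [heq j]
  intro x
  obtain ⟨L, hL, -⟩ := hder j x
  exact hL.differentiableAt

/-- The convolution of the indicator function of `S` with the Gaussian probability density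
`(r/π)^(d/2) exp (-r |x|²)`. -/
noncomputable def gaussianCutoff (S : Set (EuclideanSpace ℝ (Fin d))) (r : ℝ)
    (x : EuclideanSpace ℝ (Fin d)) : ℂ :=
  ((r / Real.pi) ^ ((d : ℝ) / 2) : ℝ) * ∫ y in S, gaussianFun r (x - y)

theorem contDiff_integral_gaussianFun (S : Set (EuclideanSpace ℝ (Fin d))) {r : ℝ} (hr : 0 < r) :
    ContDiff ℝ ∞ (fun x => ∫ y in S, gaussianFun r (x - y)) ∧
    ∀ j, iteratedFDeriv ℝ j (fun x => ∫ y in S, gaussianFun r (x - y))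
      = fun x => ∫ y in S, iteratedFDeriv ℝ j (gaussianFun r) (x - y) :=
  iteratedFDeriv_integral_sub
    (fun _ x ha => (integrable_exp_neg_mul_norm_sub_sq ha x).integrableOn)
    (contDiff_gaussianFun r) (half_pos hr) (fun j z => norm_iteratedFDeriv_gaussianFun_le hr.le j z)

theorem contDiff_gaussianCutoff (S : Set (EuclideanSpace ℝ (Fin d))) {r : ℝ} (hr : 0 < r) :
    ContDiff ℝ ∞ (gaussianCutoff S r) :=
  contDiff_const.mul (contDiff_integral_gaussianFun S hr).1

/-- Exact, since the kernel has total mass `1`. Every estimate away from `S` thereby becomes one for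
`1 - χ` inside `S`. -/
theorem gaussianCutoff_add_compl {S : Set (EuclideanSpace ℝ (Fin d))} (hS : MeasurableSet S)
    {r : ℝ} (hr : 0 < r) (x : EuclideanSpace ℝ (Fin d)) :
    gaussianCutoff S r x + gaussianCutoff Sᶜ r x = 1 := by
  have hint : Integrable fun y : EuclideanSpace ℝ (Fin d) => gaussianFun r (x - y) :=
    (integrable_exp_neg_mul_norm_sub_sq hr x).ofReal
  rw [gaussianCutoff, gaussianCutoff, ← mul_add, integral_add_compl hS hint]
  have h1 : ∫ y, gaussianFun r (x - y) = ((∫ y, Real.exp (-r * ‖x - y‖ ^ 2) : ℝ) : ℂ) :=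
    integral_ofReal
  have h2 : ∫ y, Real.exp (-r * ‖x - y‖ ^ 2)
      = ∫ y : EuclideanSpace ℝ (Fin d), Real.exp (-r * ‖y‖ ^ 2) :=
    integral_sub_left_eq_self (fun y => Real.exp (-r * ‖y‖ ^ 2)) volume x
  rw [h1, h2, GaussianFourier.integral_rexp_neg_mul_sq_norm hr, finrank_euclideanSpace_fin,
    ← Complex.ofReal_mul, ← Real.mul_rpow (by positivity) (by positivity)]
  rw [div_mul_div_cancel₀ (by positivity), div_self hr.ne', Real.one_rpow, Complex.ofReal_one]

/-- The factor `e^{-(r/2)‖x-y‖²}` is split in two: one half yields `e^{-(r/4)ε²}` because `‖x-y‖ ≥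
ε` on `S`, the other is integrated over the whole space. The normalisation times that integral is
`4^{d/2} = 2^d`. -/
theorem norm_iteratedFDeriv_gaussianCutoff_le {S : Set (EuclideanSpace ℝ (Fin d))}
    (hS : MeasurableSet S) {r : ℝ} (hr : 0 < r) {x : EuclideanSpace ℝ (Fin d)} {ε : ℝ}
    (hε : 0 ≤ ε) (hx : ∀ y ∈ S, ε ≤ dist x y) (j : ℕ) :
    ‖iteratedFDeriv ℝ j (gaussianCutoff S r) x‖
      ≤ 2 ^ d * ((d * (4 * √(2 * r))) ^ j * √(j.factorial : ℝ)) * Real.exp (-(r / 4) * ε ^ 2) := by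
  obtain ⟨h1, h2⟩ := contDiff_integral_gaussianFun S hr
  set c : ℝ := (r / Real.pi) ^ ((d : ℝ) / 2) with hc
  have hc0 : 0 ≤ c := by positivity
  set B : ℝ := (d * (4 * √(2 * r))) ^ j * √(j.factorial : ℝ) with hB
  have hB0 : 0 ≤ B := by positivity
  have e : gaussianCutoff S r = fun x => (c : ℂ) • ∫ y in S, gaussianFun r (x - y) := rfl
  rw [e, iteratedFDeriv_const_smul_apply' (h1.contDiffAt.of_le (by exact_mod_cast le_top)), h2,
    norm_smul, Complex.norm_real, Real.norm_of_nonneg hc0]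
  have h3 : ‖∫ y in S, iteratedFDeriv ℝ j (gaussianFun r) (x - y)‖
      ≤ ∫ y in S, B * Real.exp (-(r / 4) * ε ^ 2) * Real.exp (-(r / 4) * ‖x - y‖ ^ 2) := by
    refine norm_integral_le_of_norm_le
      ((integrable_exp_neg_mul_norm_sub_sq (by positivity) x).const_mul _).integrableOn ?_
    filter_upwards [ae_restrict_mem hS] with y hy
    refine (norm_iteratedFDeriv_gaussianFun_le hr.le j _).trans ?_
    rw [mul_assoc B, ← Real.exp_add]
    refine mul_le_mul_of_nonneg_left (Real.exp_le_exp.2 ?_) hB0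
    have := hx y hy
    rw [dist_eq_norm] at this
    have := pow_le_pow_left₀ hε this 2
    nlinarith
  have h4 : ∫ y in S, B * Real.exp (-(r / 4) * ε ^ 2) * Real.exp (-(r / 4) * ‖x - y‖ ^ 2)
      ≤ B * Real.exp (-(r / 4) * ε ^ 2) * (Real.pi / (r / 4)) ^ ((d : ℝ) / 2) := by
    rw [integral_const_mul]
    refine mul_le_mul_of_nonneg_left ?_ (by positivity)
    have h5 : ∫ y, Real.exp (-(r / 4) * ‖x - y‖ ^ 2)
        = ∫ y : EuclideanSpace ℝ (Fin d), Real.exp (-(r / 4) * ‖y‖ ^ 2) :=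
      integral_sub_left_eq_self (fun y => Real.exp (-(r / 4) * ‖y‖ ^ 2)) volume x
    have h6 := GaussianFourier.integral_rexp_neg_mul_sq_norm (V := EuclideanSpace ℝ (Fin d))
      (show 0 < r / 4 by positivity)
    rw [finrank_euclideanSpace_fin] at h6
    rw [← h6, ← h5]
    exact setIntegral_le_integral (integrable_exp_neg_mul_norm_sub_sq (by positivity) x)
      (Eventually.of_forall fun y => (Real.exp_pos _).le)
  have h7 : c * (Real.pi / (r / 4)) ^ ((d : ℝ) / 2) = 2 ^ d := by
    rw [hc, ← Real.mul_rpow (by positivity) (by positivity)]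
    have : r / Real.pi * (Real.pi / (r / 4)) = 2 ^ (2 : ℝ) := by
      have := Real.pi_pos
      field_simp
      norm_num
    rw [this, ← Real.rpow_mul two_pos.le, mul_div_cancel₀ _ two_ne_zero, Real.rpow_natCast]
  calc _ ≤ c * (B * Real.exp (-(r / 4) * ε ^ 2) * (Real.pi / (r / 4)) ^ ((d : ℝ) / 2)) :=
        mul_le_mul_of_nonneg_left (h3.trans h4) hc0
    _ = (c * (Real.pi / (r / 4)) ^ ((d : ℝ) / 2)) * B * Real.exp (-(r / 4) * ε ^ 2) := by ring
    _ = _ := by rw [h7]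

end Cutoff

/-- Exchanges Gaussian derivative bounds for analytic ones of any radius `s`, at the price
`e^{K/(2s²)}`. With `K` proportional to `n` the price is exponential in `n`. The square is the
inequality `(K/s²)^j ≤ j! e^{K/s²}`. -/
theorem sqrt_pow_mul_sqrt_factorial_le {K s : ℝ} (hK : 0 ≤ K) (hs : 0 < s) (j : ℕ) :
    √K ^ j * √(j.factorial : ℝ) ≤ s ^ j * j.factorial * Real.exp (K / (2 * s ^ 2)) := by
  refine (pow_le_pow_iff_left₀ (by positivity) (by positivity) two_ne_zero).1 ?_
  have h1 := Real.pow_div_factorial_le_exp (K / s ^ 2) (by positivity) j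
  rw [div_le_iff₀ (by positivity), div_pow, div_le_iff₀ (by positivity)] at h1
  have e1 : (√K ^ j * √(j.factorial : ℝ)) ^ 2 = K ^ j * j.factorial := by
    rw [mul_pow, ← pow_mul, mul_comm j 2, pow_mul, Real.sq_sqrt hK, Real.sq_sqrt (by positivity)]
  have e2 : Real.exp (K / (2 * s ^ 2)) ^ 2 = Real.exp (K / s ^ 2) := by
    rw [← Real.exp_nat_mul]; congr 1; push_cast; field_simp
  rw [e1, mul_pow, e2, mul_pow]
  calc K ^ j * j.factorial ≤ Real.exp (K / s ^ 2) * j.factorial * (s ^ 2) ^ j * j.factorial := by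
        gcongr
    _ = _ := by rw [← pow_mul, ← pow_mul, mul_comm 2 j]; ring

/-- The sequence of mollified indicator functions of `S` at the scales `(R n)^(-1/2)`. -/
noncomputable def cutoffSeq {d : ℕ} (S : Set (EuclideanSpace ℝ (Fin d))) (R : ℝ) :
    ℕ+ → EuclideanSpace ℝ (Fin d) → ℂ := fun n => gaussianCutoff S (R * n)

/-! ### Cutoff sequences: growth, negligibility, moderateness -/

section CutoffSeq

variable {d : ℕ} {S : Set (EuclideanSpace ℝ (Fin d))} {R : ℝ}

theorem mul_pnat_pos (hR : 0 < R) (n : ℕ+) : 0 < R * (n : ℝ) := by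
  have := n.pos
  positivity

theorem norm_iteratedFDeriv_cutoffSeq_le (hS : MeasurableSet S) (hR : 0 < R)
    {x : EuclideanSpace ℝ (Fin d)} {ε : ℝ} (hε : 0 ≤ ε) (hx : ∀ y ∈ S, ε ≤ dist x y) (n : ℕ+)
    (j : ℕ) :
    ‖iteratedFDeriv ℝ j (cutoffSeq S R n) x‖
      ≤ 2 ^ d * (√(32 * d ^ 2 * R * n) ^ j * √(j.factorial : ℝ))
        * Real.exp (-(R * n / 4) * ε ^ 2) := by
  have h := norm_iteratedFDeriv_gaussianCutoff_le hS (mul_pnat_pos hR n) hε hx j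
  have e : (d : ℝ) * (4 * √(2 * (R * n))) = √(32 * d ^ 2 * R * n) := by
    rw [show (32 : ℝ) * d ^ 2 * R * n = (d * 4) ^ 2 * (2 * (R * n)) by ring,
      Real.sqrt_mul (x := ((d : ℝ) * 4) ^ 2) (by positivity), Real.sqrt_sq (by positivity)]
    ring
  rwa [e] at h

/-- The radius `16(d+1)/δ` is large enough for the price of the analytic bound to use up at most
half of the decay `e^{-Rnε²/4}`. It does not involve `R`, so `R` can be enlarged later without
harming regularity. -/
theorem norm_iteratedFDeriv_cutoffSeq_le_of_dist (hS : MeasurableSet S) (hR : 0 < R)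
    {x : EuclideanSpace ℝ (Fin d)} {δ ε : ℝ} (hδ : 0 < δ) (hε : δ ≤ ε)
    (hx : ∀ y ∈ S, ε ≤ dist x y) (n : ℕ+) (j : ℕ) :
    ‖iteratedFDeriv ℝ j (cutoffSeq S R n) x‖
      ≤ 2 ^ d * Real.exp (-(R * n / 8) * ε ^ 2) * ((16 * (d + 1) / δ) ^ j * j.factorial) := by
  have hn := mul_pnat_pos hR n
  refine (norm_iteratedFDeriv_cutoffSeq_le hS hR (hδ.le.trans hε) hx n j).trans ?_
  have h := sqrt_pow_mul_sqrt_factorial_le (K := 32 * d ^ 2 * R * n) (s := 16 * (d + 1) / δ)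
    (by rw [mul_assoc]; positivity) (by positivity) j
  have h2 : 32 * (d : ℝ) ^ 2 * R * n / (2 * (16 * (d + 1) / δ) ^ 2) ≤ R * n / 8 * ε ^ 2 := by
    have h3 : δ ^ 2 ≤ ε ^ 2 := pow_le_pow_left₀ hδ.le hε 2
    rw [div_le_iff₀ (by positivity), div_pow]
    have h4 : R * n / 8 * ε ^ 2 * (2 * ((16 * (d + 1)) ^ 2 / δ ^ 2))
        = 64 * (R * n) * (d + 1) ^ 2 * (ε ^ 2 / δ ^ 2) := by ring
    rw [h4]
    have h5 : 1 ≤ ε ^ 2 / δ ^ 2 := by rwa [one_le_div (by positivity)]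
    have h6 : (d : ℝ) ^ 2 ≤ (d + 1) ^ 2 := by gcongr; linarith
    calc 32 * (d : ℝ) ^ 2 * R * n = 32 * (R * n) * d ^ 2 * 1 := by ring
      _ ≤ 64 * (R * n) * (d + 1) ^ 2 * (ε ^ 2 / δ ^ 2) := by gcongr; norm_num
  calc _ ≤ 2 ^ d * ((16 * (d + 1) / δ) ^ j * j.factorial * Real.exp (R * n / 8 * ε ^ 2))
        * Real.exp (-(R * n / 4) * ε ^ 2) := by
        refine mul_le_mul_of_nonneg_right (mul_le_mul_of_nonneg_left (h.trans ?_)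
          (by positivity)) (Real.exp_pos _).le
        gcongr
    _ = 2 ^ d * (Real.exp (R * n / 8 * ε ^ 2) * Real.exp (-(R * n / 4) * ε ^ 2))
        * ((16 * (d + 1) / δ) ^ j * j.factorial) := by ring
    _ = _ := by
        rw [← Real.exp_add]
        congr 3
        ring

theorem hasEntireGrowth_cutoffSeq (hS : MeasurableSet S) (hR : 0 < R) :
    HasEntireGrowth (cutoffSeq S R) := by
  refine ⟨fun n => contDiff_gaussianCutoff S (mul_pnat_pos hR n), fun s hs => ?_⟩
  refine ⟨2 ^ d + 32 * d ^ 2 * R / (2 * s ^ 2), by positivity, fun n j x => ?_⟩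
  have hn := mul_pnat_pos hR n
  refine (norm_iteratedFDeriv_cutoffSeq_le hS hR le_rfl (fun y _ => dist_nonneg) n j).trans ?_
  have h := sqrt_pow_mul_sqrt_factorial_le (K := 32 * d ^ 2 * R * n) (s := s)
    (by rw [mul_assoc]; positivity) hs j
  have h2 : 32 * (d : ℝ) ^ 2 * R * n / (2 * s ^ 2)
      ≤ (2 ^ d + 32 * d ^ 2 * R / (2 * s ^ 2)) * (n * (1 + ‖x‖ ^ 2)) := by
    have h3 : (n : ℝ) ≤ n * (1 + ‖x‖ ^ 2) :=
      le_mul_of_one_le_right (by positivity) (by nlinarith [sq_nonneg ‖x‖])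
    calc 32 * (d : ℝ) ^ 2 * R * n / (2 * s ^ 2) = 32 * d ^ 2 * R / (2 * s ^ 2) * n := by ring
      _ ≤ _ := by
        gcongr
        exact le_add_of_nonneg_left (by positivity)
  have h4 : Real.exp (-(R * n / 4) * (0 : ℝ) ^ 2) = 1 := by simp
  rw [h4, mul_one]
  calc _ ≤ 2 ^ d * (s ^ j * j.factorial * Real.exp (32 * d ^ 2 * R * n / (2 * s ^ 2))) := by
        gcongr
    _ ≤ (2 ^ d + 32 * d ^ 2 * R / (2 * s ^ 2)) * (s ^ j * j.factorial *
        Real.exp ((2 ^ d + 32 * d ^ 2 * R / (2 * s ^ 2)) * (n * (1 + ‖x‖ ^ 2)))) := by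
        gcongr
        exact le_add_of_nonneg_right (by positivity)
    _ = _ := by ring

theorem one_sub_cutoffSeq (hS : MeasurableSet S) (hR : 0 < R) :
    1 - cutoffSeq S R = cutoffSeq Sᶜ R := by
  funext n x
  have := gaussianCutoff_add_compl hS (mul_pnat_pos hR n) x
  simp only [Pi.sub_apply, Pi.one_apply, cutoffSeq]
  rw [← this]
  ring

/-- Away from `S` the cutoff beats exponential growth in `n`. -/
theorem norm_iteratedFDeriv_cutoffSeq_mul_le (hS : MeasurableSet S) (hR : 0 < R)
    {x : EuclideanSpace ℝ (Fin d)} {δ ε : ℝ} (hδ : 0 < δ) (hε : δ ≤ ε)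
    (hx : ∀ y ∈ S, ε ≤ dist x y) (n : ℕ+) {u : EuclideanSpace ℝ (Fin d) → ℂ}
    (hu : ContDiff ℝ ∞ u) {B : ℝ} (hB : 0 ≤ B)
    (hb : ∀ j, ‖iteratedFDeriv ℝ j u x‖ ≤ B * (1 ^ j * j.factorial)) (j : ℕ) :
    ‖iteratedFDeriv ℝ j (cutoffSeq S R n * u) x‖
      ≤ 2 ^ d * Real.exp (-(R * n / 8) * ε ^ 2) * B
        * ((16 * (d + 1) / δ + 1) ^ j * j.factorial) :=
  norm_iteratedFDeriv_mul_le_of_bound (contDiff_gaussianCutoff S (mul_pnat_pos hR n)) hu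
    (fun j => by positivity) factorial_mul_factorial_le (by positivity) hB (by positivity)
    zero_le_one (norm_iteratedFDeriv_cutoffSeq_le_of_dist hS hR hδ hε hx n) hb j

theorem exists_pos_le_dist {X : Type*} [PseudoMetricSpace X] {K S : Set X} {Ω : Set X}
    (hK : IsCompact K) (hΩ : IsOpen Ω) (hKΩ : K ⊆ Ω) (hd : Disjoint Ω S) :
    ∃ δ > 0, ∀ x ∈ K, ∀ y ∈ S, δ ≤ dist x y := by
  obtain ⟨δ, h0, h⟩ := hK.exists_thickening_subset_open hΩ hKΩ
  refine ⟨δ, h0, fun x hx y hy => ?_⟩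
  by_contra hlt
  push Not at hlt
  exact Set.disjoint_left.1 hd (h (Metric.mem_thickening_iff.2 ⟨x, hx, by rwa [dist_comm]⟩)) hy

namespace WeightSequence

variable {W : WeightSequence}

theorem isNegligible_cutoffSeq (hNE : W.NE) (hS : MeasurableSet S) (hR : 0 < R)
    {Ω : Opens (EuclideanSpace ℝ (Fin d))} (hd : Disjoint (Ω : Set (EuclideanSpace ℝ (Fin d))) S) :
    W.IsNegligible Ω (cutoffSeq S R) := by
  refine ⟨fun n => (hasEntireGrowth_cutoffSeq hS hR).isUltradifferentiable hNE Ω n,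
    fun K hK hKΩ => ?_⟩
  obtain ⟨δ, hδ, hdist⟩ := exists_pos_le_dist hK Ω.isOpen hKΩ hd
  obtain ⟨C, L, hC, hL, hb⟩ := hNE.exists_normLE (d := d)
  obtain ⟨lam, D, hlam, hD, he⟩ := hNE.exp_neg_le (show 0 < R / 8 * δ ^ 2 by positivity)
  refine ⟨lam, hlam, 16 * (d + 1) / δ * L, by positivity, C * (2 ^ d * D), fun n => ?_⟩
  refine (hb K (16 * (d + 1) / δ) (2 ^ d * Real.exp (-(R * n / 8) * δ ^ 2)) _ (by positivity)
    (by positivity) fun x hx k => norm_iteratedFDeriv_cutoffSeq_le_of_dist hS hR hδ le_rfl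
      (hdist x hx) n k).mono (by positivity) le_rfl ?_ (by positivity)
  have h1 := he n
  rw [show -(R / 8 * δ ^ 2 * n) = -(R * n / 8) * δ ^ 2 by ring] at h1
  calc C * (2 ^ d * Real.exp (-(R * n / 8) * δ ^ 2))
      ≤ C * (2 ^ d * (D * Real.exp (-W.assoc (lam * n)))) := by gcongr
    _ = _ := by ring

/-- The square of the derivative bound is, up to a constant, `(Kn)^k k!`. Here `(Kn)^k = (K/lam)^k
(lam n)^k ≤ (K/lam)^k M_k e^{M(lam n)}` and `k! ≤ C L^k M_k`, so the root is at most geometric times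
`M_k e^{M(lam n)}`. The argument works for every `lam`, with `h` depending on it. -/
theorem isModerate_cutoffSeq (hNE : W.NE) (hS : MeasurableSet S) (hR : 0 < R)
    (Ω : Opens (EuclideanSpace ℝ (Fin d))) : W.IsModerate Ω (cutoffSeq S R) := by
  refine ⟨fun n => (hasEntireGrowth_cutoffSeq hS hR).isUltradifferentiable hNE Ω n,
    fun K hK hKΩ lam hlam => ?_⟩
  obtain ⟨C, L, hC, hL, hb⟩ := hNE.factorial_le
  set h : ℝ := √(32 * d ^ 2 * R / lam * L) with hh
  refine ⟨h + 1, by positivity, 2 ^ d * √C, fun n => ?_⟩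
  refine NormLE.mono (h := h) (C := 2 ^ d * √C * Real.exp (W.assoc (lam * n)))
    (normLE_of_norm_iteratedFDeriv_le fun x _ k => ?_) (by positivity) (by linarith) le_rfl
    (by positivity)
  have hn := mul_pnat_pos hR n
  have hln := mul_pnat_pos hlam n
  have hnp : (0 : ℝ) < n := by exact_mod_cast n.pos
  have hMk := W.pos k
  have h0 := norm_iteratedFDeriv_cutoffSeq_le hS hR (x := x) le_rfl (fun y _ => dist_nonneg) n k
  rw [show Real.exp (-(R * n / 4) * (0 : ℝ) ^ 2) = 1 by simp, mul_one] at h0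
  refine h0.trans ?_
  have h1 : √(32 * d ^ 2 * R * n) ^ k * √(k.factorial : ℝ)
      ≤ h ^ k * √C * W.M k * Real.exp (W.assoc (lam * n)) := by
    refine (pow_le_pow_iff_left₀ (by positivity) (by positivity) two_ne_zero).1 ?_
    have e1 : (√(32 * d ^ 2 * R * n) ^ k * √(k.factorial : ℝ)) ^ 2
        = (32 * d ^ 2 * R * n) ^ k * k.factorial := by
      rw [mul_pow, ← pow_mul, mul_comm k 2, pow_mul, Real.sq_sqrt (by positivity),
        Real.sq_sqrt (by positivity)]
    have e2 : (h ^ k * √C * W.M k * Real.exp (W.assoc (lam * n))) ^ 2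
        = (32 * d ^ 2 * R / lam * L) ^ k * C * W.M k ^ 2 * Real.exp (W.assoc (lam * n)) ^ 2 := by
      rw [mul_pow, mul_pow, mul_pow, ← pow_mul, mul_comm k 2, pow_mul, hh,
        Real.sq_sqrt (by positivity), Real.sq_sqrt (by positivity)]
    rw [e1, e2]
    have h2 := W.pow_le_mul_exp_assoc hln k
    have h3 : (32 * d ^ 2 * R * n) ^ k = (32 * d ^ 2 * R / lam) ^ k * (lam * n) ^ k := by
      rw [← mul_pow]; congr 1; field_simp
    have h4 : 1 ≤ Real.exp (W.assoc (lam * n)) := Real.one_le_exp (W.assoc_nonneg hln)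
    rw [h3]
    calc (32 * d ^ 2 * R / lam) ^ k * (lam * n) ^ k * k.factorial
        ≤ (32 * d ^ 2 * R / lam) ^ k * (W.M k * Real.exp (W.assoc (lam * n)))
          * (C * L ^ k * W.M k) := by gcongr; exact hb k
      _ = (32 * d ^ 2 * R / lam * L) ^ k * C * W.M k ^ 2 * (Real.exp (W.assoc (lam * n)) * 1) := by
          rw [mul_pow]; ring
      _ ≤ (32 * d ^ 2 * R / lam * L) ^ k * C * W.M k ^ 2 *
          (Real.exp (W.assoc (lam * n)) * Real.exp (W.assoc (lam * n))) := by gcongr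
      _ = _ := by ring
  calc _ ≤ 2 ^ d * (h ^ k * √C * W.M k * Real.exp (W.assoc (lam * n))) := by gcongr
    _ = _ := by ring

theorem isNegligible_one_sub_cutoffSeq (hNE : W.NE) (hS : MeasurableSet S) (hR : 0 < R)
    {Ω : Opens (EuclideanSpace ℝ (Fin d))} (hd : (Ω : Set (EuclideanSpace ℝ (Fin d))) ⊆ S) :
    W.IsNegligible Ω (1 - cutoffSeq S R) := by
  rw [one_sub_cutoffSeq hS hR]
  exact isNegligible_cutoffSeq hNE hS.compl hR (Set.disjoint_compl_right_iff_subset.2 hd)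

end WeightSequence

end CutoffSeq

/-! ### Bounds for Chebyshev polynomials -/

section ChebyshevBounds

open Polynomial

theorem contDiff_polynomial_eval (p : ℝ[X]) : ContDiff ℝ ∞ fun x => p.eval x := by
  simpa using p.contDiff_aeval (𝕜 := ℝ) ∞

theorem iteratedDeriv_polynomial_eval (p : ℝ[X]) (j : ℕ) :
    iteratedDeriv j (fun x => p.eval x) = fun x => (derivative^[j] p).eval x := by
  induction j generalizing p with
  | zero => simp
  | succ j ih =>
    rw [iteratedDeriv_succ']
    have : deriv (fun x => p.eval x) = fun x => (derivative p).eval x := by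
      ext x; exact p.deriv
    rw [this, ih, Function.iterate_succ_apply]

/-- A bound on the whole line, needed for the growth of the truncated expansions. Differentiating
`T_{n+2} = 2X T_{n+1} - T_n` creates an extra term `2j T_{n+1}^{(j-1)}`, and `j s^{j-1}(j-1)! = s^j
j!/s`; so each step in `n` costs a factor `2|y| + 2/s + 1`. -/
theorem abs_iterate_derivative_T_le_pow_natAbs {s : ℝ} (hs : 0 < s) (k : ℤ) (j : ℕ) (y : ℝ) :
    |(derivative^[j] (Chebyshev.T ℝ k)).eval y|
      ≤ (2 * |y| + 2 / s + 1) ^ k.natAbs * (s ^ j * j.factorial) := by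
  have key : ∀ (n : ℕ) (j : ℕ), |(derivative^[j] (Chebyshev.T ℝ n)).eval y|
      ≤ (2 * |y| + 2 / s + 1) ^ n * (s ^ j * j.factorial) := by
    set Λ := 2 * |y| + 2 / s + 1 with hΛ
    have hs2 : 0 < 2 / s := by positivity
    have hΛ1 : 1 ≤ Λ := by have := abs_nonneg y; linarith
    intro n
    induction n using Nat.strong_induction_on with
    | _ n ih =>
      intro j
      match n with
      | 0 =>
        rcases j with _ | j
        · simp
        · simp only [Nat.cast_zero, Chebyshev.T_zero, Function.iterate_succ_apply, derivative_one,
            iterate_derivative_zero, eval_zero, abs_zero]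
          positivity
      | 1 =>
        rcases j with _ | _ | j
        · simp only [Nat.cast_one, Chebyshev.T_one, Function.iterate_zero_apply, eval_X]
          simp
          have := abs_nonneg y; linarith
        · simp only [Nat.cast_one, Chebyshev.T_one, zero_add, Function.iterate_one, derivative_X,
            eval_one]
          simp
          have : 2 / s * s = 2 := by field_simp
          have := abs_nonneg y
          nlinarith
        · simp only [Nat.cast_one, Chebyshev.T_one, Function.iterate_succ_apply, derivative_X,
            derivative_one, iterate_derivative_zero, eval_zero, abs_zero]
          positivity
      | n + 2 =>
        have e : Chebyshev.T ℝ ((n + 2 : ℕ) : ℤ)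
            = 2 * (Chebyshev.T ℝ ((n + 1 : ℕ) : ℤ) * X) - Chebyshev.T ℝ (n : ℤ) := by
          push_cast
          rw [Chebyshev.T_add_two]
          ring
        have h0 := ih n (by omega) j
        have h1 := ih (n + 1) (by omega) j
        have h2 : (j : ℝ) * |(derivative^[j - 1] (Chebyshev.T ℝ ((n + 1 : ℕ) : ℤ))).eval y|
            ≤ 1 / s * (Λ ^ (n + 1) * (s ^ j * j.factorial)) := by
          rcases j with _ | j
          · simp only [Nat.cast_zero, zero_mul]; positivity
          · have h3 := ih (n + 1) (by omega) j
            rw [Nat.add_sub_cancel]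
            calc _ ≤ ((j + 1 : ℕ) : ℝ) * (Λ ^ (n + 1) * (s ^ j * j.factorial)) := by gcongr
              _ = _ := by
                rw [Nat.factorial_succ]; push_cast; field_simp; ring
        have e2 : (derivative^[j] (Chebyshev.T ℝ ((n + 2 : ℕ) : ℤ))).eval y
            = 2 * (y * (derivative^[j] (Chebyshev.T ℝ ((n + 1 : ℕ) : ℤ))).eval y
              + j * (derivative^[j - 1] (Chebyshev.T ℝ ((n + 1 : ℕ) : ℤ))).eval y)
              - (derivative^[j] (Chebyshev.T ℝ (n : ℤ))).eval y := by
          rw [e, iterate_derivative_sub, ← Nat.cast_two (R := ℝ[X]), iterate_derivative_natCast_mul,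
            iterate_derivative_mul_X]
          simp
          ring
        rw [e2]
        set F := s ^ j * (j.factorial : ℝ) with hF
        have hF0 : 0 ≤ F := by positivity
        have hP0 : 0 ≤ Λ ^ (n + 1) * F := by positivity
        calc _ ≤ 2 * (|y| * |(derivative^[j] (Chebyshev.T ℝ ((n + 1 : ℕ) : ℤ))).eval y|
              + j * |(derivative^[j - 1] (Chebyshev.T ℝ ((n + 1 : ℕ) : ℤ))).eval y|)
              + |(derivative^[j] (Chebyshev.T ℝ (n : ℤ))).eval y| := by
              refine (abs_sub _ _).trans (add_le_add ?_ le_rfl)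
              rw [abs_mul, abs_two]
              refine mul_le_mul_of_nonneg_left ((abs_add_le _ _).trans ?_) zero_le_two
              rw [abs_mul, abs_mul, Nat.abs_cast]
          _ ≤ 2 * (|y| * (Λ ^ (n + 1) * F) + 1 / s * (Λ ^ (n + 1) * F)) + Λ ^ (n + 1) * F := by
              have : Λ ^ n * F ≤ Λ ^ (n + 1) * F := by gcongr; omega
              gcongr
              exact h0.trans this
          _ = Λ ^ (n + 2) * F := by rw [pow_succ Λ (n + 1)]; rw [hΛ]; ring
  have := key k.natAbs j
  rwa [Chebyshev.T_natAbs] at this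

/-- Bernstein type bounds in the interior of the interval. -/
theorem abs_iterate_derivative_T_le_of_abs_le_half (k : ℤ) (j : ℕ) {x : ℝ} (hx : |x| ≤ 1 / 2) :
    |(derivative^[j] (Chebyshev.T ℝ k)).eval x| ≤ (3 * |(k : ℝ)|) ^ j := by
  have hx2 : 3 / 4 ≤ 1 - x ^ 2 := by
    have := sq_abs x
    nlinarith [abs_nonneg x]
  induction j using Nat.strong_induction_on with
  | _ j ih =>
    match j with
    | 0 => simpa using Chebyshev.abs_eval_T_real_le_one k (hx.trans (by norm_num))
    | 1 =>
      -- The identity `(1 - x²) T_k' = k (T_{k-1} - x T_k)` gives `|T_k'| ≤ |k| (3/2)/(3/4) = 2|k|`.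
      have h1 := congrArg (eval x) (Chebyshev.one_sub_X_sq_mul_derivative_T_eq_poly_in_T (R := ℝ) (k - 1))
      simp only [sub_add_cancel, eval_mul, eval_sub, eval_one, eval_pow, eval_X,
        Int.cast_sub, Int.cast_one, eval_intCast] at h1
      have h2 := Chebyshev.abs_eval_T_real_le_one k (hx.trans (by norm_num : (1 : ℝ) / 2 ≤ 1))
      have h3 := Chebyshev.abs_eval_T_real_le_one (k - 1)
        (hx.trans (by norm_num : (1 : ℝ) / 2 ≤ 1))
      have h4 := congrArg abs h1
      rw [abs_mul, abs_mul, abs_of_nonneg (show 0 ≤ 1 - x ^ 2 by linarith)] at h4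
      have h5 : |eval x (Chebyshev.T ℝ (k - 1)) - x * eval x (Chebyshev.T ℝ k)| ≤ 3 / 2 := by
        refine (abs_sub _ _).trans ?_
        rw [abs_mul]
        nlinarith [abs_nonneg x, abs_nonneg (eval x (Chebyshev.T ℝ k))]
      have h6 := mul_le_mul_of_nonneg_left h5 (abs_nonneg (k : ℝ))
      simp only [Function.iterate_one, pow_one]
      have h7 := mul_le_mul_of_nonneg_right hx2 (abs_nonneg (eval x (derivative (Chebyshev.T ℝ k))))
      have h8 := abs_nonneg (k : ℝ)
      nlinarith
    | j + 2 =>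
      -- Above the degree the derivative vanishes. Otherwise `j + 2 ≤ K`, so in the differentiated
      -- Chebyshev equation the coefficients of orders `j + 1` and `j` are at most `K` and `K²`. The
      -- right side is then at most `4K²(3K)^j`, below `(3/4) · 9K²(3K)^j`.
      rcases lt_or_ge k.natAbs (j + 2) with hlt | hge
      · rw [iterate_derivative_eq_zero (by rwa [Chebyshev.natDegree_T]), eval_zero, abs_zero]
        positivity
      have h0 := ih j (by omega)
      have h1 := ih (j + 1) (by omega)
      set K := |(k : ℝ)| with hK
      have hjK : (j : ℝ) + 2 ≤ K := by
        rw [hK, ← Int.cast_abs, Int.abs_eq_natAbs]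
        exact_mod_cast hge
      have hj0 : (0 : ℝ) ≤ j := Nat.cast_nonneg j
      have e := congrArg abs (Chebyshev.one_sub_X_sq_mul_iterate_derivative_T_eval k j x)
      rw [abs_mul, abs_of_nonneg (show 0 ≤ 1 - x ^ 2 by linarith)] at e
      have hkK : (k : ℝ) ^ 2 = K ^ 2 := (sq_abs _).symm
      rw [hkK] at e
      have h2 : |(2 * j + 1) * x * eval x (derivative^[j + 1] (Chebyshev.T ℝ k))
          - (K ^ 2 - j ^ 2) * eval x (derivative^[j] (Chebyshev.T ℝ k))|
          ≤ K * (3 * K) ^ (j + 1) + K ^ 2 * (3 * K) ^ j := by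
        refine (abs_sub _ _).trans (add_le_add ?_ ?_)
        · rw [abs_mul]
          refine mul_le_mul ?_ h1 (abs_nonneg _) (by positivity)
          rw [abs_mul, abs_of_nonneg (by positivity)]
          nlinarith
        · rw [abs_mul]
          refine mul_le_mul ?_ h0 (abs_nonneg _) (by positivity)
          rw [abs_of_nonneg (by nlinarith)]
          nlinarith
      have h3 := mul_le_mul_of_nonneg_right hx2
        (abs_nonneg (eval x (derivative^[j + 2] (Chebyshev.T ℝ k))))
      have h4 : (3 * K) ^ (j + 2) = 9 * (K ^ 2 * (3 * K) ^ j) := by ring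
      have h5 : K * (3 * K) ^ (j + 1) = 3 * (K ^ 2 * (3 * K) ^ j) := by ring
      have h6 : 0 ≤ K ^ 2 * (3 * K) ^ j := by positivity
      rw [h4]
      linarith

end ChebyshevBounds

/-! ### Tensor products of Chebyshev polynomials -/

section ChebyshevFun

open Polynomial

variable {d : ℕ}

/-- The coordinate `x ↦ x i / ρ` as a linear form. -/
noncomputable def scaledCoord (ρ : ℝ) (i : Fin d) : EuclideanSpace ℝ (Fin d) →L[ℝ] ℝ :=
  ρ⁻¹ • (EuclideanSpace.proj i : EuclideanSpace ℝ (Fin d) →L[ℝ] ℝ)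

theorem scaledCoord_apply (ρ : ℝ) (i : Fin d) (x : EuclideanSpace ℝ (Fin d)) :
    scaledCoord ρ i x = ρ⁻¹ * x i := rfl

theorem abs_scaledCoord_le {ρ : ℝ} (hρ : 0 < ρ) (i : Fin d) (x : EuclideanSpace ℝ (Fin d)) :
    |scaledCoord ρ i x| ≤ ρ⁻¹ * ‖x‖ := by
  rw [scaledCoord_apply, abs_mul, abs_of_pos (inv_pos.2 hρ)]
  exact mul_le_mul_of_nonneg_left (PiLp.norm_apply_le x i) (inv_pos.2 hρ).le

theorem norm_scaledCoord_le {ρ : ℝ} (hρ : 0 < ρ) (i : Fin d) : ‖scaledCoord ρ i‖ ≤ ρ⁻¹ :=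
  ContinuousLinearMap.opNorm_le_bound _ (inv_pos.2 hρ).le fun x => abs_scaledCoord_le hρ i x

/-- The tensor product Chebyshev polynomials `∏ i, T_{k i} ((x i - x₀ i) / ρ)`. -/
noncomputable def chebyshevFun (x₀ : EuclideanSpace ℝ (Fin d)) (ρ : ℝ) (k : Fin d → ℤ) :
    EuclideanSpace ℝ (Fin d) → ℂ :=
  ∏ i, fun x => (((Chebyshev.T ℝ (k i)).eval (scaledCoord ρ i (x - x₀)) : ℝ) : ℂ)

variable {x₀ : EuclideanSpace ℝ (Fin d)} {ρ : ℝ}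

theorem contDiff_chebyshevFun_factor (k : Fin d → ℤ) (i : Fin d) : ContDiff ℝ ∞ fun x =>
    (((Chebyshev.T ℝ (k i)).eval (scaledCoord ρ i (x - x₀)) : ℝ) : ℂ) :=
  Complex.ofRealCLM.contDiff.comp ((contDiff_polynomial_eval (Chebyshev.T ℝ (k i))).comp
    ((ContinuousLinearMap.contDiff _).comp (contDiff_id.sub contDiff_const)))

theorem contDiff_chebyshevFun (k : Fin d → ℤ) : ContDiff ℝ ∞ (chebyshevFun x₀ ρ k) := by
  have e : chebyshevFun x₀ ρ k = fun x => ∏ i,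
      (((Chebyshev.T ℝ (k i)).eval (scaledCoord ρ i (x - x₀)) : ℝ) : ℂ) := by
    funext x; simp [chebyshevFun]
  rw [e]
  exact contDiff_prod fun i _ => contDiff_chebyshevFun_factor k i

theorem norm_iteratedFDeriv_chebyshevFun_factor_le (hρ : 0 < ρ) (k : Fin d → ℤ) (i : Fin d)
    (x : EuclideanSpace ℝ (Fin d)) (j : ℕ) :
    ‖iteratedFDeriv ℝ j (fun x =>
      (((Chebyshev.T ℝ (k i)).eval (scaledCoord ρ i (x - x₀)) : ℝ) : ℂ)) x‖
      ≤ |(derivative^[j] (Chebyshev.T ℝ (k i))).eval (scaledCoord ρ i (x - x₀))| * (ρ⁻¹) ^ j := by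
  refine (norm_iteratedFDeriv_ofReal_comp_clm_le (contDiff_polynomial_eval (Chebyshev.T ℝ (k i)))
    (scaledCoord ρ i) x₀ x j).trans ?_
  rw [iteratedDeriv_polynomial_eval, Real.norm_eq_abs]
  gcongr
  exact norm_scaledCoord_le hρ i

theorem abs_intCast_le_norm (k : Fin d → ℤ) (i : Fin d) : |(k i : ℝ)| ≤ ‖k‖ := by
  rw [← Int.norm_eq_abs]; exact norm_le_pi_norm k i

theorem norm_iteratedFDeriv_chebyshevFun_le_pow (hρ : 0 < ρ) (k : Fin d → ℤ)
    {x : EuclideanSpace ℝ (Fin d)} (hx : ∀ i, |scaledCoord ρ i (x - x₀)| ≤ 1 / 2) (j : ℕ) :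
    ‖iteratedFDeriv ℝ j (chebyshevFun x₀ ρ k) x‖ ≤ (3 * d / ρ * ‖k‖) ^ j := by
  refine (norm_iteratedFDeriv_prod_le_of_bound Finset.univ (w := fun _ => 1) (A := fun _ => 1)
    (a := 3 * ‖k‖ / ρ) (contDiff_chebyshevFun_factor k) le_rfl (fun _ => zero_le_one)
    (fun _ _ => by norm_num) (fun _ => zero_le_one) (by positivity) (fun i j => ?_) j).trans
    (le_of_eq ?_)
  · refine (norm_iteratedFDeriv_chebyshevFun_factor_le hρ k i x j).trans ?_
    rw [one_mul, mul_one, div_eq_mul_inv, mul_pow]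
    gcongr
    refine (abs_iterate_derivative_T_le_of_abs_le_half (k i) j (hx i)).trans ?_
    gcongr
    exact abs_intCast_le_norm k i
  · rw [Finset.prod_const_one, one_mul, mul_one, Finset.card_univ, Fintype.card_fin]
    congr 1
    ring

theorem exists_norm_iteratedFDeriv_chebyshevFun_le (hρ : 0 < ρ) {s : ℝ} (hs : 0 < s) :
    ∃ C : ℝ, 0 < C ∧ ∀ (k : Fin d → ℤ) (x : EuclideanSpace ℝ (Fin d)) (j : ℕ),
      ‖iteratedFDeriv ℝ j (chebyshevFun x₀ ρ k) x‖
        ≤ Real.exp (C * (‖k‖ * (1 + ‖x‖ ^ 2))) * (s ^ j * j.factorial) := by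
  -- Rescaling the coordinate multiplies the radius by `ρ⁻¹`, and the product of `d` factors
  -- multiplies it by `d`; the result `d s/(d+1)` is at most `s`.
  set s' : ℝ := s * ρ / (d + 1) with hs'
  have hs0 : 0 < s' := by positivity
  set c : ℝ := 2 * (ρ⁻¹ * (1 + ‖x₀‖)) + 2 / s' with hc
  have hc0 : 0 < c := by positivity
  refine ⟨d * c + 1, by positivity, fun k x j => ?_⟩
  have hw : ∀ i j : ℕ, (i.factorial : ℝ) * j.factorial ≤ (i + j).factorial :=
    factorial_mul_factorial_le
  refine (norm_iteratedFDeriv_prod_le_of_bound Finset.univ (w := fun j => (j.factorial : ℝ))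
    (A := fun _ => Real.exp (c * (‖k‖ * (1 + ‖x‖ ^ 2)))) (a := s / (d + 1))
    (contDiff_chebyshevFun_factor k) (by simp) (fun _ => by positivity) hw
    (fun _ => by positivity) (by positivity) (fun i j => ?_) j).trans ?_
  · refine (norm_iteratedFDeriv_chebyshevFun_factor_le hρ k i x j).trans ?_
    have h1 := abs_iterate_derivative_T_le_pow_natAbs hs0 (k i) j (scaledCoord ρ i (x - x₀))
    have h2 : 2 * |scaledCoord ρ i (x - x₀)| + 2 / s' ≤ c * (1 + ‖x‖ ^ 2) := by
      have h3 := abs_scaledCoord_le hρ i (x - x₀)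
      have h4 : ‖x - x₀‖ ≤ (1 + ‖x₀‖) * (1 + ‖x‖ ^ 2) := by
        refine (norm_sub_le _ _).trans ?_
        nlinarith [norm_nonneg x, norm_nonneg x₀, sq_nonneg (‖x‖ - 1),
          mul_nonneg (norm_nonneg x₀) (sq_nonneg ‖x‖)]
      have h5 : ρ⁻¹ * ‖x - x₀‖ ≤ ρ⁻¹ * (1 + ‖x₀‖) * (1 + ‖x‖ ^ 2) := by
        rw [mul_assoc]
        gcongr
      have h6 : 2 / s' ≤ 2 / s' * (1 + ‖x‖ ^ 2) :=
        le_mul_of_one_le_right (by positivity) (by nlinarith [sq_nonneg ‖x‖])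
      rw [hc]
      linarith
    have h3 : (2 * |scaledCoord ρ i (x - x₀)| + 2 / s' + 1) ^ (k i).natAbs
        ≤ Real.exp (c * (‖k‖ * (1 + ‖x‖ ^ 2))) := by
      calc _ ≤ Real.exp (c * (1 + ‖x‖ ^ 2)) ^ (k i).natAbs := by
            refine pow_le_pow_left₀ (by positivity) ((Real.add_one_le_exp _).trans ?_) _
            exact Real.exp_le_exp.2 h2
        _ = Real.exp (c * (|(k i : ℝ)| * (1 + ‖x‖ ^ 2))) := by
            rw [← Real.exp_nat_mul, Nat.cast_natAbs, Int.cast_abs]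
            congr 1; ring
        _ ≤ _ := by
            gcongr
            exact abs_intCast_le_norm k i
    calc _ ≤ Real.exp (c * (‖k‖ * (1 + ‖x‖ ^ 2))) * (s' ^ j * j.factorial) * (ρ⁻¹) ^ j := by
          gcongr
          exact h1.trans (by gcongr)
      _ = Real.exp (c * (‖k‖ * (1 + ‖x‖ ^ 2))) * ((s' * ρ⁻¹) ^ j * j.factorial) := by
          rw [mul_pow]; ring
      _ = _ := by
          have e : s' * ρ⁻¹ = s / (d + 1) := by rw [hs']; field_simp
          rw [e]
  · rw [Finset.prod_const, Finset.card_univ, Fintype.card_fin, ← Real.exp_nat_mul]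
    have e : (d : ℝ) * (s / (d + 1)) ≤ s := by
      rw [mul_div_assoc', div_le_iff₀ (by positivity)]
      nlinarith
    have h0 : 0 ≤ ‖k‖ * (1 + ‖x‖ ^ 2) := by positivity
    exact mul_le_mul (Real.exp_le_exp.2 (by nlinarith)) (mul_le_mul_of_nonneg_right
      (pow_le_pow_left₀ (by positivity) e j) (by positivity)) (by positivity) (by positivity)

end ChebyshevFun

/-! ### Fourier coefficients of functions composed with a cosine map -/

section TorusFourier

open MeasureTheory UnitAddTorus

attribute [local instance] instMeasureSpaceUnitAddCircle

local instance isAddHaarMeasure_unitAddCircle :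
    Measure.IsAddHaarMeasure (volume : Measure UnitAddCircle) :=
  inferInstanceAs (Measure.IsAddHaarMeasure AddCircle.haarAddCircle)

local instance isProbabilityMeasure_unitAddCircle :
    IsProbabilityMeasure (volume : Measure UnitAddCircle) :=
  inferInstanceAs (IsProbabilityMeasure AddCircle.haarAddCircle)

variable {d : ℕ}

/-- `Φ'` is the derivative of `Φ` in the `i`-th variable of the torus. -/
def HasTorusDeriv (i : Fin d) (Φ Φ' : UnitAddTorus (Fin d) → ℂ) : Prop :=
  ∀ θ, HasDerivAt (fun t : ℝ => Φ (θ + Pi.single i (t : UnitAddCircle))) (Φ' θ) 0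

theorem HasTorusDeriv.hasDerivAt {i : Fin d} {Φ Φ' : UnitAddTorus (Fin d) → ℂ}
    (h : HasTorusDeriv i Φ Φ') (θ : UnitAddTorus (Fin d)) (t : ℝ) :
    HasDerivAt (fun t : ℝ => Φ (θ + Pi.single i (t : UnitAddCircle)))
      (Φ' (θ + Pi.single i (t : UnitAddCircle))) t := by
  have h1 := h (θ + Pi.single i (t : UnitAddCircle))
  rw [← sub_self t] at h1
  have h2 := HasDerivAt.comp_sub_const t t h1
  refine h2.congr_of_eventuallyEq (Eventually.of_forall fun s => ?_)
  simp only [add_assoc, ← Pi.single_add, ← AddCircle.coe_add]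
  rw [add_sub_cancel]

/-- By translation invariance the integral of `Φ(θ + t e_i)` does not depend on `t`; differentiate
under the integral at `t = 0`. -/
theorem HasTorusDeriv.integral_eq_zero {i : Fin d} {Φ Φ' : UnitAddTorus (Fin d) → ℂ}
    (hΦ : Continuous Φ) (hΦ' : Continuous Φ') (h : HasTorusDeriv i Φ Φ') : ∫ θ, Φ' θ = 0 := by
  obtain ⟨B, hB⟩ := (isCompact_range hΦ').isBounded.exists_norm_le
  have h1 := (hasDerivAt_integral_of_dominated_loc_of_deriv_le
    (F := fun (t : ℝ) (θ : UnitAddTorus (Fin d)) => Φ (θ + Pi.single i (t : UnitAddCircle)))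
    (F' := fun (t : ℝ) (θ : UnitAddTorus (Fin d)) => Φ' (θ + Pi.single i (t : UnitAddCircle)))
    (μ := volume) (x₀ := (0 : ℝ)) (bound := fun _ => B) (s := univ) univ_mem
    (Eventually.of_forall fun t => (hΦ.comp (by fun_prop)).aestronglyMeasurable)
    ((hΦ.comp (by fun_prop)).integrable_of_hasCompactSupport
      (HasCompactSupport.of_compactSpace _))
    (hΦ'.comp (by fun_prop)).aestronglyMeasurable
    (Eventually.of_forall fun θ t _ => hB _ (mem_range_self _))
    (integrable_const _)
    (Eventually.of_forall fun θ t _ => h.hasDerivAt θ t)).2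
  have h2 : (fun t : ℝ => ∫ θ : UnitAddTorus (Fin d), Φ (θ + Pi.single i (t : UnitAddCircle)))
      = fun _ => ∫ θ, Φ θ := by
    funext t
    exact integral_add_right_eq_self _ _
  rw [h2] at h1
  have h3 := h1.unique (hasDerivAt_const _ _)
  simpa using h3

theorem mFourier_apply_add (q : Fin d → ℤ) (θ η : UnitAddTorus (Fin d)) :
    mFourier q (θ + η) = mFourier q θ * mFourier q η := by
  simp [mFourier, fourier_apply, Finset.prod_mul_distrib, AddCircle.toCircle_add]

theorem mFourier_apply_single (q : Fin d → ℤ) (i : Fin d) (z : UnitAddCircle) :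
    mFourier q (Pi.single i z) = fourier (q i) z := by
  simp only [mFourier, ContinuousMap.coe_mk]
  rw [Finset.prod_eq_single i]
  · simp
  · intro j _ hj
    rw [Pi.single_eq_of_ne hj, fourier_eval_zero]
  · simp

theorem hasTorusDeriv_mFourier (q : Fin d → ℤ) (i : Fin d) :
    HasTorusDeriv i (mFourier q) fun θ => 2 * Real.pi * Complex.I * q i * mFourier q θ := by
  intro θ
  have e : (fun t : ℝ => mFourier q (θ + Pi.single i (t : UnitAddCircle)))
      = fun t : ℝ => mFourier q θ * fourier (q i) (t : UnitAddCircle) := by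
    funext t
    rw [mFourier_apply_add, mFourier_apply_single]
  rw [e]
  have := (hasDerivAt_fourier (1 : ℝ) (q i) 0).const_mul (mFourier q θ)
  refine this.congr_deriv ?_
  rw [show ((0 : ℝ) : UnitAddCircle) = 0 by simp, fourier_eval_zero]
  push_cast
  ring

theorem HasTorusDeriv.mul {i : Fin d} {Φ Φ' Ψ Ψ' : UnitAddTorus (Fin d) → ℂ}
    (h : HasTorusDeriv i Φ Φ') (h' : HasTorusDeriv i Ψ Ψ') :
    HasTorusDeriv i (fun θ => Φ θ * Ψ θ) fun θ => Φ' θ * Ψ θ + Φ θ * Ψ' θ := by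
  intro θ
  have := (h θ).fun_mul (h' θ)
  simpa using this

/-- Integration by parts: the derivative of `mFourier (-q) * Φ` has integral zero. -/
theorem HasTorusDeriv.mFourierCoeff {i : Fin d} {Φ Φ' : UnitAddTorus (Fin d) → ℂ}
    (hΦ : Continuous Φ) (hΦ' : Continuous Φ') (h : HasTorusDeriv i Φ Φ') (q : Fin d → ℤ) :
    2 * Real.pi * Complex.I * q i * mFourierCoeff Φ q = mFourierCoeff Φ' q := by
  have h1 := HasTorusDeriv.integral_eq_zero (by fun_prop) (by fun_prop)
    ((hasTorusDeriv_mFourier (-q) i).mul h)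
  have hi : ∀ u : UnitAddTorus (Fin d) → ℂ, Continuous u → Integrable u := fun u hu =>
    hu.integrable_of_hasCompactSupport (HasCompactSupport.of_compactSpace _)
  rw [integral_add (hi _ (by fun_prop)) (hi _ (by fun_prop))] at h1
  simp only [UnitAddTorus.mFourierCoeff, smul_eq_mul]
  rw [← integral_const_mul, ← sub_eq_zero, ← neg_eq_zero, neg_sub, sub_eq_add_neg, ← integral_neg,
    ← h1, add_comm]
  congr 2
  funext θ
  simp
  ring

theorem norm_mFourierCoeff_le {Φ : UnitAddTorus (Fin d) → ℂ} {B : ℝ} (hB : ∀ θ, ‖Φ θ‖ ≤ B)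
    (q : Fin d → ℤ) : ‖mFourierCoeff Φ q‖ ≤ B := by
  refine (norm_integral_le_of_norm_le_const (C := B) (Eventually.of_forall fun θ => ?_)).trans
    (by simp)
  rw [norm_smul]
  have := ((mFourier (-q)).norm_coe_le_norm θ).trans_eq mFourier_norm
  calc _ ≤ 1 * B := mul_le_mul this (hB θ) (norm_nonneg _) zero_le_one
    _ = B := one_mul _

theorem mFourierCoeff_mFourier_mul (e q : Fin d → ℤ) (Φ : UnitAddTorus (Fin d) → ℂ) :
    mFourierCoeff (fun θ => mFourier e θ * Φ θ) q = mFourierCoeff Φ (q - e) := by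
  simp only [mFourierCoeff, smul_eq_mul, ← mul_assoc, ← mFourier_add]
  congr 3
  simp [sub_eq_add_neg, add_comm]

/-- The map `θ ↦ x₀ + ρ (cos 2πθ_i)_i` from the torus to `ℝ^d`. -/
noncomputable def cosTorusMap (x₀ : EuclideanSpace ℝ (Fin d)) (ρ : ℝ) (θ : UnitAddTorus (Fin d)) :
    EuclideanSpace ℝ (Fin d) :=
  x₀ + ρ • WithLp.toLp 2 fun i => (fourier 1 (θ i)).re

theorem continuous_cosTorusMap (x₀ : EuclideanSpace ℝ (Fin d)) (ρ : ℝ) :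
    Continuous (cosTorusMap x₀ ρ) := by
  unfold cosTorusMap
  refine continuous_const.add (Continuous.const_smul ?_ ρ)
  refine (PiLp.continuous_toLp 2 _).comp (continuous_pi fun i => ?_)
  exact Complex.continuous_re.comp (by fun_prop)

theorem cosTorusMap_add_single (x₀ : EuclideanSpace ℝ (Fin d)) (ρ : ℝ) (θ : UnitAddTorus (Fin d))
    (i : Fin d) (z : UnitAddCircle) :
    cosTorusMap x₀ ρ (θ + Pi.single i z) = cosTorusMap x₀ ρ θ
      + (ρ * ((fourier 1 (θ i + z)).re - (fourier 1 (θ i)).re)) • EuclideanSpace.single i 1 := by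
  ext j
  simp only [cosTorusMap, PiLp.add_apply, PiLp.smul_apply, Pi.add_apply, smul_eq_mul]
  by_cases hj : j = i
  · subst hj; simp; ring
  · simp [hj]

theorem hasDerivAt_cosTorusMap (x₀ : EuclideanSpace ℝ (Fin d)) (ρ : ℝ) (θ : UnitAddTorus (Fin d))
    (i : Fin d) :
    HasDerivAt (fun t : ℝ => cosTorusMap x₀ ρ (θ + Pi.single i (t : UnitAddCircle)))
      ((-(2 * Real.pi * ρ) * (fourier 1 (θ i)).im) • EuclideanSpace.single i 1) 0 := by
  simp only [cosTorusMap_add_single]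
  refine (HasDerivAt.smul_const ?_ _).const_add _
  have h1 : HasDerivAt (fun t : ℝ => fourier 1 (θ i + (t : UnitAddCircle)))
      (fourier 1 (θ i) * (2 * Real.pi * Complex.I)) 0 := by
    have : (fun t : ℝ => (fourier 1 (θ i + (t : UnitAddCircle)) : ℂ))
        = fun t : ℝ => fourier 1 (θ i) * fourier 1 (t : UnitAddCircle) := by
      funext t
      simp [fourier_apply, AddCircle.toCircle_add]
    rw [this]
    have := (hasDerivAt_fourier (1 : ℝ) 1 0).const_mul (fourier 1 (θ i))
    refine this.congr_deriv ?_
    rw [show ((0 : ℝ) : UnitAddCircle) = 0 by simp, fourier_eval_zero]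
    push_cast
    ring
  have h2 := Complex.reCLM.hasFDerivAt.comp_hasDerivAt (0 : ℝ) h1
  have h3 := (h2.sub_const (fourier 1 (θ i)).re).const_mul ρ
  refine h3.congr_deriv ?_
  rw [Complex.reCLM_apply]
  simp
  ring

/-- The chain rule produces the factor `sin 2πθ_i`, written as a difference of two characters so
that on the Fourier side it acts as a shift by `±1`. -/
theorem hasTorusDeriv_comp_cosTorusMap {x₀ : EuclideanSpace ℝ (Fin d)} {ρ : ℝ}
    {g : EuclideanSpace ℝ (Fin d) → ℂ} (i : Fin d)
    (hg : ∀ θ, DifferentiableAt ℝ g (cosTorusMap x₀ ρ θ)) :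
    HasTorusDeriv i (fun θ => g (cosTorusMap x₀ ρ θ)) fun θ =>
      Real.pi * ρ * Complex.I * (mFourier (Pi.single i 1) θ
          * fderiv ℝ g (cosTorusMap x₀ ρ θ) (EuclideanSpace.single i 1)
        - mFourier (-Pi.single i 1) θ
          * fderiv ℝ g (cosTorusMap x₀ ρ θ) (EuclideanSpace.single i 1)) := by
  intro θ
  have h0 : cosTorusMap x₀ ρ (θ + Pi.single i ((0 : ℝ) : UnitAddCircle)) = cosTorusMap x₀ ρ θ := by
    simp
  have h1 := (hg θ).hasFDerivAt
  rw [← h0] at h1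
  have h2 := h1.comp_hasDerivAt (0 : ℝ) (hasDerivAt_cosTorusMap x₀ ρ θ i)
  refine h2.congr_deriv ?_
  beta_reduce
  rw [h0, map_smul, mFourier_neg, mFourier_single, ← sub_mul, Complex.sub_conj, Complex.real_smul]
  push_cast
  linear_combination -(2 * Real.pi * ρ * (fourier 1 (θ i)).im *
    fderiv ℝ g (cosTorusMap x₀ ρ θ) (EuclideanSpace.single i 1)) * Complex.I_sq

/-- One integration by parts trades a factor `q i` for a derivative of `g`, with indices shifted by
`±1` in direction `i`; `ρ / 2` is `πρ / 2π`. This inequality is iterated to obtain decay. -/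
theorem abs_mul_norm_mFourierCoeff_le {x₀ : EuclideanSpace ℝ (Fin d)} {ρ : ℝ} (hρ : 0 ≤ ρ)
    {g : EuclideanSpace ℝ (Fin d) → ℂ} (i : Fin d)
    (hg : ∀ θ, ContDiffAt ℝ 1 g (cosTorusMap x₀ ρ θ)) (q : Fin d → ℤ) :
    |(q i : ℝ)| * ‖mFourierCoeff (fun θ => g (cosTorusMap x₀ ρ θ)) q‖
      ≤ ρ / 2 * (‖mFourierCoeff (fun θ => fderiv ℝ g (cosTorusMap x₀ ρ θ)
          (EuclideanSpace.single i 1)) (q - Pi.single i 1)‖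
        + ‖mFourierCoeff (fun θ => fderiv ℝ g (cosTorusMap x₀ ρ θ)
          (EuclideanSpace.single i 1)) (q + Pi.single i 1)‖) := by
  have hc : Continuous fun θ => g (cosTorusMap x₀ ρ θ) := continuous_iff_continuousAt.2 fun θ =>
    (hg θ).continuousAt.comp (continuous_cosTorusMap x₀ ρ).continuousAt
  have hc' : Continuous fun θ => fderiv ℝ g (cosTorusMap x₀ ρ θ) (EuclideanSpace.single i 1) := by
    refine continuous_iff_continuousAt.2 fun θ => ?_
    have h1 : ContinuousAt (fderiv ℝ g) (cosTorusMap x₀ ρ θ) :=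
      ((hg θ).fderiv_right (m := 0) (by norm_num)).continuousAt
    exact (h1.comp (continuous_cosTorusMap x₀ ρ).continuousAt).clm_apply continuousAt_const
  have h1 := HasTorusDeriv.mFourierCoeff hc (by fun_prop)
    (hasTorusDeriv_comp_cosTorusMap i fun θ => (hg θ).differentiableAt one_ne_zero) q
  have hi : ∀ u : UnitAddTorus (Fin d) → ℂ, Continuous u → Integrable u := fun u hu =>
    hu.integrable_of_hasCompactSupport (HasCompactSupport.of_compactSpace _)
  set D := fun θ => fderiv ℝ g (cosTorusMap x₀ ρ θ) (EuclideanSpace.single i 1) with hD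
  have h2 : mFourierCoeff (fun θ => Real.pi * ρ * Complex.I * (mFourier (Pi.single i 1) θ * D θ
      - mFourier (-Pi.single i 1) θ * D θ)) q
      = Real.pi * ρ * Complex.I * (mFourierCoeff D (q - Pi.single i 1)
        - mFourierCoeff D (q + Pi.single i 1)) := by
    rw [← sub_neg_eq_add q, ← mFourierCoeff_mFourier_mul, ← mFourierCoeff_mFourier_mul]
    simp only [mFourierCoeff, smul_eq_mul]
    rw [← integral_sub (hi _ (by fun_prop)) (hi _ (by fun_prop)), ← integral_const_mul]
    congr 1
    funext θ
    ring
  rw [h2] at h1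
  have h3 := congrArg norm h1
  simp only [norm_mul, Complex.norm_I, mul_one, Complex.norm_real, Complex.norm_intCast,
    Real.norm_eq_abs, Complex.norm_ofNat, abs_of_pos Real.pi_pos, abs_of_nonneg hρ] at h3
  have h4 := norm_sub_le (mFourierCoeff D (q - Pi.single i 1)) (mFourierCoeff D (q + Pi.single i 1))
  have hpi := Real.pi_pos
  have h5 : |(q i : ℝ)| * ‖mFourierCoeff (fun θ => g (cosTorusMap x₀ ρ θ)) q‖
      = ρ / 2 * ‖mFourierCoeff D (q - Pi.single i 1) - mFourierCoeff D (q + Pi.single i 1)‖ := by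
    have : Real.pi * (|(q i : ℝ)| * ‖mFourierCoeff (fun θ => g (cosTorusMap x₀ ρ θ)) q‖)
      = Real.pi * (ρ / 2 * ‖mFourierCoeff D (q - Pi.single i 1)
        - mFourierCoeff D (q + Pi.single i 1)‖) := by linarith
    exact mul_left_cancel₀ hpi.ne' this
  rw [h5]
  gcongr

end TorusFourier

/-! ### Decay of the coefficients and the Chebyshev expansion -/

section TorusFourierExpansion

open MeasureTheory UnitAddTorus

attribute [local instance] instMeasureSpaceUnitAddCircle isAddHaarMeasure_unitAddCircle
  isProbabilityMeasure_unitAddCircle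

variable {d : ℕ}

/-- In the iteration `b m q` bounds a coefficient of the `m`-th derivative, and `K` is the index at
which it started. After `m` shifts `q i` has moved by at most `m`, so `|K| ≤ |q i| + m`. The first
term gains `ρh` from the shift inequality; the second is absorbed by `m M_{m+p} ≤ c M_{m+p+1}`. Each
power of `K` thus costs `ρh + c`. -/
theorem WeightSequence.abs_pow_mul_le_of_shift (W : WeightSequence) {c : ℝ} (hc : 0 ≤ c)
    (hW : ∀ q : ℕ, (q : ℝ) * W.M q ≤ c * W.M (q + 1)) {A h ρ : ℝ} (hA : 0 ≤ A) (hh : 0 ≤ h)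
    (hρ : 0 ≤ ρ) (i : Fin d) {b : ℕ → (Fin d → ℤ) → ℝ} (hb0 : ∀ m q, 0 ≤ b m q)
    (hb : ∀ m q, b m q ≤ A * (h ^ m * W.M m))
    (hs : ∀ m q, |(q i : ℝ)| * b m q
      ≤ ρ / 2 * (b (m + 1) (q - Pi.single i 1) + b (m + 1) (q + Pi.single i 1)))
    (p m : ℕ) (q : Fin d → ℤ) (K : ℤ) (hK : |(K : ℝ) - q i| ≤ m) :
    |(K : ℝ)| ^ p * b m q ≤ A * (h ^ m * (ρ * h + c) ^ p * W.M (m + p)) := by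
  induction p generalizing m q with
  | zero => simpa using hb m q
  | succ p ih =>
    have hsplit : |(K : ℝ)| ≤ |(q i : ℝ)| + m := by
      have := abs_sub_abs_le_abs_sub (K : ℝ) (q i)
      linarith
    have hM := W.pos (m + p + 1)
    have hM' := W.pos (m + p)
    have h1 := ih (m + 1) (q - Pi.single i 1) (by
      have e : ((K : ℝ) - ((q - Pi.single i 1 : Fin d → ℤ) i : ℤ)) = (K - q i) + 1 := by
        simp; ring
      rw [e]
      refine (abs_add_le _ _).trans ?_
      push_cast
      rw [abs_one]
      linarith)
    have h2 := ih (m + 1) (q + Pi.single i 1) (by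
      have e : ((K : ℝ) - ((q + Pi.single i 1 : Fin d → ℤ) i : ℤ)) = (K - q i) - 1 := by
        simp; ring
      rw [e]
      refine (abs_sub _ _).trans ?_
      push_cast
      rw [abs_one]
      linarith)
    have h3 := ih m q hK
    have hmM : (m : ℝ) * W.M (m + p) ≤ c * W.M (m + p + 1) := by
      refine le_trans ?_ (hW (m + p))
      gcongr
      omega
    rw [show m + 1 + p = m + p + 1 by ring] at h1 h2
    set κ := ρ * h + c
    have hκ : 0 ≤ κ := by positivity
    calc |(K : ℝ)| ^ (p + 1) * b m q = |(K : ℝ)| ^ p * (|(K : ℝ)| * b m q) := by ring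
      _ ≤ |(K : ℝ)| ^ p * ((|(q i : ℝ)| + m) * b m q) := by
          gcongr
          exact hb0 m q
      _ = |(K : ℝ)| ^ p * (|(q i : ℝ)| * b m q) + m * (|(K : ℝ)| ^ p * b m q) := by ring
      _ ≤ |(K : ℝ)| ^ p * (ρ / 2 * (b (m + 1) (q - Pi.single i 1)
            + b (m + 1) (q + Pi.single i 1))) + m * (A * (h ^ m * κ ^ p * W.M (m + p))) :=
          add_le_add (mul_le_mul_of_nonneg_left (hs m q) (by positivity))
            (mul_le_mul_of_nonneg_left h3 (Nat.cast_nonneg _))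
      _ = ρ / 2 * (|(K : ℝ)| ^ p * b (m + 1) (q - Pi.single i 1)
            + |(K : ℝ)| ^ p * b (m + 1) (q + Pi.single i 1))
            + A * (h ^ m * κ ^ p * (m * W.M (m + p))) := by ring
      _ ≤ ρ / 2 * (A * (h ^ (m + 1) * κ ^ p * W.M (m + p + 1))
            + A * (h ^ (m + 1) * κ ^ p * W.M (m + p + 1)))
            + A * (h ^ m * κ ^ p * (c * W.M (m + p + 1))) := by gcongr
      _ = A * (h ^ m * κ ^ (p + 1) * W.M (m + (p + 1))) := by
          rw [← add_assoc, pow_succ κ]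
          simp only [κ]
          ring

theorem norm_intVec_pow_mul_le {a B : ℝ} (p : ℕ) (q : Fin d → ℤ) (ha : p = 0 → a ≤ B)
    (hB : 0 ≤ B) (h : ∀ i, |(q i : ℝ)| ^ p * a ≤ B) : ‖q‖ ^ p * a ≤ B := by
  rcases Nat.eq_zero_or_pos p with rfl | hp
  · simpa using ha rfl
  rcases isEmpty_or_nonempty (Fin d) with hd | hd
  · have : q = 0 := Subsingleton.elim _ _
    simp [this, hp.ne', hB]
  · obtain ⟨i, hi⟩ := Finite.exists_max fun i => ‖q i‖
    have : ‖q‖ = |(q i : ℝ)| := by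
      rw [← Int.norm_eq_abs]
      exact le_antisymm ((pi_norm_le_iff_of_nonneg (norm_nonneg _)).2 hi) (norm_le_pi_norm q i)
    rw [this]
    exact h i

theorem partialDeriv_zero (f : EuclideanSpace ℝ (Fin d) → ℂ) (σ : Fin 0 → Fin d)
    (x : EuclideanSpace ℝ (Fin d)) : WeightSequence.partialDeriv f σ x = f x :=
  iteratedFDeriv_zero_apply _

/-- The iteration, started at `m = 0` and `K = q i`, bounds `‖q‖^p` times the coefficient by `A (ρh
+ c)^p M_p`; the supremum over `p` produces the associated function. -/
theorem WeightSequence.norm_mFourierCoeff_le (W : WeightSequence) {c : ℝ} (hc : 0 < c)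
    (hW : ∀ q : ℕ, (q : ℝ) * W.M q ≤ c * W.M (q + 1)) {x₀ : EuclideanSpace ℝ (Fin d)} {ρ h A : ℝ}
    (hρ : 0 ≤ ρ) (hh : 0 ≤ h) (hA : 0 < A) {f : EuclideanSpace ℝ (Fin d) → ℂ}
    (hf : ∀ θ, ContDiffAt ℝ ∞ f (cosTorusMap x₀ ρ θ))
    (hb : W.NormLE (range (cosTorusMap x₀ ρ)) h A f) (q : Fin d → ℤ) :
    ‖mFourierCoeff (fun θ => f (cosTorusMap x₀ ρ θ)) q‖
      ≤ A * Real.exp (-W.assoc (‖q‖ / (ρ * h + c))) := by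
  have hκ : 0 < ρ * h + c := by positivity
  set a := ‖mFourierCoeff (fun θ => f (cosTorusMap x₀ ρ θ)) q‖ with ha
  have h0 : a ≤ A := by
    refine _root_.norm_mFourierCoeff_le (fun θ => ?_) q
    have := hb 0 ![] _ (mem_range_self θ)
    simpa [partialDeriv_zero, W.zero] using this
  have key : ∀ p : ℕ, ‖q‖ ^ p * a ≤ A * ((ρ * h + c) ^ p * W.M p) := by
    intro p
    have hp := W.pos p
    refine norm_intVec_pow_mul_le p q ?_ (by positivity) fun i => ?_
    · rintro rfl
      simpa [W.zero] using h0
    · have := W.abs_pow_mul_le_of_shift hc.le hW hA.le hh hρ i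
        (b := fun m q => ‖mFourierCoeff
          (fun θ => partialDeriv f (fun _ : Fin m => i) (cosTorusMap x₀ ρ θ)) q‖)
        (fun _ _ => norm_nonneg _)
        (fun m q => _root_.norm_mFourierCoeff_le (fun θ => hb m _ _ (mem_range_self θ)) q)
        (fun m q => by
          have hcd : ∀ θ, ContDiffAt ℝ ∞ (iteratedFDeriv ℝ m f) (cosTorusMap x₀ ρ θ) := fun θ =>
            (hf θ).iteratedFDeriv_right (by exact_mod_cast le_top)
          have h1 := abs_mul_norm_mFourierCoeff_le (x₀ := x₀) hρ
            (g := partialDeriv f (fun _ : Fin m => i)) i (fun θ =>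
              (ContinuousMultilinearMap.apply ℝ _ ℂ
                (fun _ : Fin m => EuclideanSpace.single i (1 : ℝ))).contDiff.contDiffAt.comp _
                  ((hcd θ).of_le (by exact_mod_cast le_top))) q
          have e : (fun θ => fderiv ℝ (partialDeriv f (fun _ : Fin m => i)) (cosTorusMap x₀ ρ θ)
              (EuclideanSpace.single i 1))
              = fun θ => partialDeriv f (fun _ : Fin (m + 1) => i) (cosTorusMap x₀ ρ θ) := by
            funext θ
            have hd := ((hcd θ).differentiableAt (by simp)).hasFDerivAt
            have := (ContinuousMultilinearMap.apply ℝ _ ℂ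
                (fun _ : Fin m => EuclideanSpace.single i (1 : ℝ))).hasFDerivAt.comp _ hd
            have e1 := this.fderiv
            unfold partialDeriv
            rw [iteratedFDeriv_succ_apply_left]
            exact congrArg (fun L => L (EuclideanSpace.single i (1 : ℝ))) e1
          rw [e] at h1
          exact h1) p 0 q (q i) (by simp)
      simp only [partialDeriv_zero] at this
      simpa using this
  have ha0 : 0 ≤ a := norm_nonneg _
  -- At `q = 0` the exponential is `1`, since `assoc 0 = 0`, and the trivial bound `a ≤ A` suffices.
  rcases eq_or_lt_of_le (norm_nonneg q) with hq | hq
  · rw [← hq]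
    simpa [WeightSequence.assoc] using h0
  rcases eq_or_lt_of_le ha0 with ha1 | ha1
  · rw [← ha1]; positivity
  have h1 := W.exp_assoc_le_of_pow_le (t := ‖q‖ / (ρ * h + c)) (B := A / a) (by positivity)
    (by positivity) (fun p => by
      rw [div_pow, div_le_iff₀ (by positivity), div_mul_eq_mul_div, div_mul_eq_mul_div,
        le_div_iff₀ ha1]
      linarith [key p])
  rw [le_div_iff₀ ha1] at h1
  rw [Real.exp_neg, ← div_eq_mul_inv, le_div_iff₀ (Real.exp_pos _)]
  linarith

theorem eval_chebyshev_T_re_fourier (n : ℤ) (z : UnitAddCircle) :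
    (((Polynomial.Chebyshev.T ℝ n).eval (fourier 1 z).re : ℝ) : ℂ)
      = (fourier n z + fourier n (-z)) / 2 := by
  have key : ∀ (n : ℤ) (y : ℝ), fourier n (y : UnitAddCircle)
      = Complex.exp ((n * (2 * Real.pi * y) : ℝ) * Complex.I) := by
    intro n y
    rw [fourier_coe_apply]
    congr 1
    push_cast
    ring
  induction z using QuotientAddGroup.induction_on with
  | H y =>
    have e : (-(y : UnitAddCircle)) = ((-y : ℝ) : UnitAddCircle) := rfl
    change (((Polynomial.Chebyshev.T ℝ n).eval (fourier 1 (y : UnitAddCircle)).re : ℝ) : ℂ)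
      = (fourier n (y : UnitAddCircle) + fourier n (-(y : UnitAddCircle))) / 2
    rw [e, key, key, key, Complex.exp_ofReal_mul_I_re]
    simp only [Int.cast_one, one_mul]
    rw [Polynomial.Chebyshev.T_real_cos, Complex.ofReal_cos, Complex.cos]
    push_cast
    congr 3
    ring_nf

/-- `T_n(cos t) = cos nt`, and a product of `d` cosines is the average of `2^d` characters over the
reflections of the torus. -/
theorem chebyshevFun_cosTorusMap {x₀ : EuclideanSpace ℝ (Fin d)} {ρ : ℝ} (hρ : 0 < ρ)
    (k : Fin d → ℤ) (θ : UnitAddTorus (Fin d)) :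
    chebyshevFun x₀ ρ k (cosTorusMap x₀ ρ θ)
      = ((2 : ℂ) ^ d)⁻¹ * ∑ ε : Fin d → Bool, mFourier k fun i => if ε i then θ i else -θ i := by
  have h1 : ∀ i, scaledCoord ρ i (cosTorusMap x₀ ρ θ - x₀) = (fourier 1 (θ i)).re := by
    intro i
    rw [scaledCoord_apply, cosTorusMap]
    simp
    field_simp
  rw [chebyshevFun, Finset.prod_apply]
  simp only [h1, eval_chebyshev_T_re_fourier]
  rw [Finset.prod_div_distrib, Finset.prod_const, Finset.card_univ, Fintype.card_fin,
    div_eq_inv_mul]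
  congr 1
  have h2 : ∀ i, fourier (k i) (θ i) + fourier (k i) (-θ i)
      = ∑ b : Bool, fourier (k i) (if b then θ i else -θ i) := by
    intro i; simp
  simp only [h2]
  rw [Finset.prod_univ_sum, Fintype.piFinset_univ]
  rfl

/-- `f ∘ cosTorusMap` is even in each variable, so its Fourier series has the sum `f x` at all `2^d`
reflections of a preimage `θ` of `x`. Averaging these series gives the Chebyshev series, here
indexed by all of `ℤ^d`. -/
theorem hasSum_chebyshevFun {x₀ : EuclideanSpace ℝ (Fin d)} {ρ : ℝ} (hρ : 0 < ρ)
    {f : EuclideanSpace ℝ (Fin d) → ℂ} (hf : Continuous fun θ => f (cosTorusMap x₀ ρ θ))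
    (hs : Summable (mFourierCoeff fun θ => f (cosTorusMap x₀ ρ θ)))
    {x : EuclideanSpace ℝ (Fin d)} (hx : ∀ i, |scaledCoord ρ i (x - x₀)| ≤ 1) :
    HasSum (fun k => mFourierCoeff (fun θ => f (cosTorusMap x₀ ρ θ)) k * chebyshevFun x₀ ρ k x)
      (f x) := by
  obtain ⟨θ, rfl⟩ : ∃ θ, cosTorusMap x₀ ρ θ = x := by
    refine ⟨fun i => ((Real.arccos (scaledCoord ρ i (x - x₀)) / (2 * Real.pi) : ℝ) :
      UnitAddCircle), ?_⟩
    ext i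
    have hi := abs_le.1 (hx i)
    simp only [cosTorusMap, PiLp.add_apply, PiLp.smul_apply, smul_eq_mul]
    rw [fourier_coe_apply]
    have e : (2 * Real.pi * Complex.I * ((1 : ℤ) : ℂ)
        * ((Real.arccos (scaledCoord ρ i (x - x₀)) / (2 * Real.pi) : ℝ) : ℂ) / ((1 : ℝ) : ℂ))
        = ((Real.arccos (scaledCoord ρ i (x - x₀)) : ℝ) : ℂ) * Complex.I := by
      have : (Real.pi : ℂ) ≠ 0 := by exact_mod_cast Real.pi_ne_zero
      push_cast
      field_simp
    rw [e, Complex.exp_ofReal_mul_I_re, Real.cos_arccos hi.1 hi.2, scaledCoord_apply]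
    simp
    field_simp
    ring
  simp only [chebyshevFun_cosTorusMap hρ]
  have h1 : ∀ ε : Fin d → Bool, HasSum (fun k => mFourierCoeff (fun θ => f (cosTorusMap x₀ ρ θ)) k
      * mFourier k fun i => if ε i then θ i else -θ i) (f (cosTorusMap x₀ ρ θ)) := by
    intro ε
    have h2 := hasSum_mFourier_series_apply_of_summable
      (f := ⟨fun θ => f (cosTorusMap x₀ ρ θ), hf⟩) hs fun i => if ε i then θ i else -θ i
    have e : cosTorusMap x₀ ρ (fun i => if ε i then θ i else -θ i) = cosTorusMap x₀ ρ θ := by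
      unfold cosTorusMap
      congr 3
      funext i
      beta_reduce
      split_ifs
      · rfl
      · rw [fourier_apply, fourier_apply, smul_neg, AddCircle.toCircle_neg, Circle.coe_inv_eq_conj,
          Complex.conj_re]
    simpa [e] using h2
  have h2 := (hasSum_sum (s := Finset.univ) fun ε _ => h1 ε).mul_left ((2 : ℂ) ^ d)⁻¹
  simp only [Finset.sum_const, Finset.card_univ, Fintype.card_fun, Fintype.card_bool,
    Fintype.card_fin, nsmul_eq_mul] at h2
  push_cast at h2
  rw [← mul_assoc, inv_mul_cancel₀ (pow_ne_zero _ two_ne_zero), one_mul] at h2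
  refine h2.congr_fun fun k => ?_
  rw [Finset.mul_sum, Finset.mul_sum, Finset.mul_sum]
  exact Finset.sum_congr rfl fun _ _ => by ring

end TorusFourierExpansion

/-! ### Local approximation by sequences of entire growth -/

section LocalSeries

variable {α E F : Type*} [NormedAddCommGroup E] [NormedSpace ℝ E] [NormedAddCommGroup F]
  [NormedSpace ℝ F] [CompleteSpace F]

theorem hasSum_iteratedFDeriv_of_isPreconnected {f : α → E → F} {v : ℕ → α → ℝ} {s : Set E}
    (hs : IsOpen s) (hs' : IsPreconnected s) (hf : ∀ i, ContDiff ℝ ∞ (f i))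
    (hv : ∀ k, Summable (v k)) (hfv : ∀ k i, ∀ x ∈ s, ‖iteratedFDeriv ℝ k (f i) x‖ ≤ v k i)
    {g : E → F} (hg : ∀ x ∈ s, HasSum (fun i => f i x) (g x)) (k : ℕ) {x : E} (hx : x ∈ s) :
    HasSum (fun i => iteratedFDeriv ℝ k (f i) x) (iteratedFDeriv ℝ k g x) := by
  have hsum : ∀ k, ∀ x ∈ s, Summable fun i => iteratedFDeriv ℝ k (f i) x := fun k x hx =>
    .of_norm_bounded (hv k) fun i => hfv k i x hx
  suffices h : ∀ x ∈ s, iteratedFDeriv ℝ k g x = ∑' i, iteratedFDeriv ℝ k (f i) x by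
    rw [h x hx]
    exact (hsum k x hx).hasSum
  induction k with
  | zero =>
    intro x hx
    simp_rw [iteratedFDeriv_zero_eq_comp, Function.comp_apply]
    rw [← (hg x hx).tsum_eq]
    exact (continuousMultilinearCurryFin0 ℝ E F).symm.toContinuousLinearEquiv.map_tsum
  | succ k ih =>
    intro x hx
    simp_rw [iteratedFDeriv_succ_eq_comp_left, Function.comp_apply]
    have h1 : iteratedFDeriv ℝ k g =ᶠ[𝓝 x] fun y => ∑' i, iteratedFDeriv ℝ k (f i) y :=
      Filter.eventuallyEq_of_mem (hs.mem_nhds hx) ih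
    have h2 := hasFDerivAt_tsum_of_isPreconnected (hv (k + 1)) hs hs'
      (f := fun i => iteratedFDeriv ℝ k (f i)) (f' := fun i => fderiv ℝ (iteratedFDeriv ℝ k (f i)))
      (fun i y _ => ((hf i).differentiable_iteratedFDeriv
        (by exact_mod_cast WithTop.coe_lt_top _) y).hasFDerivAt)
      (fun i y hy => by
        simpa only [iteratedFDeriv_succ_eq_comp_left, LinearIsometryEquiv.norm_map,
          Function.comp_apply] using hfv (k + 1) i y hy) hx (hsum k x hx) hx
    rw [h1.fderiv_eq, h2.fderiv]
    exact (continuousMultilinearCurryLeftEquiv ℝ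
      (fun _ : Fin (k + 1) => E) F).symm.toContinuousLinearEquiv.map_tsum

end LocalSeries

namespace WeightSequence

variable {d : ℕ} {W : WeightSequence}

/-- Two applications of `2M(t/H) ≤ M(t) + L`. The tail estimate of the Chebyshev expansion has four
separate uses for the decay of a coefficient. -/
theorem M2.exists_exp_neg_assoc_le (hM2 : W.M2) {κ : ℝ} (hκ : 0 < κ) : ∃ μ C : ℝ, 0 < μ ∧ 0 < C ∧
    ∀ s : ℝ, 0 ≤ s → Real.exp (-W.assoc (s / κ)) ≤ C * Real.exp (-W.assoc (μ * s)) ^ 4 := by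
  obtain ⟨H, L, hH, hL⟩ := hM2.exists_assoc
  refine ⟨1 / (κ * H * H), Real.exp |3 * L|, by positivity, Real.exp_pos _, fun s hs => ?_⟩
  rw [← Real.exp_nat_mul, ← Real.exp_add]
  refine Real.exp_le_exp.2 ?_
  rcases hs.eq_or_lt with rfl | hs
  · simp [WeightSequence.assoc]
  have h1 := hL (s / κ) (by positivity)
  have h2 := hL (s / κ / H) (by positivity)
  have e : 1 / (κ * H * H) * s = s / κ / H / H := by field_simp
  rw [e]
  have := le_abs_self (3 * L)
  push_cast
  linarith

theorem range_cosTorusMap_subset_ball (x₀ : EuclideanSpace ℝ (Fin d)) {r : ℝ} (hr : 0 < r) :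
    range (cosTorusMap x₀ (r / (d + 1))) ⊆ Metric.ball x₀ r := by
  rintro _ ⟨θ, rfl⟩
  have hd : (0 : ℝ) < d + 1 := by positivity
  rw [Metric.mem_ball, dist_eq_norm, cosTorusMap, add_sub_cancel_left, norm_smul, Real.norm_eq_abs,
    abs_of_pos (by positivity)]
  set v : EuclideanSpace ℝ (Fin d) := WithLp.toLp 2 fun i => (fourier 1 (θ i)).re
  have h1 : ‖v‖ ^ 2 ≤ d := by
    rw [EuclideanSpace.real_norm_sq_eq]
    calc ∑ i, v i ^ 2 ≤ ∑ _i : Fin d, (1 : ℝ) := by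
          refine Finset.sum_le_sum fun i _ => ?_
          rw [sq_le_one_iff_abs_le_one]
          refine (Complex.abs_re_le_norm _).trans ?_
          rw [fourier_apply, Circle.norm_coe]
      _ = d := by simp
  have h2 : ‖v‖ < d + 1 := by
    by_contra! h
    have : (0 : ℝ) ≤ d := Nat.cast_nonneg d
    nlinarith
  calc r / (d + 1) * ‖v‖ < r / (d + 1) * (d + 1) := by gcongr
    _ = r := by field_simp

/-- Near every point, a moderate sequence differs by a negligible one from a sequence of linear
combinations of products of Chebyshev polynomials. -/
theorem IsModerate.exists_hasEntireGrowth_sub (hM1 : W.M1) (hM2 : W.M2) (hNE : W.NE)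
    {U : Opens (EuclideanSpace ℝ (Fin d))} {f : ℕ+ → EuclideanSpace ℝ (Fin d) → ℂ}
    (hf : W.IsModerate U f) {x₀ : EuclideanSpace ℝ (Fin d)} (hx₀ : x₀ ∈ U) :
    ∃ V : Opens (EuclideanSpace ℝ (Fin d)), x₀ ∈ V ∧ V ≤ U ∧
      ∃ g, HasEntireGrowth g ∧ W.IsNegligible V (g - f) := by
  obtain ⟨r, hr, hrU⟩ := Metric.isOpen_iff.1 U.isOpen x₀ hx₀
  set ρ : ℝ := r / (d + 1) with hρdef
  have hρ : 0 < ρ := by positivity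
  have hρr : ρ ≤ r := div_le_self hr.le (by have : (0 : ℝ) ≤ d := Nat.cast_nonneg d; linarith)
  have hKU : range (cosTorusMap x₀ ρ) ⊆ U := (range_cosTorusMap_subset_ball x₀ hr).trans hrU
  have hX := continuous_cosTorusMap x₀ ρ
  obtain ⟨h, hh, C, hC⟩ := hf.2 _ (isCompact_range hX) hKU 1 one_pos
  obtain ⟨c, hc1, hcW⟩ := hNE.nat_mul_le hM1
  have hc : 0 < c := by linarith
  obtain ⟨Ce, Le, hCe, hLe, hexp⟩ := hNE.exp_assoc_le
  have hκ : 0 < ρ * h + c := by positivity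
  obtain ⟨μ, C', hμ, hC', hquart⟩ := hM2.exists_exp_neg_assoc_le hκ
  set a : ℕ+ → (Fin d → ℤ) → ℂ := fun n =>
    UnitAddTorus.mFourierCoeff fun θ => f n (cosTorusMap x₀ ρ θ) with hadef
  set B : ℕ+ → ℝ := fun n => (|C| + 1) * Real.exp (W.assoc n) with hB
  have hB0 : ∀ n, 0 < B n := fun n => by positivity
  have hcd : ∀ n x, x ∈ U → ContDiffAt ℝ ∞ (f n) x := fun n x hx =>
    (hf.1 n).1.contDiffAt (U.isOpen.mem_nhds hx)
  have ha : ∀ n q, ‖a n q‖ ≤ B n * Real.exp (-W.assoc (‖q‖ / (ρ * h + c))) := fun n q =>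
    W.norm_mFourierCoeff_le hc hcW hρ.le hh.le (hB0 n)
      (fun θ => hcd n _ (hKU (mem_range_self θ)))
      ((hC n).mono hh.le le_rfl (by
        rw [one_mul]
        exact mul_le_mul_of_nonneg_right (by linarith [le_abs_self C]) (Real.exp_pos _).le)
        (hB0 n).le) q
  have hsum1 : Summable fun q : Fin d → ℤ => Real.exp (-W.assoc (‖q‖ / (ρ * h + c))) := by
    have := W.summable_exp_neg_assoc d (inv_pos.2 hκ)
    simpa only [inv_mul_eq_div] using this
  have hsum2 := W.summable_exp_neg_assoc d hμ
  -- With this truncation level every discarded index satisfies `n ≤ μ‖q‖`, hence `e^{-M(μ‖q‖)} ≤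
  -- e^{-M(n)}`.
  set R : ℝ := μ⁻¹ with hR
  have hR0 : 0 < R := inv_pos.2 hμ
  have hfin : ∀ n : ℕ+, {q : Fin d → ℤ | ‖q‖ ≤ R * n}.Finite := fun n => by
    have : {q : Fin d → ℤ | ‖q‖ ≤ R * n} = Metric.closedBall 0 (R * n) := by
      ext q; simp
    rw [this]
    exact (isCompact_closedBall (0 : Fin d → ℤ) _).finite_of_discrete
  set T : ℕ+ → Finset (Fin d → ℤ) := fun n => (hfin n).toFinset with hT
  have hmemT : ∀ n q, q ∈ T n ↔ ‖q‖ ≤ R * n := fun n q => by simp [hT]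
  set g : ℕ+ → EuclideanSpace ℝ (Fin d) → ℂ := fun n x =>
    ∑ q ∈ T n, a n q * chebyshevFun x₀ ρ q x with hg
  have hgcd : ∀ n, ContDiff ℝ ∞ (g n) := fun n =>
    ContDiff.sum fun q _ => contDiff_const.mul (contDiff_chebyshevFun q)
  -- For `‖q‖ ≤ Rn` the growth `e^{C0‖q‖(1+‖x‖²)}` is exponential in `n`, and so is `e^{M(n)} ≤ Ce
  -- e^{Le n}` by (NE).
  have hgE : HasEntireGrowth g := by
    refine ⟨hgcd, fun s hs => ?_⟩
    obtain ⟨C0, hC0, hcheb⟩ := exists_norm_iteratedFDeriv_chebyshevFun_le (x₀ := x₀) hρ hs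
    set S := ∑' q : Fin d → ℤ, Real.exp (-W.assoc (‖q‖ / (ρ * h + c))) with hS
    have hS0 : 0 ≤ S := tsum_nonneg fun _ => (Real.exp_pos _).le
    set C1 := (|C| + 1) * Ce * S with hC1
    have hC10 : 0 ≤ C1 := by positivity
    refine ⟨C1 + (Le + C0 * R), by positivity, fun n j x => ?_⟩
    have hn : (1 : ℝ) ≤ n := Nat.one_le_cast.2 n.pos
    have hn0 : (0 : ℝ) < n := by linarith
    have e : iteratedFDeriv ℝ j (g n) x
        = ∑ q ∈ T n, a n q • iteratedFDeriv ℝ j (chebyshevFun x₀ ρ q) x := by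
      have h1 : g n = fun x => ∑ q ∈ T n, (a n q • chebyshevFun x₀ ρ q) x := rfl
      have h2 : ∀ q, ContDiffAt ℝ j (chebyshevFun x₀ ρ q) x := fun q =>
        ((contDiff_chebyshevFun q).of_le (by exact_mod_cast le_top)).contDiffAt
      have h3 := iteratedFDeriv_fun_sum_apply (u := T n) (x := x) (n := j)
        (f := fun q => a n q • chebyshevFun x₀ ρ q) fun q _ => (h2 q).const_smul (a n q)
      rw [h1, h3]
      exact Finset.sum_congr rfl fun q _ => iteratedFDeriv_const_smul_apply (h2 q)
    rw [e]
    calc ‖∑ q ∈ T n, a n q • iteratedFDeriv ℝ j (chebyshevFun x₀ ρ q) x‖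
        ≤ ∑ q ∈ T n, B n * Real.exp (-W.assoc (‖q‖ / (ρ * h + c)))
            * (Real.exp (C0 * (R * n * (1 + ‖x‖ ^ 2))) * (s ^ j * j.factorial)) := by
          refine (norm_sum_le _ _).trans (Finset.sum_le_sum fun q hq => ?_)
          rw [norm_smul]
          have := (hmemT n q).1 hq
          refine mul_le_mul (ha n q) ((hcheb q x j).trans ?_) (norm_nonneg _)
            (mul_nonneg (hB0 n).le (Real.exp_pos _).le)
          gcongr
      _ = (∑ q ∈ T n, Real.exp (-W.assoc (‖q‖ / (ρ * h + c))))
            * (B n * (Real.exp (C0 * (R * n * (1 + ‖x‖ ^ 2))) * (s ^ j * j.factorial))) := by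
          rw [Finset.sum_mul]
          exact Finset.sum_congr rfl fun _ _ => by ring
      _ ≤ S * ((|C| + 1) * (Ce * Real.exp (Le * n))
            * (Real.exp (C0 * (R * n * (1 + ‖x‖ ^ 2))) * (s ^ j * j.factorial))) := by
          have h1 := hsum1.sum_le_tsum (T n) fun _ _ => (Real.exp_pos _).le
          have h2 := hexp n hn0
          have h3 : B n ≤ (|C| + 1) * (Ce * Real.exp (Le * n)) := by
            simp only [hB]
            gcongr
          have : 0 < B n := hB0 n
          gcongr
      _ = C1 * Real.exp (Le * n + C0 * (R * n * (1 + ‖x‖ ^ 2))) * (s ^ j * j.factorial) := by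
          rw [Real.exp_add]; ring
      _ ≤ _ := by
          have hx2 : 1 ≤ 1 + ‖x‖ ^ 2 := by have := sq_nonneg ‖x‖; linarith
          have h3 : Le * n + C0 * (R * n * (1 + ‖x‖ ^ 2))
              ≤ (C1 + (Le + C0 * R)) * (n * (1 + ‖x‖ ^ 2)) := by
            have h4 : Le * n ≤ Le * (n * (1 + ‖x‖ ^ 2)) := by
              gcongr
              nlinarith
            have h5 : 0 ≤ C1 * (n * (1 + ‖x‖ ^ 2)) := by positivity
            nlinarith
          have h6 : C1 ≤ C1 + (Le + C0 * R) := by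
            have : 0 ≤ Le + C0 * R := by positivity
            linarith
          gcongr
  -- The radius `ρ / 2` keeps the scaled coordinates in `[-1/2, 1/2]`, where the Bernstein bound
  -- holds.
  let V : Opens (EuclideanSpace ℝ (Fin d)) := ⟨Metric.ball x₀ (ρ / 2), Metric.isOpen_ball⟩
  have hVU : V ≤ U := fun x hx => hrU (Metric.ball_subset_ball (by linarith) hx)
  refine ⟨V, Metric.mem_ball_self (by positivity), hVU, g, hgE, ?_⟩
  have hVbox : ∀ x ∈ V, ∀ i, |scaledCoord ρ i (x - x₀)| ≤ 1 / 2 := by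
    intro x hx i
    have h1 : ‖x - x₀‖ < ρ / 2 := by rw [← dist_eq_norm]; exact hx
    have h2 := PiLp.norm_apply_le (x - x₀) i
    rw [scaledCoord_apply, abs_mul, abs_of_pos (inv_pos.2 hρ), inv_mul_le_iff₀ hρ]
    rw [Real.norm_eq_abs] at h2
    linarith
  set b : ℕ+ → (Fin d → ℤ) → ℂ := fun n q => if q ∈ T n then 0 else -a n q with hb
  have hser : ∀ n, ∀ x ∈ V, HasSum (fun q => (b n q • chebyshevFun x₀ ρ q) x) ((g - f) n x) := by
    intro n x hx
    have hcont : Continuous fun θ => f n (cosTorusMap x₀ ρ θ) := continuous_iff_continuousAt.2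
      fun θ => (hcd n _ (hKU (mem_range_self θ))).continuousAt.comp hX.continuousAt
    have h1 := hasSum_chebyshevFun hρ hcont
      (Summable.of_norm_bounded (hsum1.mul_left (B n)) (ha n))
      (fun i => (hVbox x hx i).trans (by norm_num))
    have h2 : HasSum (fun q => if q ∈ T n then a n q * chebyshevFun x₀ ρ q x else 0) (g n x) := by
      have : HasSum (fun q => if q ∈ T n then a n q * chebyshevFun x₀ ρ q x else 0)
          (∑ q ∈ T n, if q ∈ T n then a n q * chebyshevFun x₀ ρ q x else 0) :=
        hasSum_sum_of_ne_finset_zero fun q hq => if_neg hq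
      rwa [Finset.sum_congr rfl fun q hq => if_pos hq] at this
    refine (h2.sub h1).congr_fun fun q => ?_
    simp only [hb, Pi.smul_apply, smul_eq_mul, hadef]
    split_ifs <;> ring
  set D := |C| + 1 with hD
  set S := ∑' q : Fin d → ℤ, Real.exp (-W.assoc (μ * ‖q‖)) with hS
  have hbound : ∀ (n : ℕ+) (j : ℕ) (q : Fin d → ℤ), ∀ x ∈ V,
      ‖iteratedFDeriv ℝ j (b n q • chebyshevFun x₀ ρ q) x‖
        ≤ D * C' * Real.exp (-W.assoc n) * ((3 * d / ρ * μ⁻¹) ^ j * W.M j)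
          * Real.exp (-W.assoc (μ * ‖q‖)) := by
    intro n j q x hx
    have hMj := W.pos j
    have h2 : ContDiffAt ℝ j (chebyshevFun x₀ ρ q) x :=
        ((contDiff_chebyshevFun q).of_le (by exact_mod_cast le_top)).contDiffAt
    rw [iteratedFDeriv_const_smul_apply h2, norm_smul]
    by_cases hq : q ∈ T n
    · simp only [hb, if_pos hq, norm_zero, zero_mul]
      positivity
    have hn0 : (0 : ℝ) < n := by exact_mod_cast n.pos
    have hq' : R * n < ‖q‖ := lt_of_not_ge fun h => hq ((hmemT n q).2 h)
    have hnq : (n : ℝ) ≤ μ * ‖q‖ := by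
      have := mul_le_mul_of_nonneg_left hq'.le hμ.le
      rwa [hR, mul_inv_cancel_left₀ hμ.ne'] at this
    set e := Real.exp (-W.assoc (μ * ‖q‖)) with he
    have he0 : 0 < e := Real.exp_pos _
    have hen : e ≤ Real.exp (-W.assoc n) :=
      Real.exp_le_exp.2 (neg_le_neg (W.assoc_mono hn0 hnq))
    have h3 : (μ * ‖q‖) ^ j * e ≤ W.M j := by
      have := W.pow_le_mul_exp_assoc (t := μ * ‖q‖) (by linarith) j
      rw [he, Real.exp_neg, ← div_eq_mul_inv, div_le_iff₀ (Real.exp_pos _)]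
      exact this
    have h4 : (3 * d / ρ * ‖q‖) ^ j * e ≤ (3 * d / ρ * μ⁻¹) ^ j * W.M j := by
      calc (3 * d / ρ * ‖q‖) ^ j * e = (3 * d / ρ * μ⁻¹) ^ j * ((μ * ‖q‖) ^ j * e) := by
            rw [← mul_assoc, ← mul_pow]
            congr 2
            field_simp
        _ ≤ _ := by gcongr
    have h5 : ‖b n q‖ ≤ D * C' * Real.exp (W.assoc n) * e ^ 4 := by
      simp only [hb, if_neg hq, norm_neg]
      calc ‖a n q‖ ≤ D * Real.exp (W.assoc n) * Real.exp (-W.assoc (‖q‖ / (ρ * h + c))) := ha n q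
        _ ≤ D * Real.exp (W.assoc n) * (C' * e ^ 4) := by
            gcongr
            exact hquart _ (norm_nonneg q)
        _ = _ := by ring
    calc ‖b n q‖ * ‖iteratedFDeriv ℝ j (chebyshevFun x₀ ρ q) x‖
        ≤ D * C' * Real.exp (W.assoc n) * e ^ 4 * (3 * d / ρ * ‖q‖) ^ j :=
          mul_le_mul h5 (norm_iteratedFDeriv_chebyshevFun_le_pow hρ q (hVbox x hx) j)
            (norm_nonneg _) (by positivity)
      -- Of the four factors `e`, two become `e^{-M(n)}`: one cancels `e^{M(n)}`, the other is the
      -- required decay. The third turns `‖q‖^j` into `M_j`, and the fourth makes the sum over `q`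
      -- converge.
      _ = D * C' * Real.exp (W.assoc n) * (e * e) * ((3 * d / ρ * ‖q‖) ^ j * e) * e := by ring
      _ ≤ D * C' * Real.exp (W.assoc n) * (Real.exp (-W.assoc n) * Real.exp (-W.assoc n))
            * ((3 * d / ρ * μ⁻¹) ^ j * W.M j) * e := by gcongr
      _ = _ := by
          have h6 : Real.exp (W.assoc n) * Real.exp (-W.assoc n) = 1 := by
            rw [← Real.exp_add, add_neg_cancel, Real.exp_zero]
          linear_combination (D * C' * Real.exp (-W.assoc n)
            * ((3 * d / ρ * μ⁻¹) ^ j * W.M j) * e) * h6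
  refine ⟨fun n => ?_, fun K _ hKV => ⟨1, one_pos, 3 * d / ρ * μ⁻¹ + 1, by positivity,
    D * C' * S, fun n => ?_⟩⟩
  · have h1 := (hgE.isUltradifferentiable hNE V n).add ((hf.restrict hVU).neg.1 n)
    rwa [sub_eq_add_neg]
  · refine normLE_of_norm_iteratedFDeriv_le fun x hx j => ?_
    have h1 := hasSum_iteratedFDeriv_of_isPreconnected (s := Metric.ball x₀ (ρ / 2))
      Metric.isOpen_ball (convex_ball _ _).isPreconnected
      (f := fun q => b n q • chebyshevFun x₀ ρ q)
      (fun q => contDiff_const.smul (contDiff_chebyshevFun q))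
      (fun j => hsum2.mul_left (D * C' * Real.exp (-W.assoc n)
        * ((3 * d / ρ * μ⁻¹) ^ j * W.M j))) (hbound n) (hser n) j (hKV hx)
    have h2 := tsum_of_norm_bounded (hsum2.hasSum.mul_left (D * C' * Real.exp (-W.assoc n)
        * ((3 * d / ρ * μ⁻¹) ^ j * W.M j))) fun q => hbound n j q x (hKV hx)
    rw [h1.tsum_eq] at h2
    have hMj := W.pos j
    have hS0 : 0 ≤ S := tsum_nonneg fun _ => (Real.exp_pos _).le
    calc _ ≤ _ := h2
      _ = D * C' * S * Real.exp (-W.assoc n) * ((3 * d / ρ * μ⁻¹) ^ j * W.M j) := by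
          rw [← hS]; ring
      _ ≤ _ := by
          rw [one_mul]
          gcongr
          linarith

end WeightSequence

/-! ### Gluing sequences of entire growth -/

section Gluing

variable {d : ℕ}

theorem HasEntireGrowth.zero : HasEntireGrowth (0 : ℕ+ → EuclideanSpace ℝ (Fin d) → ℂ) := by
  have h := hasEntireGrowth_cutoffSeq (d := d) MeasurableSet.empty one_pos
  simpa using h.sub h

/-- The point is the order of quantifiers: `D` depends only on `u` and `r`, so `R` can be chosen
afterwards to make the exponent as negative as desired. -/
theorem HasEntireGrowth.exists_norm_iteratedFDeriv_cutoffSeq_mul_le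
    {u : ℕ+ → EuclideanSpace ℝ (Fin d) → ℂ} (hu : HasEntireGrowth u) (r : ℝ) :
    ∃ D : ℝ, 0 < D ∧ ∀ (S : Set (EuclideanSpace ℝ (Fin d))) (R δ : ℝ)
      (x : EuclideanSpace ℝ (Fin d)), MeasurableSet S → 0 < R → ‖x‖ ≤ r → 0 < δ →
      (∀ y ∈ S, δ ≤ dist x y) → ∀ (n : ℕ+) (j : ℕ),
      ‖iteratedFDeriv ℝ j ((cutoffSeq S R * u) n) x‖
        ≤ Real.exp ((D - R * δ ^ 2 / 8) * n) * ((16 * (d + 1) / δ + 1) ^ j * j.factorial) := by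
  obtain ⟨C, hC, hb⟩ := hu.2 1 one_pos
  refine ⟨2 ^ d * C + C * (1 + r ^ 2), by positivity, fun S R δ x hS hR hx hδ hd n j => ?_⟩
  have hn : (1 : ℝ) ≤ n := Nat.one_le_cast.2 n.pos
  refine (norm_iteratedFDeriv_cutoffSeq_mul_le hS hR hδ le_rfl hd n (hu.1 n)
    (B := C * Real.exp (C * (n * (1 + r ^ 2)))) (by positivity) (fun j => (hb n j x).trans ?_)
    j).trans ?_
  · gcongr
  · refine mul_le_mul_of_nonneg_right ?_ (by positivity)
    have h1 : 2 ^ d * C ≤ Real.exp (2 ^ d * C * n) := by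
      have h2 := Real.add_one_le_exp (2 ^ d * C * n)
      have h3 : 2 ^ d * C ≤ 2 ^ d * C * n := le_mul_of_one_le_right (by positivity) hn
      linarith
    calc _ = 2 ^ d * C * (Real.exp (-(R * n / 8) * δ ^ 2) * Real.exp (C * (n * (1 + r ^ 2)))) := by
          ring
      _ ≤ Real.exp (2 ^ d * C * n)
          * (Real.exp (-(R * n / 8) * δ ^ 2) * Real.exp (C * (n * (1 + r ^ 2)))) := by gcongr
      _ = _ := by
          rw [← Real.exp_add, ← Real.exp_add]
          congr 1
          ring

theorem exists_isBounded_nhds_le_dist {K S : Set (EuclideanSpace ℝ (Fin d))}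
    {Ω : Set (EuclideanSpace ℝ (Fin d))} (hK : IsCompact K) (hΩ : IsOpen Ω) (hKΩ : K ⊆ Ω)
    (hd : Disjoint Ω S) : ∃ (N : Opens (EuclideanSpace ℝ (Fin d))) (r δ : ℝ), K ⊆ N ∧ 0 < δ ∧
      (∀ x ∈ N, ‖x‖ ≤ r) ∧ ∀ x ∈ N, ∀ y ∈ S, δ ≤ dist x y := by
  obtain ⟨δ, hδ, h⟩ := exists_pos_le_dist hK hΩ hKΩ hd
  obtain ⟨r, hr⟩ := (hK.isBounded.thickening (δ := δ / 2)).exists_norm_le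
  refine ⟨⟨Metric.thickening (δ / 2) K, Metric.isOpen_thickening⟩, r, δ / 2,
    Metric.self_subset_thickening (by positivity) K, by positivity, hr, fun x hx y hy => ?_⟩
  obtain ⟨z, hz, hxz⟩ := Metric.mem_thickening_iff.1 hx
  have h1 := h z hz y hy
  have h2 := dist_triangle_left z y x
  linarith

namespace WeightSequence

variable {W : WeightSequence}

theorem NE.isNegligible_of_norm_le (hNE : W.NE) {V : Opens (EuclideanSpace ℝ (Fin d))}
    {u : ℕ+ → EuclideanSpace ℝ (Fin d) → ℂ} (hu : ∀ n, ContDiff ℝ ∞ (u n)) {a A c : ℝ}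
    (ha : 0 < a) (hA : 0 ≤ A) (hc : 0 < c)
    (hb : ∀ n : ℕ+, ∀ x ∈ V, ∀ j, ‖iteratedFDeriv ℝ j (u n) x‖
      ≤ A * Real.exp (-(c * n)) * (a ^ j * j.factorial)) : W.IsNegligible V u := by
  obtain ⟨C, L, hC, hL, h⟩ := hNE.exists_normLE (d := d)
  obtain ⟨lam, D, hlam, hD, he⟩ := hNE.exp_neg_le hc
  have key : ∀ n : ℕ+, ∀ K : Set (EuclideanSpace ℝ (Fin d)), K ⊆ V →
      W.NormLE K (a * L) (C * (A * Real.exp (-(c * n)))) (u n) := fun n K hKV =>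
    h K a _ (u n) ha.le (by positivity) fun x hx j => hb n x (hKV hx) j
  have haL : 0 < a * L := by positivity
  refine ⟨fun n => ⟨(hu n).contDiffOn, fun K _ hKV => ⟨a * L, haL, _, key n K hKV⟩⟩,
    fun K _ hKV => ⟨lam, hlam, a * L, haL, C * A * D, fun n => ?_⟩⟩
  refine (key n K hKV).mono haL.le le_rfl ?_ (by positivity)
  calc C * (A * Real.exp (-(c * n))) ≤ C * (A * (D * Real.exp (-W.assoc (lam * n)))) := by
        gcongr; exact he n
    _ = _ := by ring

theorem NE.exists_isNegligible_cutoffSeq_mul (hNE : W.NE)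
    {u : ℕ+ → EuclideanSpace ℝ (Fin d) → ℂ} (hu : HasEntireGrowth u)
    {S : Set (EuclideanSpace ℝ (Fin d))} (hS : MeasurableSet S)
    {V : Opens (EuclideanSpace ℝ (Fin d))} {r δ : ℝ} (hV : ∀ x ∈ V, ‖x‖ ≤ r) (hδ : 0 < δ)
    (hd : ∀ x ∈ V, ∀ y ∈ S, δ ≤ dist x y) :
    ∃ R₀ : ℝ, 0 < R₀ ∧ ∀ R, R₀ ≤ R → W.IsNegligible V (cutoffSeq S R * u) := by
  obtain ⟨D, hD, hb⟩ := hu.exists_norm_iteratedFDeriv_cutoffSeq_mul_le r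
  -- For such `R` the exponent `D - Rδ²/8` is at most `-1`.
  refine ⟨8 * (D + 1) / δ ^ 2, by positivity, fun R hR => ?_⟩
  have hR0 : 0 < R := lt_of_lt_of_le (by positivity) hR
  refine hNE.isNegligible_of_norm_le (((hasEntireGrowth_cutoffSeq hS hR0).mul hu).1)
    (a := 16 * (d + 1) / δ + 1) (A := 1) (c := 1) (by positivity) zero_le_one one_pos
    fun n x hx j => (hb S R δ x hS hR0 (hV x hx) hδ (hd x hx) n j).trans ?_
  rw [one_mul]
  rw [div_le_iff₀ (by positivity)] at hR
  gcongr
  have hn : (0 : ℝ) < n := by exact_mod_cast n.pos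
  nlinarith

/-- On `V`, the sequence `G` represents the same generalized function as each of the sequences
`f i` given on `U i`. -/
def Agrees (W : WeightSequence) {ι : Type*} (U : ι → Opens (EuclideanSpace ℝ (Fin d)))
    (f : ι → ℕ+ → EuclideanSpace ℝ (Fin d) → ℂ) (G : ℕ+ → EuclideanSpace ℝ (Fin d) → ℂ)
    (V : Opens (EuclideanSpace ℝ (Fin d))) : Prop :=
  ∀ i, W.IsNegligible (V ⊓ U i) (G - f i)

variable {ι : Type*} {U : ι → Opens (EuclideanSpace ℝ (Fin d))}
  {f : ι → ℕ+ → EuclideanSpace ℝ (Fin d) → ℂ}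

theorem Agrees.mono {G : ℕ+ → EuclideanSpace ℝ (Fin d) → ℂ}
    {V V' : Opens (EuclideanSpace ℝ (Fin d))} (h : W.Agrees U f G V) (hV : V' ≤ V) :
    W.Agrees U f G V' := fun i => (h i).restrict (inf_le_inf_right _ hV)

theorem Agrees.of_locally {G : ℕ+ → EuclideanSpace ℝ (Fin d) → ℂ}
    {V : Opens (EuclideanSpace ℝ (Fin d))}
    (h : ∀ x ∈ V, ∃ V' : Opens (EuclideanSpace ℝ (Fin d)), x ∈ V' ∧ W.Agrees U f G V') :
    W.Agrees U f G V := fun i => .of_locally fun x hx => by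
  obtain ⟨V', hx', h'⟩ := h x hx.1
  exact ⟨V' ⊓ U i, ⟨hx', hx.2⟩, h' i⟩

theorem Agrees.add_negligible {G H : ℕ+ → EuclideanSpace ℝ (Fin d) → ℂ}
    {V : Opens (EuclideanSpace ℝ (Fin d))} (h : W.Agrees U f G V) (hH : W.IsNegligible V H) :
    W.Agrees U f (G + H) V := fun i => by
  have := (h i).add (hH.restrict inf_le_left)
  rwa [sub_add_eq_add_sub] at this

/-- Two sequences of entire growth that agree with the given family near `L₁` and near `L₂` can be
combined into one that does so near `L₁ ∪ L₂`. -/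
theorem Agrees.exists_combine (hM1 : W.M1) (hM2 : W.M2) (hNE : W.NE)
    {G₁ G₂ : ℕ+ → EuclideanSpace ℝ (Fin d) → ℂ} (hG₁ : HasEntireGrowth G₁)
    (hG₂ : HasEntireGrowth G₂) {V₁ V₂ : Opens (EuclideanSpace ℝ (Fin d))}
    (h₁ : W.Agrees U f G₁ V₁) (h₂ : W.Agrees U f G₂ V₂)
    {L₁ L₂ S : Set (EuclideanSpace ℝ (Fin d))} (hL₁ : IsCompact L₁) (hL₂ : IsCompact L₂)
    (hS : MeasurableSet S) (hLS : L₁ ⊆ interior S) (hSV : closure S ⊆ V₁) (hLV : L₂ ⊆ V₂) :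
    ∃ R₀ : ℝ, 0 < R₀ ∧ ∀ R, R₀ ≤ R → ∃ V : Opens (EuclideanSpace ℝ (Fin d)), L₁ ∪ L₂ ⊆ V ∧
      W.Agrees U f (cutoffSeq S R * G₁ + cutoffSeq Sᶜ R * G₂) V := by
  -- `N₁` surrounds `L₁` at positive distance from `Sᶜ`, and `N₂` surrounds the part of `L₂` outside
  -- `V₁` at positive distance from `S`. There the unwanted `G₁` or `G₂` is controlled only by its
  -- entire growth, which is why `R` has to be large.
  obtain ⟨N₁, r₁, δ₁, hLN₁, hδ₁, hr₁, hd₁⟩ := exists_isBounded_nhds_le_dist (S := Sᶜ) hL₁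
    isOpen_interior hLS (disjoint_compl_right_iff_subset.2 interior_subset)
  obtain ⟨N₂, r₂, δ₂, hLN₂, hδ₂, hr₂, hd₂⟩ := exists_isBounded_nhds_le_dist (S := S)
    (hL₂.diff V₁.isOpen) (isClosed_closure (s := S)).isOpen_compl
    (fun x hx hxS => hx.2 (hSV hxS)) (disjoint_compl_left_iff_subset.2 subset_closure)
  obtain ⟨Ra, hRa, ha⟩ := hNE.exists_isNegligible_cutoffSeq_mul hG₁ hS.compl hr₁ hδ₁ hd₁
  obtain ⟨Rb, hRb, hb⟩ := hNE.exists_isNegligible_cutoffSeq_mul hG₂ hS.compl hr₁ hδ₁ hd₁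
  obtain ⟨Rc, hRc, hc⟩ := hNE.exists_isNegligible_cutoffSeq_mul hG₁ hS hr₂ hδ₂ hd₂
  obtain ⟨Rd, hRd, hd⟩ := hNE.exists_isNegligible_cutoffSeq_mul hG₂ hS hr₂ hδ₂ hd₂
  refine ⟨Ra + Rb + Rc + Rd, by positivity, fun R hR => ?_⟩
  have hR0 : 0 < R := by linarith
  have ha := ha R (by linarith)
  have hb := hb R (by linarith)
  have hc := hc R (by linarith)
  have hd := hd R (by linarith)
  have hcompl : cutoffSeq Sᶜ R = 1 - cutoffSeq S R := (one_sub_cutoffSeq hS hR0).symm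
  -- On `N₁` the combination is `G₁` plus a negligible term, on `V₂ ⊓ N₂` it is `G₂` plus one. On
  -- `V₁ ⊓ V₂` both sequences agree with the family, and moderate coefficients with sum `1` preserve
  -- this.
  refine ⟨N₁ ⊔ (V₁ ⊓ V₂) ⊔ (V₂ ⊓ N₂), ?_, .of_locally fun x hx => ?_⟩
  · rintro x (hx | hx)
    · exact Or.inl (Or.inl (hLN₁ hx))
    · by_cases hx1 : x ∈ V₁
      · exact Or.inl (Or.inr ⟨hx1, hLV hx⟩)
      · exact Or.inr ⟨hLV hx, hLN₂ ⟨hx, hx1⟩⟩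
  rcases hx with (hx | hx) | hx
  · have hNV : N₁ ≤ V₁ := fun x hx => by
      refine hSV (subset_closure ?_)
      by_contra hxS
      have := hd₁ x hx x hxS
      rw [dist_self] at this
      linarith
    refine ⟨N₁, hx, ?_⟩
    have e : cutoffSeq S R * G₁ + cutoffSeq Sᶜ R * G₂
        = G₁ + (cutoffSeq Sᶜ R * G₂ - cutoffSeq Sᶜ R * G₁) := by rw [hcompl]; ring
    rw [e]
    exact (h₁.mono hNV).add_negligible (hb.sub ha)
  · refine ⟨V₁ ⊓ V₂, hx, fun i => ?_⟩
    have e : cutoffSeq S R * G₁ + cutoffSeq Sᶜ R * G₂ - f i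
        = cutoffSeq S R * (G₁ - f i) + cutoffSeq Sᶜ R * (G₂ - f i) := by rw [hcompl]; ring
    rw [e]
    exact (((h₁.mono inf_le_left) i).mul_left hM1 hM2 (isModerate_cutoffSeq hNE hS hR0 _)).add
      (((h₂.mono inf_le_right) i).mul_left hM1 hM2 (isModerate_cutoffSeq hNE hS.compl hR0 _))
  · refine ⟨V₂ ⊓ N₂, hx, ?_⟩
    have e : cutoffSeq S R * G₁ + cutoffSeq Sᶜ R * G₂
        = G₂ + (cutoffSeq S R * G₁ - cutoffSeq S R * G₂) := by rw [hcompl]; ring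
    rw [e]
    exact (h₂.mono inf_le_left).add_negligible ((hc.sub hd).restrict inf_le_right)

/-- Near every compact set a compatible family is represented by a sequence of entire growth. -/
theorem exists_agrees_of_isCompact (hM1 : W.M1) (hM2 : W.M2) (hNE : W.NE)
    (hf : ∀ i, W.IsModerate (U i) (f i))
    (hcomp : ∀ i j, W.IsNegligible (U i ⊓ U j) (f i - f j))
    {K : Set (EuclideanSpace ℝ (Fin d))} (hK : IsCompact K) (hKU : K ⊆ ⋃ i, (U i : Set _)) :
    ∃ G, HasEntireGrowth G ∧ ∃ V : Opens (EuclideanSpace ℝ (Fin d)), K ⊆ V ∧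
      W.Agrees U f G V := by
  -- The compact induction runs through arbitrary subsets, whereas combining two approximants needs
  -- compact sets; hence a compact `L` is carried along.
  suffices h : ∃ L : Set (EuclideanSpace ℝ (Fin d)), IsCompact L ∧ K ⊆ L ∧
      ∃ G, HasEntireGrowth G ∧ ∃ V : Opens (EuclideanSpace ℝ (Fin d)), L ⊆ V ∧
        W.Agrees U f G V by
    obtain ⟨L, _, hKL, G, hG, V, hLV, hA⟩ := h
    exact ⟨G, hG, V, hKL.trans hLV, hA⟩
  refine hK.induction_on (p := fun s => ∃ L : Set (EuclideanSpace ℝ (Fin d)), IsCompact L ∧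
    s ⊆ L ∧ ∃ G, HasEntireGrowth G ∧ ∃ V : Opens (EuclideanSpace ℝ (Fin d)), L ⊆ V ∧
        W.Agrees U f G V) ?_ ?_ ?_ ?_
  · exact ⟨∅, isCompact_empty, Subset.rfl, 0, .zero, ⊥, empty_subset _,
      .of_locally fun x hx => hx.elim⟩
  · rintro s t hst ⟨L, hL, htL, h⟩
    exact ⟨L, hL, hst.trans htL, h⟩
  · rintro s t ⟨L₁, hL₁, hs, G₁, hG₁, V₁, hV₁, hA₁⟩ ⟨L₂, hL₂, ht, G₂, hG₂, V₂, hV₂, hA₂⟩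
    obtain ⟨S, hSc, hLS, hSV⟩ := exists_compact_between hL₁ V₁.isOpen hV₁
    obtain ⟨R, hR, h⟩ := Agrees.exists_combine hM1 hM2 hNE hG₁ hG₂ hA₁ hA₂ hL₁ hL₂
      hSc.measurableSet hLS (hSc.isClosed.closure_eq.trans_subset hSV) hV₂
    obtain ⟨V, hV, hA⟩ := h R le_rfl
    exact ⟨L₁ ∪ L₂, hL₁.union hL₂, union_subset_union hs ht, _,
      ((hasEntireGrowth_cutoffSeq hSc.measurableSet hR).mul hG₁).add
        ((hasEntireGrowth_cutoffSeq hSc.measurableSet.compl hR).mul hG₂), V, hV, hA⟩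
  · intro x hx
    obtain ⟨i, hi⟩ := mem_iUnion.1 (hKU hx)
    obtain ⟨V, hxV, hVU, G, hG, hGf⟩ := (hf i).exists_hasEntireGrowth_sub hM1 hM2 hNE hi
    obtain ⟨L, hL, hLV⟩ := local_compact_nhds (V.isOpen.mem_nhds hxV)
    refine ⟨L, mem_nhdsWithin_of_mem_nhds hL, L, hLV.2, Subset.rfl, G, hG, V, hLV.1, fun j => ?_⟩
    have h1 := (hGf.restrict (inf_le_left (b := U j))).add
      ((hcomp i j).restrict (inf_le_inf_right (U j) hVU))
    rwa [sub_add_sub_cancel] at h1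

end WeightSequence

end Gluing

/-! ### Passage to the limit along a compact exhaustion -/

section Exhaustion

theorem exists_seq_of_forall_exists {X : Type*} {Q : ℕ → X → Prop} {r : ℕ → X → X → Prop}
    (h0 : ∃ x, Q 0 x) (h : ∀ m x, Q m x → ∃ y, Q (m + 1) y ∧ r m x y) :
    ∃ u : ℕ → X, ∀ m, Q m (u m) ∧ r m (u m) (u (m + 1)) := by
  choose! s hs hr using h
  obtain ⟨x, hx⟩ := h0
  have hQ : ∀ m, Q m (Nat.rec x s m : X) := fun m => by
    induction m with
    | zero => exact hx
    | succ m ih => exact hs m _ ih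
  exact ⟨fun m => Nat.rec x s m, fun m => ⟨hQ m, hr m _ (hQ m)⟩⟩

theorem exists_compact_exhaustion {d : ℕ} (Ω : Opens (EuclideanSpace ℝ (Fin d))) :
    ∃ K : ℕ → Set (EuclideanSpace ℝ (Fin d)), (∀ m, IsCompact (K m)) ∧
      (∀ m, K m ⊆ interior (K (m + 1))) ∧ ⋃ m, K m = Ω := by
  have : LocallyCompactSpace Ω := Ω.isOpen.locallyCompactSpace
  let c := CompactExhaustion.choice Ω
  refine ⟨fun m => Subtype.val '' c m, fun m => (c.isCompact m).image continuous_subtype_val,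
    fun m => ?_, ?_⟩
  · exact interior_maximal (image_mono interior_subset)
      (Ω.isOpen.isOpenMap_subtype_val _ isOpen_interior) |>.trans'
        (image_mono (c.subset_interior_succ m))
  · rw [← image_iUnion, c.iUnion_eq, image_univ, Subtype.range_coe]

variable {d : ℕ}

namespace WeightSequence

variable {W : WeightSequence} {ι : Type*} {U : ι → Opens (EuclideanSpace ℝ (Fin d))}
  {f : ι → ℕ+ → EuclideanSpace ℝ (Fin d) → ℂ}

/-- The approximants on an exhaustion can be chosen such that consecutive ones differ by rapidly
decreasing quantities. -/
theorem exists_seq_agrees (hM1 : W.M1) (hM2 : W.M2) (hNE : W.NE)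
    (hf : ∀ i, W.IsModerate (U i) (f i))
    (hcomp : ∀ i j, W.IsNegligible (U i ⊓ U j) (f i - f j))
    {K : ℕ → Set (EuclideanSpace ℝ (Fin d))} (hK : ∀ m, IsCompact (K m))
    (hKU : ∀ m, K m ⊆ ⋃ i, (U i : Set _)) :
    ∃ G : ℕ → ℕ+ → EuclideanSpace ℝ (Fin d) → ℂ, ∀ m,
      (HasEntireGrowth (G m) ∧ ∃ V : Opens (EuclideanSpace ℝ (Fin d)), K m ⊆ V ∧
        W.Agrees U f (G m) V) ∧
      ∀ (x : EuclideanSpace ℝ (Fin d)) (δ : ℝ), 0 < δ → (∀ y ∉ K m, δ ≤ dist x y) →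
        1 ≤ m * δ ^ 2 → ∀ (n : ℕ+) (j : ℕ), ‖iteratedFDeriv ℝ j ((G (m + 1) - G m) n) x‖
          ≤ Real.exp (-(m * n)) * ((16 * (d + 1) / δ + 1) ^ j * j.factorial) := by
  refine exists_seq_of_forall_exists (Q := fun m G => HasEntireGrowth G ∧
    ∃ V : Opens (EuclideanSpace ℝ (Fin d)), K m ⊆ V ∧ W.Agrees U f G V)
    (r := fun m G G' => ∀ (x : EuclideanSpace ℝ (Fin d)) (δ : ℝ), 0 < δ →
      (∀ y ∉ K m, δ ≤ dist x y) → 1 ≤ m * δ ^ 2 → ∀ (n : ℕ+) (j : ℕ),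
      ‖iteratedFDeriv ℝ j ((G' - G) n) x‖
        ≤ Real.exp (-(m * n)) * ((16 * (d + 1) / δ + 1) ^ j * j.factorial))
    (exists_agrees_of_isCompact hM1 hM2 hNE hf hcomp (hK 0) (hKU 0)) ?_
  rintro m G ⟨hG, V, hV, hA⟩
  obtain ⟨F, hF, V', hV', hA'⟩ :=
    exists_agrees_of_isCompact hM1 hM2 hNE hf hcomp (hK (m + 1)) (hKU (m + 1))
  obtain ⟨S, hSc, hLS, hSV⟩ := exists_compact_between (hK m) V.isOpen hV
  have hS := hSc.measurableSet
  obtain ⟨R₀, hR₀, h⟩ := Agrees.exists_combine hM1 hM2 hNE hG hF hA hA' (hK m) (hK (m + 1))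
      hS hLS (hSc.isClosed.closure_eq.trans_subset hSV) hV'
  obtain ⟨r, hr⟩ := (hK m).isBounded.exists_norm_le
  obtain ⟨D, hD, hb⟩ := (hF.sub hG).exists_norm_iteratedFDeriv_cutoffSeq_mul_le r
  -- `R` must be fixed before `δ`. Since `mδ² ≥ 1`, this choice gives `Rδ²/8 ≥ D + m`, that is,
  -- decay `e^{-mn}` uniformly for all admissible points.
  set R : ℝ := R₀ + 8 * (D + m) * m with hR
  have hR0 : 0 < R := by positivity
  obtain ⟨V'', hV'', hA''⟩ := h R (le_add_of_nonneg_right (by positivity))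
  refine ⟨_, ⟨((hasEntireGrowth_cutoffSeq hS hR0).mul hG).add
    ((hasEntireGrowth_cutoffSeq hS.compl hR0).mul hF), V'', subset_union_right.trans hV'', hA''⟩,
    fun x δ hδ hx hm n j => ?_⟩
  have e : cutoffSeq S R * G + cutoffSeq Sᶜ R * F - G = cutoffSeq Sᶜ R * (F - G) := by
    rw [← one_sub_cutoffSeq hS hR0]; ring
  rw [e]
  have hxK : x ∈ K m := by
    by_contra hxK
    have := hx x hxK
    rw [dist_self] at this
    linarith
  refine (hb Sᶜ R δ x hS.compl hR0 (hr x hxK) hδ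
    (fun y hy => hx y fun hyK => hy (interior_subset (hLS hyK))) n j).trans ?_
  have hn : (0 : ℝ) < n := by exact_mod_cast n.pos
  have h1 : D - R * δ ^ 2 / 8 ≤ -m := by
    have h2 : (D + m) * 1 ≤ (D + m) * (m * δ ^ 2) := by gcongr
    have h3 : 0 ≤ R₀ * δ ^ 2 := by positivity
    have h4 : R * δ ^ 2 = R₀ * δ ^ 2 + 8 * ((D + m) * (m * δ ^ 2)) := by rw [hR]; ring
    linarith
  rw [← neg_mul]
  gcongr

/-- A compatible family of moderate sequences can be glued. -/
theorem exists_glue (hM1 : W.M1) (hM2 : W.M2) (hNE : W.NE)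
    (hf : ∀ i, W.IsModerate (U i) (f i))
    (hcomp : ∀ i j, W.IsNegligible (U i ⊓ U j) (f i - f j)) :
    ∃ F : ℕ+ → EuclideanSpace ℝ (Fin d) → ℂ, ∀ i, W.IsNegligible (U i) (F - f i) := by
  obtain ⟨K, hK, hKi, hKU⟩ := exists_compact_exhaustion (⨆ i, U i)
  rw [Opens.coe_iSup] at hKU
  have hmono : Monotone K := monotone_nat_of_le_succ fun m => (hKi m).trans interior_subset
  obtain ⟨G, hG⟩ := exists_seq_agrees hM1 hM2 hNE hf hcomp hK fun m =>
    (subset_iUnion K m).trans hKU.subset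
  -- The diagonal sequence. Near a given point its difference from a fixed `G M` telescopes into at
  -- most `n` terms of size `e^{-mn} ≤ e^{-n}`, so it represents the same generalized function
  -- there.
  refine ⟨fun n => G n n, fun i => .of_locally fun x hx => ?_⟩
  obtain ⟨J, hJ⟩ : ∃ J, x ∈ K J :=
    mem_iUnion.1 (hKU.symm.subset (mem_iUnion.2 ⟨i, hx⟩))
  let N : Opens (EuclideanSpace ℝ (Fin d)) := ⟨interior (K (J + 1)), isOpen_interior⟩
  have hNK : ∀ y ∈ N, y ∈ K (J + 1) := fun y hy => interior_subset hy
  obtain ⟨δ, hδ, hd⟩ := exists_pos_le_dist (S := (K (J + 2))ᶜ) (hK (J + 1)) isOpen_interior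
    (hKi (J + 1)) (disjoint_compl_right_iff_subset.2 interior_subset)
  obtain ⟨M₀, hM₀⟩ := exists_nat_ge (1 / δ ^ 2)
  set M := J + 2 + M₀ with hM
  have hdM : ∀ m, M ≤ m → 1 ≤ (m : ℝ) * δ ^ 2 := fun m hm => by
    rw [div_le_iff₀ (by positivity)] at hM₀
    have : (M₀ : ℝ) ≤ m := by exact_mod_cast (show M₀ ≤ m by omega)
    refine hM₀.trans ?_
    gcongr
  have key : W.IsNegligible N (fun n => G n n - G M n) := by
    have hcd : ∀ n : ℕ+, ContDiff ℝ ∞ (G n n - G M n) := fun n =>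
      ((hG n).1.1.1 n).sub ((hG M).1.1.1 n)
    -- Only the finitely many indices `n ≤ M` use this bound; its dependence on `n` is harmless.
    have hloc : ∀ n : ℕ+, ∃ B : ℝ, 0 ≤ B ∧ ∀ y ∈ N, ∀ j,
        ‖iteratedFDeriv ℝ j (G n n - G M n) y‖ ≤ B * (1 ^ j * j.factorial) := by
      intro n
      obtain ⟨r, hr⟩ := (hK (J + 1)).isBounded.exists_norm_le
      obtain ⟨C, hC, hb⟩ := ((hG n).1.1.sub (hG M).1.1).2 1 one_pos
      refine ⟨C * Real.exp (C * (n * (1 + r ^ 2))), by positivity, fun y hy j =>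
        (hb n j y).trans ?_⟩
      have := hr y (hNK y hy)
      gcongr
    choose B hB0 hB using hloc
    set P : Finset ℕ+ := Finset.Icc 1 ⟨M, by omega⟩ with hP
    set a := 16 * (d + 1) / δ + 1 with ha
    have ha1 : 1 ≤ a := le_add_of_nonneg_left (by positivity)
    -- The `2` comes from `n ≤ 2e^{n/2}`, which absorbs the number of telescoping terms; the sum
    -- handles `n ≤ M`, with `e^M` compensating `e^{-n/2}`.
    set A := 2 + (∑ n ∈ P, B n) * Real.exp M with hA
    have hsum : 0 ≤ ∑ n ∈ P, B n := Finset.sum_nonneg fun n _ => hB0 n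
    refine hNE.isNegligible_of_norm_le hcd (a := a) (A := A) (c := 1 / 2) (by positivity)
      (by positivity) (by norm_num) fun n y hy j => ?_
    rcases le_total M n with hMn | hnM
    · have e : G n n - G M n = ∑ m ∈ Finset.Ico M (n : ℕ), (G (m + 1) - G m) n := by
        have := congrFun (Finset.sum_Ico_sub G hMn) n
        rw [Finset.sum_apply] at this
        exact this.symm
      have hsm : ∀ m ∈ Finset.Ico M (n : ℕ), ContDiffAt ℝ j ((G (m + 1) - G m) n) y := fun m _ =>
        ((((hG (m + 1)).1.1.1 n).sub ((hG m).1.1.1 n)).of_le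
          (by exact_mod_cast le_top)).contDiffAt
      rw [e, iteratedFDeriv_sum_apply hsm]
      refine (norm_sum_le _ _).trans ?_
      have hn0 : (0 : ℝ) ≤ n := Nat.cast_nonneg _
      calc ∑ m ∈ Finset.Ico M (n : ℕ), ‖iteratedFDeriv ℝ j ((G (m + 1) - G m) n) y‖
          ≤ ∑ m ∈ Finset.Ico M (n : ℕ), Real.exp (-n) * (a ^ j * j.factorial) := by
            refine Finset.sum_le_sum fun m hm => ?_
            have hMm := (Finset.mem_Ico.1 hm).1
            refine ((hG m).2 y δ hδ (fun z hz => hd y (hNK y hy) z fun hz' =>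
              hz (hmono (by omega) hz')) (hdM m hMm) n j).trans ?_
            have hm1 : (1 : ℝ) ≤ m := by exact_mod_cast (show 1 ≤ m by omega)
            gcongr
            nlinarith
        _ = ((n : ℕ) - M : ℕ) * (Real.exp (-n) * (a ^ j * j.factorial)) := by
            rw [Finset.sum_const, Nat.card_Ico, nsmul_eq_mul]
        _ ≤ n * (Real.exp (-n) * (a ^ j * j.factorial)) := by
            gcongr
            exact Nat.sub_le _ _
        _ ≤ 2 * Real.exp (1 / 2 * n) * (Real.exp (-n) * (a ^ j * j.factorial)) := by
            have := Real.add_one_le_exp (1 / 2 * (n : ℝ))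
            gcongr
            linarith
        _ = 2 * Real.exp (-(1 / 2 * n)) * (a ^ j * j.factorial) := by
            have : Real.exp (-(1 / 2 * (n : ℝ))) = Real.exp (1 / 2 * n) * Real.exp (-n) := by
              rw [← Real.exp_add]; congr 1; ring
            rw [this]; ring
        _ ≤ _ := by
            gcongr
            exact le_add_of_nonneg_right (by positivity)
    · refine (hB n y hy j).trans ?_
      have hnP : n ∈ P := Finset.mem_Icc.2 ⟨one_le, hnM⟩
      have h1 := Finset.single_le_sum (f := B) (fun n _ => hB0 n) hnP
      have h2 : (1 : ℝ) ≤ Real.exp M * Real.exp (-(1 / 2 * n)) := by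
        rw [← Real.exp_add]
        refine Real.one_le_exp ?_
        have : (n : ℝ) ≤ M := by exact_mod_cast hnM
        have : (0 : ℝ) ≤ n := Nat.cast_nonneg _
        linarith
      have h3 : B n ≤ A * Real.exp (-(1 / 2 * n)) := by
        calc B n ≤ (∑ n ∈ P, B n) * 1 := by linarith
          _ ≤ (∑ n ∈ P, B n) * (Real.exp M * Real.exp (-(1 / 2 * n))) := by gcongr
          _ ≤ A * Real.exp (-(1 / 2 * n)) := by
              rw [← mul_assoc]
              gcongr
              linarith
      gcongr
  obtain ⟨V, hV, hA⟩ := (hG M).1.2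
  have hNV : N ≤ V := fun y hy => hV (hmono (by omega) (hNK y hy))
  refine ⟨N ⊓ U i, ⟨hKi J hJ, hx⟩, ?_⟩
  have h := (key.restrict inf_le_left).add ((hA.mono hNV) i)
  convert h using 1
  funext n
  simp

theorem exists_moderate_glue (hM1 : W.M1) (hM2 : W.M2) (hNE : W.NE)
    (hf : ∀ i, W.IsModerate (U i) (f i))
    (hcomp : ∀ i j, W.IsNegligible (U i ⊓ U j) (f i - f j)) :
    ∃ F : ℕ+ → EuclideanSpace ℝ (Fin d) → ℂ, W.IsModerate (⨆ i, U i) F ∧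
      ∀ i, W.IsNegligible (U i) (F - f i) := by
  obtain ⟨F, hF⟩ := exists_glue hM1 hM2 hNE hf hcomp
  refine ⟨F, .of_locally fun x hx => ?_, hF⟩
  obtain ⟨i, hi⟩ := Opens.mem_iSup.1 hx
  have := (hF i).isModerate.add (hf i)
  rw [sub_add_cancel] at this
  exact ⟨U i, hi, this⟩

end WeightSequence

end Exhaustion

/-! ### The sheaf property and softness -/

section Sheaf

namespace WeightSequence

variable {W : WeightSequence} {hM1 : W.M1} {hM2 : W.M2} {d : ℕ}

/-- The generalized function represented by a moderate sequence. -/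
noncomputable def IsModerate.toGenFun (hM1 : W.M1) (hM2 : W.M2)
    {Ω : Opens (EuclideanSpace ℝ (Fin d))} {f : ℕ+ → EuclideanSpace ℝ (Fin d) → ℂ}
    (hf : W.IsModerate Ω f) : W.GenFun hM1 hM2 Ω :=
  Ideal.Quotient.mk (W.negligible hM1 hM2 Ω) ⟨f, hf⟩

theorem GenFun.exists_rep {Ω : Opens (EuclideanSpace ℝ (Fin d))} (s : W.GenFun hM1 hM2 Ω) :
    ∃ (f : ℕ+ → EuclideanSpace ℝ (Fin d) → ℂ) (hf : W.IsModerate Ω f),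
      hf.toGenFun hM1 hM2 = s := by
  obtain ⟨f, rfl⟩ := Ideal.Quotient.mk_surjective s
  exact ⟨f.1, f.2, rfl⟩

theorem IsModerate.toGenFun_eq_iff {Ω : Opens (EuclideanSpace ℝ (Fin d))}
    {f g : ℕ+ → EuclideanSpace ℝ (Fin d) → ℂ} (hf : W.IsModerate Ω f) (hg : W.IsModerate Ω g) :
    hf.toGenFun hM1 hM2 = hg.toGenFun hM1 hM2 ↔ W.IsNegligible Ω (f - g) :=
  Ideal.Quotient.mk_eq_mk_iff_sub_mem _ _

theorem isSheaf_genFunPresheaf (hM1 : W.M1) (hM2 : W.M2) (hNE : W.NE) (d : ℕ) :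
    (W.genFunPresheaf hM1 hM2 d).IsSheaf := by
  rw [TopCat.Presheaf.isSheaf_iff_isSheafUniqueGluing]
  intro ι U sf hcomp
  choose f hf hfs using fun i => GenFun.exists_rep (W := W) (hM1 := hM1) (hM2 := hM2) (sf i)
  obtain rfl : (fun i => (hf i).toGenFun hM1 hM2) = sf := funext hfs
  have hneg : ∀ i j, W.IsNegligible (U i ⊓ U j) (f i - f j) := fun i j =>
    (IsModerate.toGenFun_eq_iff ((hf i).restrict inf_le_left)
      ((hf j).restrict inf_le_right)).1 (hcomp i j)
  obtain ⟨F, hF, hFf⟩ := exists_moderate_glue hM1 hM2 hNE hf hneg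
  refine ⟨hF.toGenFun hM1 hM2, fun i => ?_, fun s hs => ?_⟩
  · exact (IsModerate.toGenFun_eq_iff (hF.restrict (le_iSup U i)) (hf i)).2 (hFf i)
  -- Uniqueness: two gluings differ on each `U i` by a negligible sequence, and negligibility is
  -- local.
  · obtain ⟨G, hG, rfl⟩ := GenFun.exists_rep (W := W) (hM1 := hM1) (hM2 := hM2) s
    refine (IsModerate.toGenFun_eq_iff hG hF).2 (.of_locally fun x hx => ?_)
    obtain ⟨i, hi⟩ := Opens.mem_iSup.1 hx
    have h1 : W.IsNegligible (U i) (G - f i) :=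
      (IsModerate.toGenFun_eq_iff (hG.restrict (le_iSup U i)) (hf i)).1 (hs i)
    have h2 := h1.sub (hFf i)
    rw [sub_sub_sub_cancel_right] at h2
    exact ⟨U i, hi, h2⟩

/-- Softness in terms of representatives. -/
theorem IsModerate.exists_extension (hM1 : W.M1) (hM2 : W.M2) (hNE : W.NE)
    {Z : Set (EuclideanSpace ℝ (Fin d))} (hZ : IsClosed Z)
    {U : Opens (EuclideanSpace ℝ (Fin d))} (hZU : Z ⊆ U)
    {f : ℕ+ → EuclideanSpace ℝ (Fin d) → ℂ} (hf : W.IsModerate U f) :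
    ∃ (g : ℕ+ → EuclideanSpace ℝ (Fin d) → ℂ) (V : Opens (EuclideanSpace ℝ (Fin d))),
      V ≤ U ∧ Z ⊆ V ∧ W.IsModerate ⊤ g ∧ W.IsNegligible V (g - f) := by
  obtain ⟨T, hT, hZT, hTU⟩ := normal_exists_closure_subset hZ U.isOpen hZU
  have hTm := hT.measurableSet
  let χ := cutoffSeq T 1
  have hχ : ∀ Ω, W.IsModerate Ω χ := isModerate_cutoffSeq hNE hTm one_pos
  -- The product `χ * f` on `U` is glued with `0` off `closure T`. They are compatible because `χ`
  -- is negligible off `closure T` and `f` is moderate; the ideal property makes the scale `R = 1`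
  -- sufficient.
  let U' : Bool → Opens (EuclideanSpace ℝ (Fin d)) := fun b =>
    if b then U else ⟨(closure T)ᶜ, isClosed_closure.isOpen_compl⟩
  let f' : Bool → ℕ+ → EuclideanSpace ℝ (Fin d) → ℂ := fun b => if b then χ * f else 0
  have hf' : ∀ b, W.IsModerate (U' b) (f' b) := by
    rintro (_ | _)
    · exact (IsNegligible.zero W _).isModerate
    · exact (hχ U).mul hM1 hM2 hf
  have hneg : W.IsNegligible (U ⊓ U' false) (χ * f) := by
    rw [mul_comm]
    refine IsNegligible.mul_left hM1 hM2 (hf.restrict inf_le_left)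
      (isNegligible_cutoffSeq hNE hTm one_pos ?_)
    exact Set.disjoint_left.2 fun x hx hxT => hx.2 (subset_closure hxT)
  have hcomp : ∀ b c, W.IsNegligible (U' b ⊓ U' c) (f' b - f' c) := by
    rintro (_ | _) (_ | _)
    · simpa [f'] using IsNegligible.zero W _
    · have := hneg.neg
      rw [inf_comm] at this
      rw [show f' false - f' true = -(χ * f) from zero_sub _]
      exact this
    · rw [show f' true - f' false = χ * f from sub_zero _]
      exact hneg
    · simpa [f'] using IsNegligible.zero W _
  obtain ⟨g, hg, hgf⟩ := exists_moderate_glue hM1 hM2 hNE hf' hcomp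
  have htop : ⨆ b, U' b = ⊤ := by
    rw [eq_top_iff]
    intro x _
    by_cases hx : x ∈ closure T
    · exact Opens.mem_iSup.2 ⟨true, hTU hx⟩
    · exact Opens.mem_iSup.2 ⟨false, hx⟩
  rw [htop] at hg
  have hTU' : (⟨T, hT⟩ : Opens (EuclideanSpace ℝ (Fin d))) ≤ U := subset_closure.trans hTU
  refine ⟨g, ⟨T, hT⟩, hTU', hZT, hg, ?_⟩
  have h1 : W.IsNegligible ⟨T, hT⟩ (g - χ * f) := (hgf true).restrict hTU'
  -- On `T` the factor `1 - χ` is negligible, so `χ * f` and `f` represent the same section there.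
  have h2 : W.IsNegligible ⟨T, hT⟩ (f * (1 - χ)) :=
    IsNegligible.mul_left hM1 hM2 (hf.restrict hTU')
      (isNegligible_one_sub_cutoffSeq hNE hTm one_pos Subset.rfl)
  have h3 := h1.sub h2
  have e : g - χ * f - f * (1 - χ) = g - f := by ring
  rwa [e] at h3

end WeightSequence

end Sheaf

theorem mainTheorem5 (W : WeightSequence) (hM1 : W.M1) (hM2 : W.M2) (hM2s : W.M2Star)
    (hQA : W.QA) (hNE : W.NE) (d : ℕ) :
    (W.genFunPresheaf hM1 hM2 d).IsSheaf ∧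
    IsSoftPresheaf (W.genFunPresheaf hM1 hM2 d) ∧
    ∀ Ω Ω' : Opens (EuclideanSpace ℝ (Fin d)),
      ∀ hΩ : closure (Ω' : Set (EuclideanSpace ℝ (Fin d))) ⊆ Ω,
      IsCompact (closure (Ω' : Set (EuclideanSpace ℝ (Fin d)))) →
      ∀ f : W.GenFun hM1 hM2 Ω, ∃ g : W.GenFun hM1 hM2 (⊤ : Opens (EuclideanSpace ℝ (Fin d))),
        W.restrictHom hM1 hM2 (le_top : Ω' ≤ ⊤) g =
          W.restrictHom hM1 hM2 (subset_closure.trans hΩ : Ω' ≤ Ω) f := by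
  refine ⟨W.isSheaf_genFunPresheaf hM1 hM2 hNE d, ?_, ?_⟩
  · intro Z hZ U hZU s
    obtain ⟨f, hf, rfl⟩ :=
      WeightSequence.GenFun.exists_rep (W := W) (hM1 := hM1) (hM2 := hM2) (d := d) s
    obtain ⟨g, V, hVU, hZV, hg, hgf⟩ := hf.exists_extension hM1 hM2 hNE hZ hZU
    exact ⟨hg.toGenFun hM1 hM2, V, hVU, hZV,
      (WeightSequence.IsModerate.toGenFun_eq_iff (hg.restrict le_top) (hf.restrict hVU)).2 hgf⟩
  · intro Ω Ω' hΩ _ f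
    obtain ⟨f, hf, rfl⟩ := f.exists_rep
    obtain ⟨g, V, hVU, hZV, hg, hgf⟩ :=
      hf.exists_extension hM1 hM2 hNE isClosed_closure hΩ
    have hΩ'V : Ω' ≤ V := subset_closure.trans hZV
    exact ⟨hg.toGenFun hM1 hM2,
      (WeightSequence.IsModerate.toGenFun_eq_iff (hg.restrict le_top)
        (hf.restrict (hΩ'V.trans hVU))).2 (hgf.restrict hΩ'V)⟩
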